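/- **Notation.** For a Banach space $B$, $C_\infty(\mathbb R,B)$ is the Banach space of continuous functions $\mathbb R\to B$ vanishing at infinity, with the supremum norm, and $C^1_\infty(\mathbb R,B)$ is the space of the differentiable $f$ with $f,f'\in C_\infty(\mathbb R,B)$, with the norm $\|f\|+\|f'\|$; an intersection of two such spaces carries the sum of the norms. A *core* of the generator of a strongly continuous semigroup is a subspace of its domain such that the generator is the closure of its restriction to this subspace. $C_{kill(a)}([a,b],B)$ is the space of continuous $f:[a,b]\to B$ with $f(a)=0$, and $C_{kill(a)}([a,\infty),B)$ is the space of $f\in C_\infty(\mathbb R,B)$ vanishing on $(-\infty,a]$. **Setting.** Let $\tilde D\subset D\subset B$ be Banach spaces with $\|\cdot\|_{\tilde D}\ge\|\cdot\|_D\ge\|\cdot\|_B$ and with $\tilde D$ dense in $D$ and in $B$. Let $A(x)$, $x\in\mathbb R$, be a uniformly bounded and strongly continuous family in $\mathcal L(D,B)$ which is also a uniformly bounded and strongly continuous family in $\mathcal L(\tilde D,D)$. Let every $A(x)$ generate a strongly continuous semigroup $e^{tA(x)}$ in $B$ with core $D$, whose restriction to $D$ is a strongly continuous semigroup in $D$ with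 core $\tilde D$, and which restricts further to a semigroup of bounded operators in $\tilde D$; in each of $B,D,\tilde D$ let these operators be bounded uniformly in $x\in\mathbb R$ and $t$ from any compact segment. Let $\nu$ be a bounded measure on $(0,\infty)$, $\|\nu\|$ its total mass, and $$L'_\nu f(x)=\int_0^\infty (f(x-y)-f(x))\,\nu(dy).$$ **Theorem.** (i) The operator $L'_\nu+A(\cdot)$ generates a strongly continuous semigroup $\Phi_t$ in $C_\infty(\mathbb R,B)$ with the invariant core $C_\infty(\mathbb R,D)$, and $\Phi_t$ is also a strongly continuous semigroup in $C_\infty(\mathbb R,D)$. For $t\ge0$, $Y\in C_\infty(\mathbb R,B)$ and $x\in\mathbb R$, $$\Phi_tY(x)=e^{-t\|\nu\|}\Bigl[e^{tA(x)}Y(x)+\sum_{m=1}^\infty\int_{0\le s_1\le\cdots\le s_m\le t}ds_1\cdots ds_m\,\nu(dz_1)\cdots\nu(dz_m)\; e^{s_1A(x)}e^{(s_2-s_1)A(x-z_1)}\cdots e^{(t-s_m)A(x-z_1-\cdots-z_m)}\,Y(x-z_1-\cdots-z_m)\Bigr],$$ with integrable integrands and a convergent series in $B$. Equivalently, with the paths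 $Z_x(\tau)=x-\sum_{j:\,s_j\le\tau}z_j$, $$\Phi_tY(x)=e^{-t\|\nu\|}\Bigl[e^{tA(x)}Y(x)+\sum_{m=1}^\infty\int_{0\le s_1\le\cdots\le s_m\le t}ds_1\cdots ds_m\,\nu(dz_1)\cdots\nu(dz_m)\; \exp\Bigl\{\int_0^{s_1}A(Z_x(\tau))d\tau\Bigr\}\exp\Bigl\{\int_{s_1}^{s_2}A(Z_x(\tau))d\tau\Bigr\}\cdots\exp\Bigl\{\int_{s_m}^tA(Z_x(\tau))d\tau\Bigr\}Y(Z_x(t))\Bigr],$$ where $\exp G$, for an operator $G:D\to B$ generating a strongly continuous semigroup in $B$ with core $D$, is the value of this semigroup at time $1$. (ii) For all $a<b$, the operators $\Phi_t$ form strongly continuous semigroups also in $C_{kill(a)}([a,\infty),B)$, which is a closed subspace of $C_\infty(\mathbb R,B)$, and in $C_{kill(a)}([a,b],B)$; on the latter $\Phi_tf$ is the restriction to $[a,b]$ of $\Phi_tY$ for any $Y\in C_{kill(a)}([a,\infty),B)$ with $Y|_{[a,b]}=f$ (such $Y$ exist, and the result does not depend on the choice). (iii) Suppose in addition that $x\mapsto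 A(x)$ is differentiable as a map $\mathbb R\to\mathcal L(D,B)$ and as a map $\mathbb R\to\mathcal L(\tilde D,D)$, with derivatives that are uniformly bounded and strongly continuous in $\mathcal L(D,B)$ and in $\mathcal L(\tilde D,D)$. Then $\Phi_t$ restricts to a strongly continuous semigroup in $C^1_\infty(\mathbb R,B)\cap C_\infty(\mathbb R,D)$, generated there by $L'_\nu+A(\cdot)$ with the core $C^1_\infty(\mathbb R,D)\cap C_\infty(\mathbb R,\tilde D)$. If moreover the operators $e^{tA(x)}$ in $\tilde D$ are strongly continuous in $t\ge0$ for every $x$ and strongly continuous in $x$ for every $t$, then this core is invariant under $\Phi_t$ and the $\Phi_t$ are bounded operators in $C^1_\infty(\mathbb R,D)\cap C_\infty(\mathbb R,\tilde D)$ equipped with its own Banach topology. -/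

import Mathlib

open Set Filter Topology MeasureTheory
open scoped ZeroAtInfty

noncomputable section

/-! ### Strongly continuous semigroups, generators and cores -/

section Semigroups

variable {X : Type*} [NormedAddCommGroup X] [NormedSpace ℝ X]

/-- `T` is a strongly continuous semigroup of bounded operators in `X`; only the values `T t` with
`t ≥ 0` matter. -/
structure IsC0Semigroup (T : ℝ → X →L[ℝ] X) : Prop where
  zero : T 0 = 1
  add : ∀ s t : ℝ, 0 ≤ s → 0 ≤ t → T (s + t) = T s * T t
  cont : ∀ f : X, ContinuousOn (fun t => T t f) (Ici 0)

/-- The graph of the generator of `T`: the pairs `(f, g)` with `(T h f - f) / h → g` as `h → 0+`. -/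
def generatorGraph (T : ℝ → X →L[ℝ] X) : Set (X × X) :=
  {p | Tendsto (fun h : ℝ => h⁻¹ • (T h p.1 - p.1)) (𝓝[>] 0) (𝓝 p.2)}

/-- `T` is a strongly continuous semigroup in `X` and the operator `j e ↦ G e` with the domain
`j E ⊆ X` is a restriction of its generator to a core: the generator is the closure of this
operator. -/
def GeneratesWithCore {E : Type*} (T : ℝ → X →L[ℝ] X) (j G : E → X) : Prop :=
  IsC0Semigroup T ∧ closure (range fun e => (j e, G e)) = generatorGraph T

end Semigroups

section Spaces

variable {B D : Type*} [NormedAddCommGroup B] [NormedSpace ℝ B]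
  [NormedAddCommGroup D] [NormedSpace ℝ D]

open Classical in
/-- The operator exponential `exp G` of an operator `G : D → B`, where `D` is embedded in `B`
by `ι`: the value at time `1` of the strongly continuous semigroup in `B` that is generated by `G`
with the core `D` (and `0` if there is no such semigroup). -/
def opExp (ι G : D →L[ℝ] B) : B →L[ℝ] B :=
  if h : ∃ T : ℝ → B →L[ℝ] B, GeneratesWithCore T ι G then h.choose 1 else 0

/-! ### Function spaces -/

/-- The map `C_∞(ℝ, D) → C_∞(ℝ, B)`, `f ↦ ι ∘ f`; for an embedding `ι` it is the inclusion. -/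
def mapC0 (ι : D →L[ℝ] B) (f : C₀(ℝ, D)) : C₀(ℝ, B) where
  toFun x := ι (f x)
  continuous_toFun := ι.continuous.comp (map_continuous f)
  zero_at_infty' := by
    have h := (ι.continuous.tendsto 0).comp (zero_at_infty f)
    simpa [Function.comp_def] using h

/-- The space `C¹_∞(ℝ, B) ∩ C_∞(ℝ, D)`, where `D` is embedded in `B` by `ι`. An element is a function
`f ∈ C_∞(ℝ, D)` that is differentiable as a `B`-valued function with a derivative in `C_∞(ℝ, B)`;
it is stored as the pair `(f, f')`. The norm is the larger of the norms of `f` in `C_∞(ℝ, D)` and of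
`f'` in `C_∞(ℝ, B)`; see `C1Space.norm_equiv` for its equivalence with the sum of the norms of `f`
in `C¹_∞(ℝ, B)` and in `C_∞(ℝ, D)`. -/
def C1Space (ι : D →L[ℝ] B) : Submodule ℝ (C₀(ℝ, D) × C₀(ℝ, B)) where
  carrier := {p | ∀ x, HasDerivAt (fun y => ι (p.1 y)) (p.2 x) x}
  add_mem' := by
    intro p q hp hq x
    have h := (hp x).add (hq x)
    refine h.congr_of_eventuallyEq (Eventually.of_forall fun y => ?_)
    simp
  zero_mem' := by
    intro x
    simpa using hasDerivAt_const x (0 : B)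
  smul_mem' := by
    intro c p hp x
    have h := (hp x).const_smul c
    refine h.congr_of_eventuallyEq (Eventually.of_forall fun y => ?_)
    simp

theorem C1Space.norm_equiv (ι : D →L[ℝ] B) (hι : ∀ d, ‖ι d‖ ≤ ‖d‖) (p : C1Space ι) :
    ‖p‖ ≤ (‖mapC0 ι p.1.1‖ + ‖p.1.2‖) + ‖p.1.1‖ ∧
      (‖mapC0 ι p.1.1‖ + ‖p.1.2‖) + ‖p.1.1‖ ≤ 3 * ‖p‖ := by
  have h1 : ‖mapC0 ι p.1.1‖ ≤ ‖p.1.1‖ := by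
    rw [← ZeroAtInftyContinuousMap.norm_toBCF_eq_norm,
      ← ZeroAtInftyContinuousMap.norm_toBCF_eq_norm]
    refine (BoundedContinuousFunction.norm_le (norm_nonneg _)).2 fun x => ?_
    exact (hι _).trans (BoundedContinuousFunction.norm_coe_le_norm p.1.1.toBCF x)
  have h2 : ‖p‖ = max ‖p.1.1‖ ‖p.1.2‖ := rfl
  have h3 := norm_nonneg (mapC0 ι p.1.1)
  have h4 := norm_nonneg p.1.1
  have h5 := norm_nonneg p.1.2
  have h6 := le_max_left ‖p.1.1‖ ‖p.1.2‖
  have h7 := le_max_right ‖p.1.1‖ ‖p.1.2‖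
  rw [h2]
  exact ⟨max_le (by linarith) (by linarith), by linarith⟩

/-- The inclusion of `C¹_∞(ℝ, D) ∩ C_∞(ℝ, E)` in `C¹_∞(ℝ, B) ∩ C_∞(ℝ, D)` for `E ⊆ D ⊆ B`. -/
def C1Space.incl {E : Type*} [NormedAddCommGroup E] [NormedSpace ℝ E]
    (ι : D →L[ℝ] B) (κ : E →L[ℝ] D) (p : C1Space κ) : C1Space ι :=
  ⟨(mapC0 κ p.1.1, mapC0 ι p.1.2), fun x => ι.hasFDerivAt.comp_hasDerivAt x (p.2 x)⟩

/-- `C_{kill(a)}([a, ∞), B)`, as a subspace of `C_∞(ℝ, B)`: the functions vanishing on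
`(-∞, a]`. -/
def killRay (B : Type*) [NormedAddCommGroup B] [NormedSpace ℝ B] (a : ℝ) :
    Submodule ℝ C₀(ℝ, B) where
  carrier := {f | ∀ x ≤ a, f x = 0}
  add_mem' := by
    intro f g hf hg x hx
    simp [hf x hx, hg x hx]
  zero_mem' := by
    intro x _
    simp
  smul_mem' := by
    intro c f hf x hx
    simp [hf x hx]

/-- `C_{kill(a)}([a, b], B)`: the continuous functions on `[a, b]` vanishing at `a`, with the
supremum norm. -/
def killSegment (B : Type*) [NormedAddCommGroup B] [NormedSpace ℝ B] (a b : ℝ) :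
    Submodule ℝ C(Icc a b, B) where
  carrier := {f | ∀ x : Icc a b, (x : ℝ) = a → f x = 0}
  add_mem' := by
    intro f g hf hg x hx
    simp [hf x hx, hg x hx]
  zero_mem' := by
    intro x _
    simp
  smul_mem' := by
    intro c f hf x hx
    simp [hf x hx]

/-! ### The operator `L'_ν + A(·)` -/

/-- `((L'_ν + A(·)) f)(x) = ∫ (f(x - y) - f(x)) ν(dy) + A(x) f(x)` for a `D`-valued function `f`; the
values lie in `B`. -/
def levyAdd (ν : Measure ℝ) (ι : D →L[ℝ] B) (A : ℝ → D →L[ℝ] B) (f : ℝ → D) (x : ℝ) : B :=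
  (∫ y, (ι (f (x - y)) - ι (f x)) ∂ν) + A x (f x)

/-! ### Jump paths and products of exponentials -/

/-- The simplex `0 ≤ s₁ ≤ ⋯ ≤ s_m ≤ t`. -/
def jumpSimplex (m : ℕ) (t : ℝ) : Set (Fin m → ℝ) :=
  {s | Monotone s ∧ ∀ i, s i ∈ Icc 0 t}

/-- The measure `ds₁ ⋯ ds_m ν(dz₁) ⋯ ν(dz_m)` over the simplex `0 ≤ s₁ ≤ ⋯ ≤ s_m ≤ t`. -/
def jumpMeasure (ν : Measure ℝ) (m : ℕ) (t : ℝ) : Measure ((Fin m → ℝ) × (Fin m → ℝ)) :=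
  (volume.restrict (jumpSimplex m t)).prod (Measure.pi fun _ => ν)

/-- The times `0, s₁, …, s_m, t`. -/
def jumpTimes {m : ℕ} (t : ℝ) (s : Fin m → ℝ) : Fin (m + 2) → ℝ :=
  Fin.cons (α := fun _ => ℝ) 0 (Fin.snoc (α := fun _ => ℝ) s t)

/-- The product
`exp{s₁ A(x)} exp{(s₂ - s₁) A(x - z₁)} ⋯ exp{(t - s_m) A(x - z₁ - ⋯ - z_m)}`
(in this order), where `S x r` stands for `exp{r A(x)}`. -/
def expProduct {m : ℕ} (S : ℝ → ℝ → B →L[ℝ] B) (t x : ℝ) (s z : Fin m → ℝ) : B →L[ℝ] B :=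
  (List.ofFn fun j : Fin (m + 1) =>
    S (x - ∑ i : Fin m, if i.castSucc < j then z i else 0)
      (jumpTimes t s j.succ - jumpTimes t s j.castSucc)).prod

/-- The piecewise constant path `Z_x` that starts at `x` and jumps by `-z_i` at the time `s_i`. -/
def jumpPath {m : ℕ} (x : ℝ) (s z : Fin m → ℝ) (τ : ℝ) : ℝ :=
  x - ∑ i : Fin m, if s i ≤ τ then z i else 0

/-- The product
`exp{∫_0^{s₁} A(Z_x(τ)) dτ} exp{∫_{s₁}^{s₂} A(Z_x(τ)) dτ} ⋯ exp{∫_{s_m}^t A(Z_x(τ)) dτ}`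
(in this order). -/
def pathExpProduct {m : ℕ} (ι : D →L[ℝ] B) (A : ℝ → D →L[ℝ] B) (t x : ℝ) (s z : Fin m → ℝ) :
    B →L[ℝ] B :=
  (List.ofFn fun j : Fin (m + 1) =>
    opExp ι (∫ τ in (jumpTimes t s j.castSucc)..(jumpTimes t s j.succ),
      A (jumpPath x s z τ))).prod

end Spaces

/-! ### The three spaces setting -/

section ThreeSpaces

variable {B D E : Type*} [NormedAddCommGroup B] [NormedSpace ℝ B]
  [NormedAddCommGroup D] [NormedSpace ℝ D] [NormedAddCommGroup E] [NormedSpace ℝ E]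

/-- A family of operators is uniformly bounded and strongly continuous. -/
def BoundedStronglyContinuous (A : ℝ → D →L[ℝ] B) : Prop :=
  (∃ C, ∀ x, ‖A x‖ ≤ C) ∧ ∀ d, Continuous fun x => A x d

/-- The operators `S x t` are bounded uniformly in `x ∈ ℝ` and `t` from any compact segment. -/
def LocallyUniformlyBounded (S : ℝ → ℝ → B →L[ℝ] B) : Prop :=
  ∀ r : ℝ, ∃ C, ∀ x, ∀ t ∈ Icc 0 r, ‖S x t‖ ≤ C

/-- The assumptions on three spaces `E ⊆ D ⊆ B` (embedded by `κ : E → D` and `ι : D → B`) and the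
family `A`: here `A₁ x : E → D` is the restriction of `A x : D → B`, `SB x t` is the semigroup
`e^{tA(x)}` in `B`, and `SD x t`, `SE x t` are its restrictions to `D` and `E`. -/
structure ThreeSpaceFamily (ι : D →L[ℝ] B) (κ : E →L[ℝ] D)
    (A : ℝ → D →L[ℝ] B) (A₁ : ℝ → E →L[ℝ] D)
    (SB : ℝ → ℝ → B →L[ℝ] B) (SD : ℝ → ℝ → D →L[ℝ] D) (SE : ℝ → ℝ → E →L[ℝ] E) : Prop where
  ι_injective : Function.Injective ι
  κ_injective : Function.Injective κ
  ι_norm_le : ∀ d, ‖ι d‖ ≤ ‖d‖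
  κ_norm_le : ∀ e, ‖κ e‖ ≤ ‖e‖
  dense_in_D : DenseRange κ
  dense_in_B : DenseRange fun e => ι (κ e)
  A_cont : BoundedStronglyContinuous A
  A₁_eq : ∀ x e, ι (A₁ x e) = A x (κ e)
  A₁_cont : BoundedStronglyContinuous A₁
  generates_B : ∀ x, GeneratesWithCore (SB x) ι (A x)
  bounded_B : LocallyUniformlyBounded SB
  SD_eq : ∀ x t d, 0 ≤ t → ι (SD x t d) = SB x t (ι d)
  generates_D : ∀ x, GeneratesWithCore (SD x) κ (A₁ x)
  bounded_D : LocallyUniformlyBounded SD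
  SE_eq : ∀ x t e, 0 ≤ t → κ (SE x t e) = SD x t (κ e)
  bounded_E : LocallyUniformlyBounded SE

/-- `A` and its restriction `A₁` are differentiable in the operator norms of `L(D, B)` and `L(E, D)`
with uniformly bounded and strongly continuous derivatives. -/
structure DifferentiableFamily (A : ℝ → D →L[ℝ] B) (A₁ : ℝ → E →L[ℝ] D) : Prop where
  diff : Differentiable ℝ A
  diff₁ : Differentiable ℝ A₁
  deriv_cont : BoundedStronglyContinuous (deriv A)
  deriv₁_cont : BoundedStronglyContinuous (deriv A₁)

/-- For every `x` the semigroup `SE x` is strongly continuous, and for every `t ≥ 0` the operator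
`SE x t` depends strongly continuously on `x`. -/
structure StronglyContinuousFamily (SE : ℝ → ℝ → E →L[ℝ] E) : Prop where
  cont_time : ∀ x e, ContinuousOn (fun t => SE x t e) (Ici 0)
  cont_space : ∀ t e, 0 ≤ t → Continuous fun x => SE x t e

end ThreeSpaces

end

noncomputable section

/-! ### Strongly continuous semigroups -/

section SemigroupTheory

variable {X Y : Type*} [NormedAddCommGroup X] [NormedSpace ℝ X]
  [NormedAddCommGroup Y] [NormedSpace ℝ Y]

theorem tendsto_apply_of_bound {α : Type*} {l : Filter α} {N : α → X →L[ℝ] Y} {v : α → X} {b : X}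
    {c : Y} {C : ℝ} (hC : ∀ᶠ a in l, ‖N a‖ ≤ C) (hN : Tendsto (fun a => N a b) l (𝓝 c))
    (hv : Tendsto v l (𝓝 b)) : Tendsto (fun a => N a (v a)) l (𝓝 c) := by
  have h2 : Tendsto (fun a => N a (v a - b)) l (𝓝 0) := by
    have h3 : Tendsto (fun a => C * ‖v a - b‖) l (𝓝 0) := by
      simpa using (tendsto_iff_norm_sub_tendsto_zero.1 hv).const_mul C
    refine squeeze_zero_norm' ?_ h3
    filter_upwards [hC] with a ha using (N a).le_of_opNorm_le ha _
  simpa using h2.add hN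

/-- The operators `T t` are bounded uniformly in `t` from any compact segment. -/
def LocallyBounded (T : ℝ → X →L[ℝ] X) : Prop :=
  ∀ r : ℝ, ∃ C, 0 ≤ C ∧ ∀ t ∈ Icc 0 r, ‖T t‖ ≤ C

theorem IsC0Semigroup.locallyBounded [CompleteSpace X] {T : ℝ → X →L[ℝ] X}
    (hT : IsC0Semigroup T) : LocallyBounded T := by
  intro r
  have h : ∀ f, ∃ C, ∀ t : Icc 0 r, ‖T t f‖ ≤ C := by
    intro f
    have hc : ContinuousOn (fun t => T t f) (Icc 0 r) := (hT.cont f).mono Icc_subset_Ici_self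
    obtain ⟨C, hC⟩ := isCompact_Icc.exists_bound_of_continuousOn hc
    exact ⟨C, fun t => hC t t.2⟩
  obtain ⟨C, hC⟩ := banach_steinhaus h
  exact ⟨max C 0, le_max_right _ _, fun t ht => (hC ⟨t, ht⟩).trans (le_max_left _ _)⟩

theorem IsC0Semigroup.tendsto_apply [CompleteSpace X] {T : ℝ → X →L[ℝ] X} (hT : IsC0Semigroup T)
    {α : Type*} {l : Filter α} {φ : α → ℝ} {v : α → X} {a : ℝ} {b : X}
    (hφ : Tendsto φ l (𝓝 a)) (hφ0 : ∀ᶠ x in l, 0 ≤ φ x) (ha : 0 ≤ a) (hv : Tendsto v l (𝓝 b)) :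
    Tendsto (fun x => T (φ x) (v x)) l (𝓝 (T a b)) := by
  obtain ⟨C, hC0, hC⟩ := hT.locallyBounded (a + 1)
  have h1 : Tendsto (fun x => T (φ x) b) l (𝓝 (T a b)) :=
    (hT.cont b a ha).tendsto.comp (tendsto_nhdsWithin_iff.2 ⟨hφ, hφ0⟩)
  refine tendsto_apply_of_bound (C := C) ?_ h1 hv
  filter_upwards [hφ0, hφ.eventually (eventually_le_nhds (lt_add_one a))] with x hx hx'
  exact hC _ ⟨hx, hx'⟩

theorem IsC0Semigroup.continuous_max [CompleteSpace X] {T : ℝ → X →L[ℝ] X} (hT : IsC0Semigroup T)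
    {α : Type*} [TopologicalSpace α] {φ : α → ℝ} {v : α → X} (hφ : Continuous φ)
    (hv : Continuous v) : Continuous fun x => T (max (φ x) 0) (v x) :=
  continuous_iff_continuousAt.2 fun x => hT.tendsto_apply
    ((hφ.max continuous_const).tendsto x) (Eventually.of_forall fun _ => le_max_right _ _)
    (le_max_right _ _) (hv.tendsto x)

theorem norm_semigroup_sub_le {T : ℝ → X →L[ℝ] X}
    (hadd : ∀ s t : ℝ, 0 ≤ s → 0 ≤ t → T (s + t) = T s * T t) {C s t : ℝ} (hs : 0 ≤ s)
    (ht : 0 ≤ t) (hCs : ‖T s‖ ≤ C) (hCt : ‖T t‖ ≤ C) (e : X) :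
    ‖T t e - T s e‖ ≤ C * ‖T |t - s| e - e‖ := by
  rcases le_total s t with h | h
  · have : T t e = T s (T |t - s| e) := by
      rw [abs_of_nonneg (sub_nonneg.2 h), ← mul_apply_eq_comp, ← hadd _ _ hs (sub_nonneg.2 h)]
      simp
    rw [this, ← map_sub]
    exact (T s).le_of_opNorm_le hCs _
  · have : T s e = T t (T |t - s| e) := by
      rw [abs_of_nonpos (sub_nonpos.2 h), ← mul_apply_eq_comp, ← hadd _ _ ht (by linarith)]
      simp
    rw [this, ← norm_neg, neg_sub, ← map_sub]
    exact (T t).le_of_opNorm_le hCt _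

theorem IsC0Semigroup.of_tendsto {T : ℝ → X →L[ℝ] X} (zero : T 0 = 1)
    (hadd : ∀ s t : ℝ, 0 ≤ s → 0 ≤ t → T (s + t) = T s * T t) (bdd : LocallyBounded T)
    (lim : ∀ f, Tendsto (fun t => T t f) (𝓝[≥] 0) (𝓝 f)) : IsC0Semigroup T := by
  refine ⟨zero, hadd, fun f a ha => ?_⟩
  have ha : 0 ≤ a := ha
  obtain ⟨C, hC0, hC⟩ := bdd (a + 1)
  rw [ContinuousWithinAt, tendsto_iff_norm_sub_tendsto_zero]
  have h1 : Tendsto (fun t : ℝ => |t - a|) (𝓝[Ici 0] a) (𝓝[≥] 0) := by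
    refine tendsto_nhdsWithin_iff.2 ⟨?_, Eventually.of_forall fun t => mem_Ici.2 (abs_nonneg _)⟩
    have : Tendsto (fun t : ℝ => |t - a|) (𝓝 a) (𝓝 |a - a|) :=
      Continuous.tendsto (by fun_prop) a
    rw [sub_self, abs_zero] at this
    exact this.mono_left nhdsWithin_le_nhds
  have h2 := (tendsto_iff_norm_sub_tendsto_zero.1 ((lim f).comp h1))
  have h3 := h2.const_mul C
  rw [mul_zero] at h3
  refine squeeze_zero' (Eventually.of_forall fun _ => norm_nonneg _) ?_ h3
  have h4 : ∀ᶠ t in 𝓝[Ici 0] a, t ≤ a + 1 :=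
    (eventually_le_nhds (lt_add_one a)).filter_mono nhdsWithin_le_nhds
  filter_upwards [h4, self_mem_nhdsWithin] with t ht ht0
  have ht0 : 0 ≤ t := ht0
  exact norm_semigroup_sub_le hadd ha ht0 (hC _ ⟨ha, by linarith⟩) (hC _ ⟨ht0, ht⟩) f

theorem IsC0Semigroup.add_apply {T : ℝ → X →L[ℝ] X} (hT : IsC0Semigroup T) {s t : ℝ} (hs : 0 ≤ s)
    (ht : 0 ≤ t) (f : X) : T (s + t) f = T s (T t f) := by
  rw [hT.add s t hs ht, mul_apply_eq_comp]

theorem IsC0Semigroup.zero_apply {T : ℝ → X →L[ℝ] X} (hT : IsC0Semigroup T) (f : X) :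
    T 0 f = f := by
  rw [hT.zero, one_apply_eq_self]

theorem IsC0Semigroup.comm_apply {T : ℝ → X →L[ℝ] X} (hT : IsC0Semigroup T) {s t : ℝ} (hs : 0 ≤ s)
    (ht : 0 ≤ t) (f : X) : T s (T t f) = T t (T s f) := by
  rw [← hT.add_apply hs ht, ← hT.add_apply ht hs, add_comm]

theorem IsC0Semigroup.intervalIntegrable {T : ℝ → X →L[ℝ] X} (hT : IsC0Semigroup T) {a b : ℝ}
    (ha : 0 ≤ a) (hb : 0 ≤ b) (f : X) : IntervalIntegrable (fun s => T s f) volume a b := by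
  refine ((hT.cont f).mono fun s hs => ?_).intervalIntegrable
  rcases le_total a b with h | h
  · rw [uIcc_of_le h] at hs; exact ha.trans hs.1
  · rw [uIcc_of_ge h] at hs; exact hb.trans hs.1

theorem IsC0Semigroup.continuous_integral [CompleteSpace X] {T : ℝ → X →L[ℝ] X}
    (hT : IsC0Semigroup T) {t : ℝ} (ht : 0 ≤ t) :
    Continuous fun g => ∫ s in (0 : ℝ)..t, T s g := by
  obtain ⟨C, hC0, hC⟩ := hT.locallyBounded t
  let L : X →ₗ[ℝ] X :=
    { toFun := fun g => ∫ s in (0 : ℝ)..t, T s g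
      map_add' := fun g g' => by
        simp only [map_add]
        exact intervalIntegral.integral_add (hT.intervalIntegrable le_rfl ht g)
          (hT.intervalIntegrable le_rfl ht g')
      map_smul' := fun c g => by
        simp only [map_smul, RingHom.id_apply]
        exact intervalIntegral.integral_smul _ _ }
  exact (L.mkContinuous (C * |t - 0|) fun g => by
    refine (intervalIntegral.norm_integral_le_of_norm_le_const (C := C * ‖g‖) fun s hs => ?_).trans
      (le_of_eq (by ring))
    rw [uIoc_of_le ht] at hs
    exact (T s).le_of_opNorm_le (hC s ⟨hs.1.le, hs.2⟩) g).continuous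

/-! ### The generator -/

theorem generatorGraph_unique {T : ℝ → X →L[ℝ] X} {f g g' : X} (h : (f, g) ∈ generatorGraph T)
    (h' : (f, g') ∈ generatorGraph T) : g = g' :=
  tendsto_nhds_unique h h'

theorem generatorGraph_apply {T : ℝ → X →L[ℝ] X} (hT : IsC0Semigroup T) {f g : X}
    (h : (f, g) ∈ generatorGraph T) {s : ℝ} (hs : 0 ≤ s) : (T s f, T s g) ∈ generatorGraph T := by
  have h1 : Tendsto (fun r : ℝ => T s (r⁻¹ • (T r f - f))) (𝓝[>] 0) (𝓝 (T s g)) :=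
    ((T s).continuous.tendsto g).comp h
  refine h1.congr' ?_
  filter_upwards [self_mem_nhdsWithin] with r hr
  rw [map_smul, map_sub, hT.comm_apply hs (le_of_lt hr)]

theorem hasDerivWithinAt_Ioi_iff_tendsto {v : ℝ → X} {v' : X} {s : ℝ} :
    HasDerivWithinAt v v' (Ioi s) s ↔
      Tendsto (fun h : ℝ => h⁻¹ • (v (s + h) - v s)) (𝓝[>] 0) (𝓝 v') := by
  rw [hasDerivWithinAt_iff_tendsto_slope' (by simp)]
  have h1 : 𝓝[>] s = map (fun h => s + h) (𝓝[>] 0) := by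
    simp
  rw [h1, tendsto_map'_iff]
  refine tendsto_congr fun h => ?_
  simp [slope_def_module]

/-- The right derivative of `s ↦ T (t - s) (v s)`. -/
theorem IsC0Semigroup.hasDerivWithinAt_sub [CompleteSpace X] {T : ℝ → X →L[ℝ] X}
    (hT : IsC0Semigroup T) {v : ℝ → X} {v' g : X} {s t : ℝ} (hst : s < t)
    (hv : HasDerivWithinAt v v' (Ioi s) s) (hg : (v s, g) ∈ generatorGraph T) :
    HasDerivWithinAt (fun r => T (t - r) (v r)) (T (t - s) (v' - g)) (Ioi s) s := by
  rw [hasDerivWithinAt_Ioi_iff_tendsto] at hv ⊢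
  have h1 := hv.sub hg
  have h2 : Tendsto (fun h : ℝ => t - (s + h)) (𝓝[>] 0) (𝓝 (t - s)) := by
    have : Tendsto (fun h : ℝ => t - (s + h)) (𝓝 0) (𝓝 (t - (s + 0))) :=
      Continuous.tendsto (by fun_prop) 0
    rw [add_zero] at this
    exact this.mono_left nhdsWithin_le_nhds
  have h3 : ∀ᶠ h : ℝ in 𝓝[>] 0, 0 ≤ t - (s + h) :=
    h2.eventually (eventually_ge_nhds (sub_pos.2 hst))
  refine (hT.tendsto_apply h2 h3 (sub_nonneg.2 hst.le) h1).congr' ?_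
  filter_upwards [h3, self_mem_nhdsWithin] with h hh hh0
  have hh0 : 0 < h := hh0
  have : T (t - s) (v s) = T (t - (s + h)) (T h (v s)) := by
    rw [← hT.add_apply hh hh0.le]; congr 2; ring
  rw [this, ← smul_sub, map_smul, ← map_sub]
  congr 2
  abel

/-- If the right derivative of a continuous function is bounded, it is integrable. -/
theorem intervalIntegrable_of_right_deriv {v v' : ℝ → X} {a b C : ℝ} (hab : a ≤ b)
    (hv : ContinuousOn v (Icc a b)) (hv' : ∀ s ∈ Ioo a b, HasDerivWithinAt v (v' s) (Ioi s) s)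
    (hC : ∀ s ∈ Ioo a b, ‖v' s‖ ≤ C) : IntervalIntegrable v' volume a b := by
  rw [intervalIntegrable_iff_integrableOn_Ioo_of_le hab]
  let w : ℝ → X := fun s => v (projIcc a b hab s)
  have hw : Continuous w := hv.comp_continuous (by fun_prop) fun s => (projIcc a b hab s).2
  let q : ℕ → ℝ → X := fun n s => ((n : ℝ) + 1) • (w (s + ((n : ℝ) + 1)⁻¹) - w s)
  have hq : ∀ n, AEStronglyMeasurable (q n) (volume.restrict (Ioo a b)) := fun n =>
    Continuous.aestronglyMeasurable (by fun_prop)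
  have hlim : Tendsto (fun n : ℕ => ((n : ℝ) + 1)⁻¹) atTop (𝓝[>] 0) := by
    refine tendsto_nhdsWithin_iff.2 ⟨?_, Eventually.of_forall fun n => ?_⟩
    · simpa using tendsto_one_div_add_atTop_nhds_zero_nat (𝕜 := ℝ)
    · show (0 : ℝ) < ((n : ℝ) + 1)⁻¹
      positivity
  have hm : AEStronglyMeasurable v' (volume.restrict (Ioo a b)) := by
    refine aestronglyMeasurable_of_tendsto_ae atTop hq ?_
    filter_upwards [ae_restrict_mem measurableSet_Ioo] with s hs
    have h1 := (hasDerivWithinAt_Ioi_iff_tendsto.1 (hv' s hs)).comp hlim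
    refine h1.congr' ?_
    have h2 : ∀ᶠ n : ℕ in atTop, s + ((n : ℝ) + 1)⁻¹ < b := by
      have h3 : Tendsto (fun n : ℕ => s + ((n : ℝ) + 1)⁻¹) atTop (𝓝 (s + 0)) :=
        tendsto_const_nhds.add (hlim.mono_right nhdsWithin_le_nhds)
      rw [add_zero] at h3
      exact h3.eventually (eventually_lt_nhds hs.2)
    filter_upwards [h2] with n hn
    have hpos : (0 : ℝ) < ((n : ℝ) + 1)⁻¹ := by positivity
    simp only [Function.comp, q, w, inv_inv]
    rw [projIcc_of_mem hab ⟨hs.1.le, hs.2.le⟩, projIcc_of_mem hab ⟨by linarith [hs.1], hn.le⟩]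
  refine Integrable.mono' (g := fun _ => C) (by simp) hm ?_
  filter_upwards [ae_restrict_mem measurableSet_Ioo] with s hs
  exact hC s hs

theorem IsC0Semigroup.hasDerivWithinAt {T : ℝ → X →L[ℝ] X} (hT : IsC0Semigroup T) {f g : X} {s : ℝ}
    (hs : 0 ≤ s) (h : (T s f, g) ∈ generatorGraph T) :
    HasDerivWithinAt (fun r => T r f) g (Ioi s) s := by
  rw [hasDerivWithinAt_Ioi_iff_tendsto]
  refine Tendsto.congr' ?_ h
  filter_upwards [self_mem_nhdsWithin] with r hr
  have hr : 0 < r := hr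
  rw [add_comm, hT.add_apply hr.le hs]

/-- Duhamel's formula for two semigroups. -/
theorem duhamel [CompleteSpace X] {T S : ℝ → X →L[ℝ] X} (hT : IsC0Semigroup T)
    (hS : IsC0Semigroup S) {f : X} {g k : ℝ → X} {t C : ℝ} (ht : 0 ≤ t)
    (hg : ∀ s ∈ Ico 0 t, (S s f, g s) ∈ generatorGraph S)
    (hk : ∀ s ∈ Ico 0 t, (S s f, k s) ∈ generatorGraph T)
    (hC : ∀ s ∈ Ico 0 t, ‖g s - k s‖ ≤ C) :
    IntervalIntegrable (fun s => T (t - s) (g s - k s)) volume 0 t ∧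
      ∫ s in (0 : ℝ)..t, T (t - s) (g s - k s) = S t f - T t f := by
  obtain ⟨M, hM0, hM⟩ := hT.locallyBounded t
  have hcont : ContinuousOn (fun s => T (t - s) (S s f)) (Icc 0 t) := by
    intro s hs
    refine hT.tendsto_apply ?_ ?_ (sub_nonneg.2 hs.2) ?_
    · exact (Continuous.tendsto (by fun_prop) s).mono_left nhdsWithin_le_nhds
    · filter_upwards [self_mem_nhdsWithin] with r hr using sub_nonneg.2 hr.2
    · exact ((hS.cont f).mono Icc_subset_Ici_self) s hs
  have hder : ∀ s ∈ Ioo 0 t, HasDerivWithinAt (fun r => T (t - r) (S r f))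
      (T (t - s) (g s - k s)) (Ioi s) s := fun s hs =>
    hT.hasDerivWithinAt_sub hs.2 (hS.hasDerivWithinAt hs.1.le (hg s ⟨hs.1.le, hs.2⟩))
      (hk s ⟨hs.1.le, hs.2⟩)
  have hint := intervalIntegrable_of_right_deriv ht hcont hder (C := M * C) fun s hs =>
    (T (t - s)).le_of_opNorm_le_of_le (hM _ ⟨by linarith [hs.2], by linarith [hs.1]⟩)
      (hC s ⟨hs.1.le, hs.2⟩)
  refine ⟨hint, ?_⟩
  rw [intervalIntegral.integral_eq_sub_of_hasDeriv_right_of_le ht hcont hder hint]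
  simp [hT.zero_apply, hS.zero_apply]

theorem tendsto_average_integral {v : ℝ → X} [CompleteSpace X] (hv : ContinuousOn v (Ici 0)) :
    Tendsto (fun t : ℝ => t⁻¹ • ∫ s in (0 : ℝ)..t, v s) (𝓝[>] 0) (𝓝 (v 0)) := by
  let w : ℝ → X := fun s => v (max s 0)
  have hw : Continuous w := hv.comp_continuous (by fun_prop) fun s => mem_Ici.2 (le_max_right _ _)
  have h1 : HasDerivAt (fun t => ∫ s in (0 : ℝ)..t, w s) (w 0) 0 :=
    intervalIntegral.integral_hasDerivAt_right (hw.intervalIntegrable _ _)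
      hw.aestronglyMeasurable.stronglyMeasurableAtFilter hw.continuousAt
  have h2 := hasDerivWithinAt_Ioi_iff_tendsto.1 h1.hasDerivWithinAt
  simp only [zero_add, intervalIntegral.integral_same, sub_zero, w, max_self] at h2
  refine h2.congr' ?_
  filter_upwards [self_mem_nhdsWithin] with t ht
  have ht : 0 < t := ht
  congr 1
  refine intervalIntegral.integral_congr fun s hs => ?_
  rw [uIcc_of_le ht.le] at hs
  simp [max_eq_left hs.1]

theorem mem_generatorGraph_iff [CompleteSpace X] {T : ℝ → X →L[ℝ] X} (hT : IsC0Semigroup T)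
    {f g : X} :
    (f, g) ∈ generatorGraph T ↔ ∀ t, 0 ≤ t → T t f - f = ∫ s in (0 : ℝ)..t, T s g := by
  constructor
  · intro h t ht
    have := intervalIntegral.integral_eq_sub_of_hasDeriv_right_of_le ht
      (f := fun s => T s f) (f' := fun s => T s g) ((hT.cont f).mono Icc_subset_Ici_self)
      (fun s hs => hT.hasDerivWithinAt hs.1.le (generatorGraph_apply hT h hs.1.le))
      (hT.intervalIntegrable le_rfl ht g)
    rw [this, hT.zero_apply]
  · intro h
    have h1 := tendsto_average_integral (hT.cont g)
    rw [hT.zero_apply] at h1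
    refine h1.congr' ?_
    filter_upwards [self_mem_nhdsWithin] with t ht
    rw [h t (le_of_lt ht)]

theorem isClosed_generatorGraph [CompleteSpace X] {T : ℝ → X →L[ℝ] X} (hT : IsC0Semigroup T) :
    IsClosed (generatorGraph T) := by
  have : generatorGraph T = ⋂ (t : ℝ) (_ : 0 ≤ t),
      {p : X × X | T t p.1 - p.1 = ∫ s in (0 : ℝ)..t, T s p.2} := by
    ext ⟨f, g⟩
    simp only [mem_iInter, mem_ofPred_eq]
    exact mem_generatorGraph_iff hT
  rw [this]
  refine isClosed_iInter fun t => isClosed_iInter fun ht => isClosed_eq (by fun_prop) ?_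
  exact (hT.continuous_integral ht).comp continuous_snd

theorem mem_generatorGraph_of_forall [CompleteSpace X] [CompleteSpace Y] {I : Type*}
    {T : ℝ → X →L[ℝ] X} (hT : IsC0Semigroup T) {S : I → ℝ → Y →L[ℝ] Y}
    (hS : ∀ i, IsC0Semigroup (S i)) {π : I → X →L[ℝ] Y}
    (hπ : ∀ f, (∀ i, π i f = 0) → f = 0)
    (hTS : ∀ i t f, 0 ≤ t → π i (T t f) = S i t (π i f)) {f g : X}
    (h : ∀ i, (π i f, π i g) ∈ generatorGraph (S i)) : (f, g) ∈ generatorGraph T := by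
  rw [mem_generatorGraph_iff hT]
  intro t ht
  rw [← sub_eq_zero]
  refine hπ _ fun i => ?_
  rw [map_sub, ← ContinuousLinearMap.intervalIntegral_comp_comm _
    (hT.intervalIntegrable le_rfl ht g), map_sub, hTS i t f ht,
    (mem_generatorGraph_iff (hS i)).1 (h i) t ht, sub_eq_zero]
  refine intervalIntegral.integral_congr fun s hs => ?_
  rw [uIcc_of_le ht] at hs
  exact (hTS i s g hs.1).symm

/-- A semigroup is determined by its generator. -/
theorem IsC0Semigroup.eq_of_generatorGraph_eq [CompleteSpace X] {T S : ℝ → X →L[ℝ] X}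
    (hT : IsC0Semigroup T) (hS : IsC0Semigroup S) (h : generatorGraph T = generatorGraph S)
    (hd : Dense {f | ∃ g, (f, g) ∈ generatorGraph S}) {t : ℝ} (ht : 0 ≤ t) : T t = S t := by
  refine DFunLike.ext' (Continuous.ext_on hd (T t).continuous (S t).continuous ?_)
  rintro f ⟨g, hg⟩
  have h1 := (duhamel hT hS (f := f) (g := fun s => S s g) (k := fun s => S s g) (C := 0) ht
    (fun s hs => generatorGraph_apply hS hg hs.1)
    (fun s hs => h ▸ generatorGraph_apply hS hg hs.1) (fun s _ => by simp)).2
  simp only [sub_self, map_zero, intervalIntegral.integral_zero] at h1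
  exact (sub_eq_zero.1 h1.symm).symm

theorem integral_mem_generatorGraph [CompleteSpace X] {T : ℝ → X →L[ℝ] X} (hT : IsC0Semigroup T)
    (f : X) {t : ℝ} (ht : 0 ≤ t) : (∫ s in (0 : ℝ)..t, T s f, T t f - f) ∈ generatorGraph T := by
  suffices h0 : HasDerivWithinAt (fun r => ∫ s in r..(t + r), T (max s 0) f) (T t f - f) (Ioi 0) 0 by
    have h1 := hasDerivWithinAt_Ioi_iff_tendsto.1 h0
    refine h1.congr' ?_
    filter_upwards [self_mem_nhdsWithin] with h hh
    have hh : 0 < h := hh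
    simp only [zero_add, add_zero]
    have e1 : ∀ a b : ℝ, 0 ≤ a → 0 ≤ b → ∫ s in a..b, T (max s 0) f = ∫ s in a..b, T s f := by
      intro a b ha hb
      refine intervalIntegral.integral_congr fun s hs => ?_
      have : 0 ≤ s := (le_inf ha hb).trans hs.1
      simp [max_eq_left this]
    rw [e1 _ _ hh.le (by linarith), e1 _ _ le_rfl ht,
      ← ContinuousLinearMap.intervalIntegral_comp_comm _ (hT.intervalIntegrable le_rfl ht f)]
    congr 2
    have e2 : ∫ s in (0 : ℝ)..t, T h (T s f) = ∫ s in (0 : ℝ)..t, T (s + h) f := by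
      refine intervalIntegral.integral_congr fun s hs => ?_
      rw [uIcc_of_le ht] at hs
      rw [add_comm, hT.add_apply hh.le hs.1]
    rw [e2, intervalIntegral.integral_comp_add_right (fun s => T s f), zero_add]
  have hc : Continuous fun s => T (max s 0) f := hT.continuous_max continuous_id continuous_const
  have h2 : ∀ a, HasDerivAt (fun r => ∫ s in (0 : ℝ)..r, T (max s 0) f) (T (max a 0) f) a :=
    fun a => intervalIntegral.integral_hasDerivAt_right (hc.intervalIntegrable _ _)
      hc.aestronglyMeasurable.stronglyMeasurableAtFilter hc.continuousAt
  have h3 : HasDerivAt (fun r => ∫ s in (0 : ℝ)..(t + r), T (max s 0) f) (T (max (t + 0) 0) f) 0 :=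
    HasDerivAt.comp_const_add t 0 (h2 (t + 0))
  have h4 := (h3.sub (h2 0)).hasDerivWithinAt (s := Ioi 0)
  simp only [add_zero, max_self, max_eq_left ht, hT.zero_apply] at h4
  refine h4.congr_of_eventuallyEq (Eventually.of_forall fun r => ?_) ?_
  · exact (intervalIntegral.integral_interval_sub_left (hc.intervalIntegrable _ _)
      (hc.intervalIntegrable _ _)).symm
  · simp

theorem closure_subset_generatorGraph {E : Type*} [CompleteSpace X] {T : ℝ → X →L[ℝ] X}
    (hT : IsC0Semigroup T) {j G : E → X} (h : ∀ e, (j e, G e) ∈ generatorGraph T) :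
    closure (range fun e => (j e, G e)) ⊆ generatorGraph T :=
  closure_minimal (range_subset_iff.2 h) (isClosed_generatorGraph hT)

/-- A closed set of pairs contains the graph of the generator as soon as it contains the pairs
`(t⁻¹ ∫₀ᵗ T s f ds, t⁻¹ (T t f - f))` for a dense set of vectors `f`. -/
theorem generatorGraph_subset_of_average [CompleteSpace X] {T : ℝ → X →L[ℝ] X}
    (hT : IsC0Semigroup T) {C : Set (X × X)} (hC : IsClosed C) {V : Set X} (hV : Dense V)
    (h : ∀ f ∈ V, ∀ t, 0 < t →
      (t⁻¹ • ∫ s in (0 : ℝ)..t, T s f, t⁻¹ • (T t f - f)) ∈ C) : generatorGraph T ⊆ C := by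
  have h1 : ∀ f : X, ∀ t, 0 < t →
      (t⁻¹ • ∫ s in (0 : ℝ)..t, T s f, t⁻¹ • (T t f - f)) ∈ C := by
    intro f t ht
    have hL := hT.continuous_integral ht.le
    have hcont : Continuous fun f => (t⁻¹ • (∫ s in (0 : ℝ)..t, T s f), t⁻¹ • (T t f - f)) := by fun_prop
    have : IsClosed ((fun f => (t⁻¹ • (∫ s in (0 : ℝ)..t, T s f), t⁻¹ • (T t f - f))) ⁻¹' C) := hC.preimage hcont
    have hsub : closure V ⊆ (fun f => (t⁻¹ • (∫ s in (0 : ℝ)..t, T s f), t⁻¹ • (T t f - f))) ⁻¹' C :=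
      closure_minimal (fun f hf => h f hf t ht) this
    exact hsub (hV f)
  rintro ⟨f, g⟩ hfg
  have h2 := tendsto_average_integral (hT.cont f)
  rw [hT.zero_apply] at h2
  refine hC.mem_of_tendsto (h2.prodMk_nhds hfg) ?_
  filter_upwards [self_mem_nhdsWithin] with t ht using h1 f t ht

/-- A dense subspace that is invariant under the semigroup, with a stronger topology in which the
semigroup is strongly continuous and the generator is bounded, is a core. -/
theorem generatesWithCore_of_invariant [CompleteSpace X] [CompleteSpace Y] {T : ℝ → X →L[ℝ] X}
    (hT : IsC0Semigroup T) {S : ℝ → Y →L[ℝ] Y} (hS : IsC0Semigroup S) {j G : Y →L[ℝ] X}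
    (hj : DenseRange j) (hjS : ∀ t y, 0 ≤ t → j (S t y) = T t (j y))
    (hG : ∀ y, (j y, G y) ∈ generatorGraph T) : GeneratesWithCore T j G := by
  refine ⟨hT, (closure_subset_generatorGraph hT hG).antisymm ?_⟩
  refine generatorGraph_subset_of_average hT isClosed_closure hj ?_
  rintro _ ⟨y, rfl⟩ t ht
  refine subset_closure ⟨t⁻¹ • ∫ s in (0 : ℝ)..t, S s y, ?_⟩
  have h1 : j (∫ s in (0 : ℝ)..t, S s y) = ∫ s in (0 : ℝ)..t, T s (j y) := by
    rw [← ContinuousLinearMap.intervalIntegral_comp_comm _ (hS.intervalIntegrable le_rfl ht.le y)]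
    refine intervalIntegral.integral_congr fun s hs => ?_
    rw [uIcc_of_le ht.le] at hs
    exact hjS s y hs.1
  have h2 : G (∫ s in (0 : ℝ)..t, S s y) = T t (j y) - j y :=
    generatorGraph_unique (h1 ▸ hG _) (integral_mem_generatorGraph hT (j y) ht.le)
  simp only [map_smul, h1, h2]

end SemigroupTheory

/-! ### Bounded perturbations -/

section Perturbation

variable {X Y : Type*} [NormedAddCommGroup X] [NormedSpace ℝ X]
  [NormedAddCommGroup Y] [NormedSpace ℝ Y]

/-- The terms of the Dyson series of the perturbation of `T` by `K`, applied to `f`. -/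
def dysonTerm (T : ℝ → X →L[ℝ] X) (K : X →L[ℝ] X) (f : X) : ℕ → ℝ → X
  | 0, t => T (max t 0) f
  | n + 1, t => ∫ s in (0 : ℝ)..max t 0, T (max s 0) (K (dysonTerm T K f n (t - s)))

variable {T : ℝ → X →L[ℝ] X} {K : X →L[ℝ] X}

theorem dysonTerm_continuous [CompleteSpace X] (hT : IsC0Semigroup T) (K : X →L[ℝ] X) (f : X)
    (n : ℕ) : Continuous (dysonTerm T K f n) := by
  induction n with
  | zero => exact hT.continuous_max continuous_id continuous_const
  | succ n ih =>
    refine intervalIntegral.continuous_parametric_intervalIntegral_of_continuous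
      (f := fun t s => T (max s 0) (K (dysonTerm T K f n (t - s)))) ?_ (by fun_prop)
    exact hT.continuous_max (φ := fun p : ℝ × ℝ => p.2)
      (v := fun p : ℝ × ℝ => K (dysonTerm T K f n (p.1 - p.2))) (by fun_prop) (by fun_prop)

theorem dysonTerm_intervalIntegrable [CompleteSpace X] (hT : IsC0Semigroup T) (K : X →L[ℝ] X)
    (f : X) (n : ℕ) (t a b : ℝ) :
    IntervalIntegrable (fun s => T (max s 0) (K (dysonTerm T K f n (t - s)))) volume a b := by
  have := dysonTerm_continuous hT K f n
  exact (hT.continuous_max (φ := fun s => s) (v := fun s => K (dysonTerm T K f n (t - s)))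
    (by fun_prop) (by fun_prop)).intervalIntegrable _ _

theorem dysonTerm_add [CompleteSpace X] (hT : IsC0Semigroup T) (f g : X) (n : ℕ) (t : ℝ) :
    dysonTerm T K (f + g) n t = dysonTerm T K f n t + dysonTerm T K g n t := by
  induction n generalizing t with
  | zero => simp [dysonTerm]
  | succ n ih =>
    simp only [dysonTerm, ih, map_add]
    exact intervalIntegral.integral_add (dysonTerm_intervalIntegrable hT K f n t _ _)
      (dysonTerm_intervalIntegrable hT K g n t _ _)

theorem dysonTerm_smul (c : ℝ) (f : X) (n : ℕ) (t : ℝ) :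
    dysonTerm T K (c • f) n t = c • dysonTerm T K f n t := by
  induction n generalizing t with
  | zero => simp [dysonTerm]
  | succ n ih =>
    simp only [dysonTerm, ih, map_smul]
    exact intervalIntegral.integral_smul _ _

theorem norm_dysonTerm_le {C r : ℝ} (hC : ∀ t ∈ Icc 0 r, ‖T t‖ ≤ C) (hr : 0 ≤ r)
    (f : X) (n : ℕ) {t : ℝ} (ht : t ≤ r) :
    ‖dysonTerm T K f n t‖ ≤ C * ((C * ‖K‖ * max t 0) ^ n / n.factorial) * ‖f‖ := by
  induction n generalizing t with
  | zero =>
    simpa [dysonTerm] using (T (max t 0)).le_of_opNorm_le (hC _ ⟨le_max_right _ _, max_le ht hr⟩) f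
  | succ n ih =>
    have hτ : 0 ≤ max t 0 := le_max_right _ _
    have h1 := intervalIntegral.norm_integral_le_of_norm_le hτ
      (f := fun s => T (max s 0) (K (dysonTerm T K f n (t - s))))
      (g := fun s => C * ‖K‖ * (C * ((C * ‖K‖ * (max t 0 - s)) ^ n / n.factorial) * ‖f‖))
      (μ := volume)
      (Eventually.of_forall fun s hs => ?_) (Continuous.intervalIntegrable (by fun_prop) _ _)
    · refine h1.trans (le_of_eq ?_)
      have h2 : ∫ s in (0 : ℝ)..max t 0, (max t 0 - s) ^ n = max t 0 ^ (n + 1) / (n + 1) := by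
        rw [intervalIntegral.integral_comp_sub_left (fun s => s ^ n)]
        simp [integral_pow]
      have h3 : (fun s => C * ‖K‖ * (C * ((C * ‖K‖ * (max t 0 - s)) ^ n / n.factorial) * ‖f‖)) =
          fun s => C * ‖K‖ * (C * ((C * ‖K‖) ^ n / n.factorial) * ‖f‖) * (max t 0 - s) ^ n := by
        ext s; rw [mul_pow]; ring
      rw [h3, intervalIntegral.integral_const_mul, h2, mul_pow, Nat.factorial_succ]
      push_cast
      field_simp
      ring
    · have hts : max t 0 = t := max_eq_left_of_lt (by
        rcases lt_or_ge 0 t with h | h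
        · exact h
        · rw [max_eq_right h] at hs; exact absurd hs.1 (not_lt.2 hs.2))
      have hs2 : s ≤ t := hts ▸ hs.2
      have h4 := ih (t := t - s) (by linarith [hs.1])
      rw [max_eq_left (sub_nonneg.2 hs2)] at h4
      rw [hts, max_eq_left hs.1.le, mul_assoc]
      exact (T s).le_of_opNorm_le_of_le (hC s ⟨hs.1.le, hs2.trans ht⟩)
        (K.le_of_opNorm_le_of_le le_rfl h4)

theorem summable_dyson_bound (C k t M : ℝ) :
    Summable fun n : ℕ => C * ((C * k * t) ^ n / n.factorial) * M :=
  ((Real.summable_pow_div_factorial _).mul_left _).mul_right _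

theorem summable_norm_dysonTerm [CompleteSpace X] (hT : IsC0Semigroup T) (K : X →L[ℝ] X) (f : X)
    (t : ℝ) : Summable fun n => ‖dysonTerm T K f n t‖ := by
  obtain ⟨C, hC0, hC⟩ := hT.locallyBounded (max t 0)
  exact Summable.of_nonneg_of_le (fun _ => norm_nonneg _)
    (fun n => norm_dysonTerm_le hC (le_max_right _ _) f n (le_max_left _ _))
    (summable_dyson_bound _ _ _ _)

theorem summable_dysonTerm [CompleteSpace X] (hT : IsC0Semigroup T) (K : X →L[ℝ] X) (f : X)
    (t : ℝ) : Summable fun n => dysonTerm T K f n t :=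
  (summable_norm_dysonTerm hT K f t).of_norm

/-- The semigroup generated by `G + K`, where `G` is the generator of `T`. -/
def perturb [CompleteSpace X] (hT : IsC0Semigroup T) (K : X →L[ℝ] X) (t : ℝ) : X →L[ℝ] X :=
  LinearMap.mkContinuousOfExistsBound
    { toFun := fun f => ∑' n, dysonTerm T K f n t
      map_add' := fun f g => by
        simp only [dysonTerm_add hT]
        exact (summable_dysonTerm hT K f t).tsum_add (summable_dysonTerm hT K g t)
      map_smul' := fun c f => by
        simp only [dysonTerm_smul, RingHom.id_apply]
        exact (summable_dysonTerm hT K f t).tsum_const_smul c }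
    (by
      obtain ⟨C, hC0, hC⟩ := hT.locallyBounded (max t 0)
      refine ⟨∑' n : ℕ, C * ((C * ‖K‖ * max t 0) ^ n / n.factorial), fun f => ?_⟩
      rw [← tsum_mul_right]
      exact tsum_of_norm_bounded (summable_dyson_bound _ _ _ _).hasSum
        fun n => norm_dysonTerm_le hC (le_max_right _ _) f n (le_max_left _ _))

theorem perturb_apply [CompleteSpace X] (hT : IsC0Semigroup T) (K : X →L[ℝ] X) (t : ℝ) (f : X) :
    perturb hT K t f = ∑' n, dysonTerm T K f n t := rfl

theorem perturb_continuous [CompleteSpace X] (hT : IsC0Semigroup T) (K : X →L[ℝ] X) (f : X) :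
    Continuous fun t => perturb hT K t f := by
  rw [continuous_iff_continuousAt]
  intro t
  obtain ⟨C, hC0, hC⟩ := hT.locallyBounded (max (t + 1) 0)
  have h : ContinuousOn (fun t => perturb hT K t f) (Iic (max (t + 1) 0)) := by
    refine continuousOn_tsum (fun n => (dysonTerm_continuous hT K f n).continuousOn)
      (summable_dyson_bound C ‖K‖ (max (t + 1) 0) ‖f‖) fun n s hs => ?_
    refine (norm_dysonTerm_le hC (le_max_right _ _) f n hs).trans ?_
    have : max s 0 ≤ max (t + 1) 0 := max_le hs (le_max_right _ _)
    have := le_max_right s 0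
    gcongr
  exact h.continuousAt (Iic_mem_nhds (lt_max_of_lt_left (lt_add_one t)))

/-- The integral equation of the perturbed semigroup. -/
theorem perturb_eq [CompleteSpace X] (hT : IsC0Semigroup T) (K : X →L[ℝ] X) (f : X) {t : ℝ}
    (ht : 0 ≤ t) :
    perturb hT K t f = T t f + ∫ s in (0 : ℝ)..t, T (max s 0) (K (perturb hT K (t - s) f)) := by
  rw [perturb_apply, (summable_dysonTerm hT K f t).tsum_eq_zero_add]
  congr 1
  · simp [dysonTerm, ht]
  obtain ⟨C, hC0, hC⟩ := hT.locallyBounded t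
  have h := intervalIntegral.hasSum_integral_of_dominated_convergence (μ := volume) (a := 0) (b := t)
    (F := fun n s => T (max s 0) (K (dysonTerm T K f n (t - s))))
    (f := fun s => T (max s 0) (K (perturb hT K (t - s) f)))
    (fun n _ => C * (‖K‖ * (C * ((C * ‖K‖ * t) ^ n / n.factorial) * ‖f‖)))
    (fun n => ?_) (fun n => Eventually.of_forall fun s hs => ?_)
    (Eventually.of_forall fun s hs => ?_) ?_ (Eventually.of_forall fun s hs => ?_)
  · rw [← h.tsum_eq]
    simp [dysonTerm, ht]
  · rw [uIoc_of_le ht]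
    exact ((intervalIntegrable_iff_integrableOn_Ioc_of_le ht).1
      (dysonTerm_intervalIntegrable hT K f n t 0 t)).aestronglyMeasurable
  · rw [uIoc_of_le ht] at hs
    rw [max_eq_left hs.1.le]
    refine (T s).le_of_opNorm_le_of_le (hC s ⟨hs.1.le, hs.2⟩)
      (K.le_of_opNorm_le_of_le le_rfl ((norm_dysonTerm_le hC ht f n
        (by linarith [hs.1])).trans ?_))
    have h1 : max (t - s) 0 ≤ t := max_le (by linarith [hs.1]) ht
    have := le_max_right (t - s) 0
    gcongr
  · exact ((summable_dyson_bound _ _ _ _).mul_left _).mul_left _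
  · exact intervalIntegrable_const
  · exact ((summable_dysonTerm hT K f (t - s)).hasSum.mapL K).mapL (T (max s 0))

theorem eq_zero_of_le_integral {φ : ℝ → ℝ} {a r : ℝ} (hφ : Continuous φ) (h0 : ∀ t, 0 ≤ φ t)
    (h : ∀ t ∈ Icc 0 r, φ t ≤ a * ∫ s in (0 : ℝ)..t, φ s) : ∀ t ∈ Icc 0 r, φ t = 0 := by
  have hd : ∀ t, HasDerivAt (fun t => ∫ s in (0 : ℝ)..t, φ s) (φ t) t := fun t =>
    intervalIntegral.integral_hasDerivAt_right (hφ.intervalIntegrable _ _)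
      hφ.aestronglyMeasurable.stronglyMeasurableAtFilter hφ.continuousAt
  have h1 := eq_zero_of_abs_deriv_le_mul_abs_self_of_eq_zero_right (a := 0) (b := r) (K := a)
    (f := fun t => ∫ s in (0 : ℝ)..t, φ s) (f' := φ)
    (fun t _ => (hd t).continuousAt.continuousWithinAt) (fun t _ => (hd t).hasDerivWithinAt)
    (by simp) (fun t ht => by
      rw [Real.norm_of_nonneg (h0 t), Real.norm_of_nonneg
        (intervalIntegral.integral_nonneg ht.1 fun s _ => h0 s)]
      exact h t ⟨ht.1, ht.2.le⟩)
  intro t ht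
  refine le_antisymm ?_ (h0 t)
  have h2 := h t ht
  have h3 := h1 t ht
  rwa [h3, mul_zero] at h2

theorem perturb_zero [CompleteSpace X] (hT : IsC0Semigroup T) (K : X →L[ℝ] X) :
    perturb hT K 0 = 1 := by
  ext f
  rw [perturb_eq hT K f le_rfl]
  simp [hT.zero_apply]

theorem perturb_integrand_continuous [CompleteSpace X] (hT : IsC0Semigroup T) (K : X →L[ℝ] X)
    (f : X) (t : ℝ) : Continuous fun s => T (max s 0) (K (perturb hT K (t - s) f)) := by
  have hc := perturb_continuous hT K f
  have hc1 : Continuous fun s => perturb hT K (t - s) f :=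
    hc.comp (continuous_const.sub continuous_id)
  exact hT.continuous_max (φ := fun s => s) continuous_id (K.continuous.comp hc1)

theorem perturb_add [CompleteSpace X] (hT : IsC0Semigroup T) (K : X →L[ℝ] X) (s t : ℝ)
    (hs : 0 ≤ s) (ht : 0 ≤ t) (f : X) :
    perturb hT K (t + s) f = perturb hT K t (perturb hT K s f) := by
  set g := perturb hT K s f with hg
  have hc := perturb_continuous hT K f
  have hcg := perturb_continuous hT K g
  have key : ∀ r, 0 ≤ r → perturb hT K (r + s) f = T r g +
      ∫ q in (0 : ℝ)..r, T (max q 0) (K (perturb hT K (r + s - q) f)) := by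
    intro r hr
    have hI := perturb_integrand_continuous hT K f
    rw [perturb_eq hT K f (add_nonneg hr hs),
      ← intervalIntegral.integral_add_adjacent_intervals (b := r)
        ((hI _).intervalIntegrable _ _) ((hI _).intervalIntegrable _ _), hg,
      perturb_eq hT K f hs, map_add,
      ← ContinuousLinearMap.intervalIntegral_comp_comm _ ((hI _).intervalIntegrable _ _)]
    have h1 : ∫ q in (0 : ℝ)..s, T r (T (max q 0) (K (perturb hT K (s - q) f))) =
        ∫ q in (0 : ℝ)..s, (fun q => T (max q 0) (K (perturb hT K (r + s - q) f))) (q + r) := by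
      refine intervalIntegral.integral_congr fun q hq => ?_
      rw [uIcc_of_le hs] at hq
      have h2 : r + s - (q + r) = s - q := by ring
      simp only [h2, max_eq_left hq.1, max_eq_left (add_nonneg hq.1 hr)]
      rw [add_comm q r, hT.add_apply hr hq.1]
    rw [h1, intervalIntegral.integral_comp_add_right
      (fun q => T (max q 0) (K (perturb hT K (r + s - q) f))), zero_add, add_comm s r,
      hT.add_apply hr hs]
    abel
  let φ : ℝ → ℝ := fun r => ‖perturb hT K (r + s) f - perturb hT K r g‖
  have hφ : Continuous φ := by
    have h1 : Continuous fun r => perturb hT K (r + s) f := hc.comp (by fun_prop)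
    exact (h1.sub hcg).norm
  obtain ⟨C, hC0, hC⟩ := hT.locallyBounded t
  have h := eq_zero_of_le_integral (a := C * ‖K‖) (r := t) hφ (fun _ => norm_nonneg _) ?_
    t ⟨ht, le_rfl⟩
  · exact sub_eq_zero.1 (norm_eq_zero.1 h)
  intro r hr
  simp only [φ]
  have hc1 : Continuous fun q => perturb hT K (r + s - q) f := hc.comp (by fun_prop)
  have hc2 : Continuous fun q => perturb hT K (r - q) g := hcg.comp (by fun_prop)
  rw [key r hr.1, perturb_eq hT K g hr.1, add_sub_add_left_eq_sub,
    ← intervalIntegral.integral_sub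
      ((perturb_integrand_continuous hT K f _).intervalIntegrable _ _)
      ((perturb_integrand_continuous hT K g _).intervalIntegrable _ _)]
  have h1 : ∫ q in (0 : ℝ)..r, φ q = ∫ q in (0 : ℝ)..r, φ (r - q) := by
    rw [intervalIntegral.integral_comp_sub_left φ]; simp
  rw [h1, ← intervalIntegral.integral_const_mul]
  refine intervalIntegral.norm_integral_le_of_norm_le hr.1 (Eventually.of_forall fun q hq => ?_)
    (Continuous.intervalIntegrable (by fun_prop) _ _)
  rw [← map_sub, ← map_sub, max_eq_left hq.1.le, mul_assoc]
  refine (T q).le_of_opNorm_le_of_le (hC q ⟨hq.1.le, hq.2.trans hr.2⟩) ?_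
  simp only [φ]
  rw [show r - q + s = r + s - q by ring]
  exact K.le_opNorm _

theorem isC0Semigroup_perturb [CompleteSpace X] (hT : IsC0Semigroup T) (K : X →L[ℝ] X) :
    IsC0Semigroup (perturb hT K) where
  zero := perturb_zero hT K
  add s t hs ht := by
    ext f
    exact perturb_add hT K t s ht hs f
  cont f := (perturb_continuous hT K f).continuousOn

theorem perturb_sub_tendsto [CompleteSpace X] (hT : IsC0Semigroup T) (K : X →L[ℝ] X) (f : X) :
    Tendsto (fun h : ℝ => h⁻¹ • (perturb hT K h f - T h f)) (𝓝[>] 0) (𝓝 (K f)) := by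
  have hc := perturb_continuous hT K f
  let F : ℝ → ℝ → X := fun t s => T (max s 0) (K (perturb hT K (t - s) f))
  have hF : Continuous F.uncurry := by
    have h1 : Continuous fun p : ℝ × ℝ => perturb hT K (p.1 - p.2) f := hc.comp (by fun_prop)
    exact hT.continuous_max (φ := fun p : ℝ × ℝ => p.2) continuous_snd (K.continuous.comp h1)
  have h1 : Continuous fun t : ℝ => ∫ θ in (0 : ℝ)..1, F t (t * θ) :=
    intervalIntegral.continuous_parametric_intervalIntegral_of_continuous'
      (f := fun t θ => F t (t * θ))
      (hF.comp (f := fun p : ℝ × ℝ => (p.1, p.1 * p.2)) (by fun_prop)) 0 1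
  have h2 := (h1.tendsto 0).mono_left (nhdsWithin_le_nhds (s := Ioi 0))
  simp only [F, zero_mul, max_self, sub_self, hT.zero_apply, perturb_zero, one_apply_eq_self,
    intervalIntegral.integral_const, sub_zero, one_smul] at h2
  refine h2.congr' ?_
  filter_upwards [self_mem_nhdsWithin] with h hh
  have hh : 0 < h := hh
  rw [perturb_eq hT K f hh.le, add_sub_cancel_left,
    intervalIntegral.integral_comp_mul_left
      (fun s => T (max s 0) (K (perturb hT K (h - s) f))) hh.ne']
  simp

theorem dysonTerm_intertwine [CompleteSpace X] [CompleteSpace Y] (hT : IsC0Semigroup T)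
    {S : ℝ → Y →L[ℝ] Y} {K' : Y →L[ℝ] Y} {j : X →L[ℝ] Y}
    (hj : ∀ t f, 0 ≤ t → j (T t f) = S t (j f)) (hK : ∀ f, j (K f) = K' (j f)) (f : X) (n : ℕ)
    (t : ℝ) : j (dysonTerm T K f n t) = dysonTerm S K' (j f) n t := by
  induction n generalizing t with
  | zero => exact hj _ _ (le_max_right _ _)
  | succ n ih =>
    simp only [dysonTerm]
    rw [← ContinuousLinearMap.intervalIntegral_comp_comm _
      (dysonTerm_intervalIntegrable hT K f n t _ _)]
    simp only [hj _ _ (le_max_right _ _), hK, ih]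

theorem perturb_intertwine [CompleteSpace X] [CompleteSpace Y] (hT : IsC0Semigroup T)
    {S : ℝ → Y →L[ℝ] Y} (hS : IsC0Semigroup S) {K' : Y →L[ℝ] Y} {j : X →L[ℝ] Y}
    (hj : ∀ t f, 0 ≤ t → j (T t f) = S t (j f)) (hK : ∀ f, j (K f) = K' (j f)) (t : ℝ) (f : X) :
    j (perturb hT K t f) = perturb hS K' t (j f) := by
  rw [perturb_apply, perturb_apply, j.map_tsum (summable_dysonTerm hT K f t)]
  exact tsum_congr fun n => dysonTerm_intertwine hT hj hK f n t

/-- The semigroup generated by `G + K - c`, where `G` is the generator of `T`. -/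
def perturbExp [CompleteSpace X] (hT : IsC0Semigroup T) (K : X →L[ℝ] X) (c t : ℝ) : X →L[ℝ] X :=
  Real.exp (-(t * c)) • perturb hT K t

theorem perturbExp_apply [CompleteSpace X] (hT : IsC0Semigroup T) (K : X →L[ℝ] X) (c t : ℝ)
    (f : X) : perturbExp hT K c t f = Real.exp (-(t * c)) • perturb hT K t f := rfl

theorem isC0Semigroup_perturbExp [CompleteSpace X] (hT : IsC0Semigroup T) (K : X →L[ℝ] X)
    (c : ℝ) : IsC0Semigroup (perturbExp hT K c) where
  zero := by simp [perturbExp, perturb_zero]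
  add s t hs ht := by
    have h := (isC0Semigroup_perturb hT K).add s t hs ht
    simp only [perturbExp, h, smul_mul_smul_comm, ← Real.exp_add]
    congr 2
    ring
  cont f := by
    have h := perturb_continuous hT K f
    have : Continuous fun t : ℝ => Real.exp (-(t * c)) • perturb hT K t f := by fun_prop
    exact this.continuousOn

theorem perturbExp_intertwine [CompleteSpace X] [CompleteSpace Y] (hT : IsC0Semigroup T)
    {S : ℝ → Y →L[ℝ] Y} (hS : IsC0Semigroup S) {K' : Y →L[ℝ] Y} {j : X →L[ℝ] Y}
    (hj : ∀ t f, 0 ≤ t → j (T t f) = S t (j f)) (hK : ∀ f, j (K f) = K' (j f)) (c t : ℝ) (f : X) :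
    j (perturbExp hT K c t f) = perturbExp hS K' c t (j f) := by
  rw [perturbExp_apply, perturbExp_apply, map_smul, perturb_intertwine hT hS hj hK]

theorem perturbExp_sub_tendsto [CompleteSpace X] (hT : IsC0Semigroup T) (K : X →L[ℝ] X) (c : ℝ)
    (f : X) : Tendsto (fun h : ℝ => h⁻¹ • (perturbExp hT K c h f - T h f)) (𝓝[>] 0)
      (𝓝 (K f - c • f)) := by
  have h1 := perturb_sub_tendsto hT K f
  have hd : HasDerivAt (fun t : ℝ => Real.exp (-(t * c))) (-c) 0 := by
    have := (((hasDerivAt_id (0 : ℝ)).mul_const c).neg).exp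
    simpa using this
  have h2 := hasDerivWithinAt_Ioi_iff_tendsto.1 (hd.hasDerivWithinAt (s := Ioi 0))
  have h3 := (perturb_continuous hT K f).tendsto 0
  rw [perturb_zero, one_apply_eq_self] at h3
  have h4 := h1.add (h2.smul (h3.mono_left nhdsWithin_le_nhds))
  rw [neg_smul, ← sub_eq_add_neg] at h4
  refine h4.congr fun h => ?_
  simp only [zero_add, zero_mul, neg_zero, Real.exp_zero, perturbExp_apply, smul_eq_mul]
  module

/-- The generator of a semigroup that differs from `T` by a bounded operator `L` to the first
order. -/
theorem GeneratesWithCore.of_sub_tendsto {E : Type*} {T Φ : ℝ → X →L[ℝ] X} {j G : E → X}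
    (h : GeneratesWithCore T j G) (hΦ : IsC0Semigroup Φ) (L : X →L[ℝ] X)
    (hL : ∀ f, Tendsto (fun h : ℝ => h⁻¹ • (Φ h f - T h f)) (𝓝[>] 0) (𝓝 (L f))) :
    GeneratesWithCore Φ j fun e => G e + L (j e) := by
  refine ⟨hΦ, ?_⟩
  let σ : X × X ≃ₜ X × X :=
    { toFun := fun p => (p.1, p.2 + L p.1)
      invFun := fun p => (p.1, p.2 - L p.1)
      left_inv := fun p => by simp
      right_inv := fun p => by simp
      continuous_toFun := by fun_prop
      continuous_invFun := by fun_prop }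
  have h1 : (range fun e => (j e, G e + L (j e))) = σ '' range fun e => (j e, G e) := by
    rw [← range_comp]; rfl
  have h2 : generatorGraph Φ = σ '' generatorGraph T := by
    ext ⟨f, g⟩
    rw [← σ.preimage_symm]
    show _ ↔ (f, g - L f) ∈ generatorGraph T
    constructor
    · intro hf
      refine Tendsto.congr (fun r => ?_) (Tendsto.sub hf (hL f))
      rw [← smul_sub]; congr 1
      simp
    · intro hf
      have := Tendsto.add hf (hL f)
      simp only [sub_add_cancel] at this
      refine Tendsto.congr (fun r => ?_) this
      rw [← smul_add]; congr 1
      simp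
  rw [h1, h2, ← σ.image_closure, h.2]

/-! ### Products and restrictions -/

theorem IsC0Semigroup.prodMap {S : ℝ → Y →L[ℝ] Y} (hT : IsC0Semigroup T) (hS : IsC0Semigroup S) :
    IsC0Semigroup fun t => (T t).prodMap (S t) where
  zero := by ext p <;> simp [hT.zero, hS.zero]
  add s t hs ht := by
    ext p <;> simp [hT.add s t hs ht, hS.add s t hs ht]
  cont f := (hT.cont f.1).prodMk (hS.cont f.2)

/-- The restriction of `T` to an invariant subspace. -/
def restrictSemigroup (T : ℝ → X →L[ℝ] X) (W : Submodule ℝ X)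
    (hW : ∀ t, 0 ≤ t → ∀ f ∈ W, T t f ∈ W) (t : ℝ) : W →L[ℝ] W :=
  ((T (max t 0)).comp W.subtypeL).codRestrict W fun f => hW _ (le_max_right _ _) _ f.2

theorem restrictSemigroup_apply {W : Submodule ℝ X} (hW : ∀ t, 0 ≤ t → ∀ f ∈ W, T t f ∈ W) {t : ℝ}
    (ht : 0 ≤ t) (f : W) : (restrictSemigroup T W hW t f : X) = T t f := by
  simp [restrictSemigroup, ht]

theorem IsC0Semigroup.restrict {W : Submodule ℝ X} (hT : IsC0Semigroup T)
    (hW : ∀ t, 0 ≤ t → ∀ f ∈ W, T t f ∈ W) : IsC0Semigroup (restrictSemigroup T W hW) where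
  zero := by
    ext f
    rw [restrictSemigroup_apply hW le_rfl, hT.zero_apply]; rfl
  add s t hs ht := by
    ext f
    rw [mul_apply_eq_comp, restrictSemigroup_apply hW (add_nonneg hs ht),
      restrictSemigroup_apply hW hs, restrictSemigroup_apply hW ht, hT.add_apply hs ht]
  cont f := by
    refine (Topology.IsInducing.subtypeVal.continuousOn_iff).2 ?_
    refine (hT.cont f).congr fun t ht => ?_
    exact restrictSemigroup_apply hW ht f

end Perturbation

/-! ### Operators in spaces of functions vanishing at infinity -/

section FunctionSpaces

variable {X Y : Type*} [NormedAddCommGroup X]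

theorem norm_apply_le_norm (f : C₀(ℝ, X)) (x : ℝ) : ‖f x‖ ≤ ‖f‖ := by
  rw [← ZeroAtInftyContinuousMap.norm_toBCF_eq_norm]
  exact BoundedContinuousFunction.norm_coe_le_norm f.toBCF x

theorem zeroAtInfty_norm_le {f : C₀(ℝ, X)} {C : ℝ} (hC : 0 ≤ C) (h : ∀ x, ‖f x‖ ≤ C) :
    ‖f‖ ≤ C := by
  rw [← ZeroAtInftyContinuousMap.norm_toBCF_eq_norm]
  exact (BoundedContinuousFunction.norm_le hC).2 h

theorem exists_radius (f : C₀(ℝ, X)) {ε : ℝ} (hε : 0 < ε) : ∃ R : ℝ, ∀ y, R ≤ |y| → ‖f y‖ < ε := by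
  have h1 : ∀ᶠ y in cocompact ℝ, ‖f y‖ < ε := by
    have := (zero_at_infty f).norm
    rw [norm_zero] at this
    exact this.eventually (eventually_lt_nhds hε)
  rw [← Metric.cobounded_eq_cocompact, ← comap_norm_atTop, eventually_comap] at h1
  obtain ⟨R, hR⟩ := eventually_atTop.1 h1
  exact ⟨R, fun y hy => hR |y| hy y rfl⟩

theorem tendsto_cocompact_sub (z : ℝ) :
    Tendsto (fun x : ℝ => x - z) (cocompact ℝ) (cocompact ℝ) :=
  (Homeomorph.subRight z).isClosedEmbedding.tendsto_cocompact

variable (μ : Measure ℝ) [IsFiniteMeasure μ]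

theorem integrable_shift (f : C₀(ℝ, X)) (x : ℝ) : Integrable (fun z => f (x - z)) μ :=
  Integrable.of_bound (Continuous.aestronglyMeasurable (by fun_prop)) ‖f‖
    (Eventually.of_forall fun _ => norm_apply_le_norm f _)

variable [NormedSpace ℝ X] [NormedAddCommGroup Y] [NormedSpace ℝ Y]

/-- Evaluation at a point. -/
def evalAt (X : Type*) [NormedAddCommGroup X] [NormedSpace ℝ X] (x : ℝ) : C₀(ℝ, X) →L[ℝ] X :=
  LinearMap.mkContinuous
    { toFun := fun f => f x
      map_add' := fun _ _ => rfl
      map_smul' := fun _ _ => rfl } 1 fun f => by simpa using norm_apply_le_norm f x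

@[simp]
theorem evalAt_apply (x : ℝ) (f : C₀(ℝ, X)) : evalAt X x f = f x := rfl

theorem BoundedStronglyContinuous.continuous_apply {M : ℝ → X →L[ℝ] Y}
    (hM : BoundedStronglyContinuous M) {v : ℝ → X} (hv : Continuous v) :
    Continuous fun x => M x (v x) := by
  obtain ⟨C, hC⟩ := hM.1
  exact continuous_iff_continuousAt.2 fun x => tendsto_apply_of_bound
    (Eventually.of_forall hC) ((hM.2 (v x)).tendsto x) (hv.tendsto x)

/-- The operator `f ↦ M(·) f(·)`. -/
def mulOp (M : ℝ → X →L[ℝ] Y) (hM : BoundedStronglyContinuous M) : C₀(ℝ, X) →L[ℝ] C₀(ℝ, Y) :=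
  LinearMap.mkContinuousOfExistsBound
    { toFun := fun f =>
        { toFun := fun x => M x (f x)
          continuous_toFun := hM.continuous_apply (map_continuous f)
          zero_at_infty' := by
            obtain ⟨C, hC⟩ := hM.1
            refine tendsto_apply_of_bound (Eventually.of_forall hC) ?_ (zero_at_infty f)
            simp }
      map_add' := fun f g => by ext x; simp
      map_smul' := fun c f => by ext x; simp }
    (by
      obtain ⟨C, hC⟩ := hM.1
      have hC0 : 0 ≤ C := (norm_nonneg _).trans (hC 0)
      exact ⟨C, fun f => zeroAtInfty_norm_le (by positivity) fun x =>
        (M x).le_of_opNorm_le_of_le (hC x) (norm_apply_le_norm f x)⟩)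

@[simp]
theorem mulOp_apply (M : ℝ → X →L[ℝ] Y) (hM : BoundedStronglyContinuous M) (f : C₀(ℝ, X)) (x : ℝ) :
    mulOp M hM f x = M x (f x) := rfl

theorem norm_mulOp_le {M : ℝ → X →L[ℝ] Y} (hM : BoundedStronglyContinuous M) {C : ℝ} (hC0 : 0 ≤ C)
    (hC : ∀ x, ‖M x‖ ≤ C) : ‖mulOp M hM‖ ≤ C :=
  ContinuousLinearMap.opNorm_le_bound _ hC0 fun f => zeroAtInfty_norm_le (by positivity) fun x =>
    (M x).le_of_opNorm_le_of_le (hC x) (norm_apply_le_norm f x)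

theorem boundedStronglyContinuous_const (L : X →L[ℝ] Y) :
    BoundedStronglyContinuous fun _ : ℝ => L :=
  ⟨⟨‖L‖, fun _ => le_rfl⟩, fun _ => continuous_const⟩

/-- `mapC0` as a continuous linear map. -/
def mapC0L (L : X →L[ℝ] Y) : C₀(ℝ, X) →L[ℝ] C₀(ℝ, Y) :=
  mulOp (fun _ => L) (boundedStronglyContinuous_const L)

@[simp]
theorem mapC0L_apply (L : X →L[ℝ] Y) (f : C₀(ℝ, X)) (x : ℝ) : mapC0L L f x = L (f x) := rfl

/-- The operator `f ↦ ∫ f(· - z) μ(dz)`. -/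
def convOp (X : Type*) [NormedAddCommGroup X] [NormedSpace ℝ X] (μ : Measure ℝ)
    [IsFiniteMeasure μ] : C₀(ℝ, X) →L[ℝ] C₀(ℝ, X) :=
  LinearMap.mkContinuous
    { toFun := fun f =>
        { toFun := fun x => ∫ z, f (x - z) ∂μ
          continuous_toFun := by
            refine continuous_of_dominated (bound := fun _ => ‖f‖)
              (fun x => (integrable_shift μ f x).aestronglyMeasurable)
              (fun x => Eventually.of_forall fun z => norm_apply_le_norm f _) (by simp)
              (Eventually.of_forall fun z => by fun_prop)
          zero_at_infty' := by
            have : (cocompact ℝ).IsCountablyGenerated := by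
              rw [← Metric.cobounded_eq_cocompact, ← comap_norm_atTop]
              infer_instance
            have := tendsto_integral_filter_of_dominated_convergence (μ := μ)
              (l := cocompact ℝ) (F := fun x z => f (x - z)) (f := fun _ => (0 : X))
              (fun _ => ‖f‖)
              (Eventually.of_forall fun x => (integrable_shift μ f x).aestronglyMeasurable)
              (Eventually.of_forall fun x => Eventually.of_forall fun z => norm_apply_le_norm f _)
              (by simp)
              (Eventually.of_forall fun z => (zero_at_infty f).comp (tendsto_cocompact_sub z))
            simpa using this }
      map_add' := fun f g => by
        ext x
        exact integral_add (integrable_shift μ f x) (integrable_shift μ g x)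
      map_smul' := fun c f => by
        ext x
        exact integral_smul c fun z => f (x - z) }
    (μ.real univ) fun f => zeroAtInfty_norm_le (by positivity) fun x => by
      refine (norm_integral_le_of_norm_le_const (C := ‖f‖)
        (Eventually.of_forall fun z => norm_apply_le_norm f _)).trans (le_of_eq (mul_comm _ _))

@[simp]
theorem convOp_apply (f : C₀(ℝ, X)) (x : ℝ) : convOp X μ f x = ∫ z, f (x - z) ∂μ := rfl

theorem convOp_mapC0L [CompleteSpace X] [CompleteSpace Y] (L : X →L[ℝ] Y) (f : C₀(ℝ, X)) :
    mapC0L L (convOp X μ f) = convOp Y μ (mapC0L L f) := by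
  ext x
  exact (L.integral_comp_comm (integrable_shift μ f x)).symm

/-- A continuous selection of convex sets that contain `0` near infinity. -/
theorem exists_zeroAtInfty_forall_mem {P : ℝ → Set X} (hP : ∀ y, Convex ℝ (P y)) (R : ℝ)
    (hR : ∀ y, R ≤ |y| → ∀ᶠ y' in 𝓝 y, (0 : X) ∈ P y')
    (h : ∀ y, |y| < R → ∃ e, ∀ᶠ y' in 𝓝 y, e ∈ P y') : ∃ g : C₀(ℝ, X), ∀ y, g y ∈ P y := by
  have hconv : ∀ y, Convex ℝ {e | e ∈ P y ∧ (R < |y| → e = 0)} := by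
    intro y a ha b hb s t hs ht hst
    refine ⟨hP y ha.1 hb.1 hs ht hst, fun hy => ?_⟩
    simp [ha.2 hy, hb.2 hy]
  have hloc : ∀ y, ∃ e, ∀ᶠ y' in 𝓝 y, e ∈ {e | e ∈ P y' ∧ (R < |y'| → e = 0)} := by
    intro y
    rcases le_or_gt R |y| with hy | hy
    · exact ⟨0, (hR y hy).mono fun y' hy' => ⟨hy', fun _ => rfl⟩⟩
    · obtain ⟨e, he⟩ := h y hy
      refine ⟨e, ?_⟩
      filter_upwards [he, continuous_abs.continuousAt.eventually (eventually_lt_nhds hy)]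
        with y' h1 h2
      exact ⟨h1, fun h3 => absurd h3 (not_lt.2 (le_of_lt h2))⟩
  obtain ⟨g, hg⟩ := exists_continuous_forall_mem_convex_of_local_const hconv hloc
  refine ⟨⟨g, ?_⟩, fun y => (hg y).1⟩
  refine Tendsto.congr' ?_ tendsto_const_nhds
  have h1 : Tendsto (fun y : ℝ => ‖y‖) (cocompact ℝ) atTop := tendsto_norm_cocompact_atTop
  filter_upwards [h1.eventually (eventually_gt_atTop R)] with y hy
  exact ((hg y).2 hy).symm

theorem exists_zeroAtInfty_near {L : X →L[ℝ] Y} (hL : DenseRange L) (f : C₀(ℝ, Y)) {ε : ℝ}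
    (hε : 0 < ε) : ∃ g : C₀(ℝ, X), ∀ y, ‖L (g y) - f y‖ < ε := by
  obtain ⟨R, hR⟩ := exists_radius f hε
  refine exists_zeroAtInfty_forall_mem (P := fun y => {e | ‖L e - f y‖ < ε}) (fun y => ?_) R
    (fun y hy => ?_) fun y _ => ?_
  · have h1 : Convex ℝ (L ⁻¹' Metric.ball (f y) ε) :=
      (convex_ball (f y) ε).linear_preimage L.toLinearMap
    convert h1 using 1
    ext e
    simp [dist_eq_norm]
  · have : ContinuousAt (fun y' => ‖L 0 - f y'‖) y := by fun_prop
    exact this.eventually (eventually_lt_nhds (by simpa using hR y hy))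
  · obtain ⟨e, he⟩ := hL.exists_dist_lt (f y) hε
    rw [dist_comm, dist_eq_norm] at he
    have : ContinuousAt (fun y' => ‖L e - f y'‖) y := by fun_prop
    exact ⟨e, this.eventually (eventually_lt_nhds he)⟩

theorem denseRange_mapC0L {L : X →L[ℝ] Y} (hL : DenseRange L) : DenseRange (mapC0L L) := by
  intro f
  rw [Metric.mem_closure_iff]
  intro ε hε
  obtain ⟨g, hg⟩ := exists_zeroAtInfty_near hL f (half_pos hε)
  refine ⟨mapC0L L g, ⟨g, rfl⟩, ?_⟩
  rw [dist_comm, dist_eq_norm]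
  exact (zeroAtInfty_norm_le (half_pos hε).le fun x => (hg x).le).trans_lt (half_lt_self hε)

end FunctionSpaces

/-! ### Families of semigroups -/

section Families

variable {X : Type*} [NormedAddCommGroup X] [NormedSpace ℝ X]

/-- A family of strongly continuous semigroups `S x`, locally uniformly bounded and strongly
continuous in the parameter `x`. -/
structure IsC0Family (S : ℝ → ℝ → X →L[ℝ] X) : Prop where
  semigroup : ∀ x, IsC0Semigroup (S x)
  bounded : LocallyUniformlyBounded S
  cont : ∀ t e, 0 ≤ t → Continuous fun x => S x t e

variable {S : ℝ → ℝ → X →L[ℝ] X}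

theorem IsC0Family.continuous_integral (hS : IsC0Family S) (e : X) {r : ℝ} (hr : 0 ≤ r) :
    Continuous fun x => ∫ s in (0 : ℝ)..r, S x s e := by
  obtain ⟨C, hC⟩ := hS.bounded r
  refine intervalIntegral.continuous_of_dominated_interval (bound := fun _ => C * ‖e‖) (fun x => ?_)
    (fun x => Eventually.of_forall fun s hs => ?_) intervalIntegrable_const
    (Eventually.of_forall fun s hs => ?_)
  · rw [uIoc_of_le hr]
    exact ((intervalIntegrable_iff_integrableOn_Ioc_of_le hr).1
      ((hS.semigroup x).intervalIntegrable le_rfl hr e)).aestronglyMeasurable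
  · rw [uIoc_of_le hr] at hs
    exact (S x s).le_of_opNorm_le (hC x s ⟨hs.1.le, hs.2⟩) e
  · rw [uIoc_of_le hr] at hs
    exact hS.cont s e hs.1.le

theorem norm_sub_integral_le [CompleteSpace X] {T : ℝ → X →L[ℝ] X} (hT : IsC0Semigroup T) (e : X)
    {C r t : ℝ} (hr : 0 ≤ r) (ht : 0 ≤ t) (hC : ∀ s ∈ Icc 0 (r + t), ‖T s‖ ≤ C) :
    ‖T t (∫ s in (0 : ℝ)..r, T s e) - ∫ s in (0 : ℝ)..r, T s e‖ ≤ 2 * t * C * ‖e‖ := by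
  have h1 : T t (∫ s in (0 : ℝ)..r, T s e) = ∫ s in t..(r + t), T s e := by
    rw [← ContinuousLinearMap.intervalIntegral_comp_comm _ (hT.intervalIntegrable le_rfl hr e)]
    have : ∫ s in (0 : ℝ)..r, T t (T s e) = ∫ s in (0 : ℝ)..r, T (s + t) e := by
      refine intervalIntegral.integral_congr fun s hs => ?_
      rw [uIcc_of_le hr] at hs
      rw [add_comm, hT.add_apply ht hs.1]
    rw [this, intervalIntegral.integral_comp_add_right (fun s => T s e), zero_add]
  have h2 : (∫ s in t..(r + t), T s e) - ∫ s in (0 : ℝ)..r, T s e =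
      (∫ s in r..(r + t), T s e) - ∫ s in (0 : ℝ)..t, T s e := by
    have a1 := intervalIntegral.integral_add_adjacent_intervals
      (hT.intervalIntegrable le_rfl ht e) (hT.intervalIntegrable ht (add_nonneg hr ht) e)
    have a2 := intervalIntegral.integral_add_adjacent_intervals
      (hT.intervalIntegrable le_rfl hr e) (hT.intervalIntegrable hr (add_nonneg hr ht) e)
    rw [eq_sub_of_add_eq' a1, eq_sub_of_add_eq' a2]
    abel
  have h3 : ‖∫ s in r..(r + t), T s e‖ ≤ C * ‖e‖ * |r + t - r| :=
    intervalIntegral.norm_integral_le_of_norm_le_const fun s hs => by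
      rw [uIoc_of_le (by linarith)] at hs
      exact (T s).le_of_opNorm_le (hC s ⟨hr.trans hs.1.le, hs.2⟩) e
  have h4 : ‖∫ s in (0 : ℝ)..t, T s e‖ ≤ C * ‖e‖ * |t - 0| :=
    intervalIntegral.norm_integral_le_of_norm_le_const fun s hs => by
      rw [uIoc_of_le ht] at hs
      exact (T s).le_of_opNorm_le (hC s ⟨hs.1.le, by linarith [hs.2]⟩) e
  rw [h1, h2]
  rw [add_sub_cancel_left, abs_of_nonneg ht] at h3
  rw [sub_zero, abs_of_nonneg ht] at h4
  exact (norm_sub_le _ _).trans (by linarith)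

theorem IsC0Family.tendsto_zero [CompleteSpace X] (hS : IsC0Family S) (x₀ : ℝ) (e : X) :
    Tendsto (fun p : ℝ × ℝ => S p.1 p.2 e) (𝓝 x₀ ×ˢ 𝓝[≥] 0) (𝓝 e) := by
  obtain ⟨C, hC⟩ := hS.bounded 2
  have hC0 : 0 ≤ C := (norm_nonneg _).trans (hC 0 0 ⟨le_rfl, zero_le_two⟩)
  rw [Metric.tendsto_nhds]
  intro ε hε
  have hη : 0 < ε / (2 * (C + 1)) := by positivity
  have h1 := tendsto_average_integral ((hS.semigroup x₀).cont e)
  rw [(hS.semigroup x₀).zero_apply] at h1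
  obtain ⟨r, hr, hr0, hr1⟩ := ((h1.eventually (Metric.ball_mem_nhds e hη)).and
    (Ioo_mem_nhdsGT (zero_lt_one' ℝ))).exists
  rw [dist_eq_norm] at hr
  let g : ℝ → X := fun x => r⁻¹ • ∫ s in (0 : ℝ)..r, S x s e
  have hg : Continuous g := (hS.continuous_integral e hr0.le).const_smul _
  have h2 : ∀ᶠ x in 𝓝 x₀, ‖g x - e‖ < ε / (2 * (C + 1)) := by
    have : ContinuousAt (fun x => ‖g x - e‖) x₀ := by fun_prop
    exact this.eventually (eventually_lt_nhds hr)
  have h3 : ∀ᶠ t in 𝓝[≥] (0 : ℝ), t ≤ 1 ∧ r⁻¹ * (2 * t * C * ‖e‖) < ε / 2 := by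
    have hc : ContinuousAt (fun t : ℝ => r⁻¹ * (2 * t * C * ‖e‖)) 0 := by fun_prop
    refine Eventually.filter_mono nhdsWithin_le_nhds
      ((eventually_le_nhds zero_lt_one).and (hc.eventually (eventually_lt_nhds ?_)))
    simpa using hε
  filter_upwards [h2.prod_mk h3, (Eventually.prod_mk (Eventually.of_forall fun _ => trivial)
    self_mem_nhdsWithin : ∀ᶠ p : ℝ × ℝ in 𝓝 x₀ ×ˢ 𝓝[≥] 0, True ∧ p.2 ∈ Ici (0 : ℝ))]
  rintro ⟨x, t⟩ ⟨hx, ht1, ht⟩ ⟨-, ht0⟩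
  have ht0 : 0 ≤ t := ht0
  simp only at hx ht1 ht
  rw [dist_eq_norm]
  have e1 : S x t e - e = S x t (e - g x) + (S x t (g x) - g x) + (g x - e) := by
    rw [map_sub]; abel
  have e2 : ‖S x t (g x) - g x‖ ≤ r⁻¹ * (2 * t * C * ‖e‖) := by
    simp only [g]
    rw [map_smul, ← smul_sub, norm_smul, Real.norm_of_nonneg (inv_nonneg.2 hr0.le)]
    exact mul_le_mul_of_nonneg_left (norm_sub_integral_le (hS.semigroup x) e hr0.le ht0
      fun s hs => hC x s ⟨hs.1, by linarith [hs.2]⟩) (inv_nonneg.2 hr0.le)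
  have e3 : ‖S x t (e - g x)‖ ≤ C * ‖g x - e‖ := by
    rw [← norm_sub_rev]
    exact (S x t).le_of_opNorm_le (hC x t ⟨ht0, by linarith⟩) _
  have e4 : (C + 1) * ‖g x - e‖ < ε / 2 := by
    rw [lt_div_iff₀ (by positivity)] at hx
    linarith
  calc ‖S x t e - e‖ ≤ ‖S x t (e - g x)‖ + ‖S x t (g x) - g x‖ + ‖g x - e‖ := by
        rw [e1]; exact norm_add₃_le
    _ < ε := by linarith

theorem IsC0Family.continuous_max [CompleteSpace X] (hS : IsC0Family S) {α : Type*}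
    [TopologicalSpace α] {φ ψ : α → ℝ} {v : α → X} (hφ : Continuous φ) (hψ : Continuous ψ)
    (hv : Continuous v) : Continuous fun a => S (φ a) (max (ψ a) 0) (v a) := by
  rw [continuous_iff_continuousAt]
  intro a
  obtain ⟨C, hC⟩ := hS.bounded (max (ψ a) 0 + 1)
  have hψ' : Continuous fun b => max (ψ b) 0 := by fun_prop
  have hlt : ∀ᶠ b in 𝓝 a, max (ψ b) 0 ≤ max (ψ a) 0 + 1 :=
    (hψ'.tendsto a).eventually (eventually_le_nhds (lt_add_one _))
  have hb : ∀ᶠ b in 𝓝 a, ‖S (φ b) (max (ψ b) 0)‖ ≤ C := by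
    filter_upwards [hlt] with b hb' using hC _ _ ⟨le_max_right _ _, hb'⟩
  refine tendsto_apply_of_bound hb ?_ (hv.tendsto a)
  set e := v a
  have h1 : Tendsto (fun b => S (φ b) (max (ψ a) 0) e) (𝓝 a) (𝓝 (S (φ a) (max (ψ a) 0) e)) :=
    ((hS.cont _ e (le_max_right _ _)).comp hφ).tendsto a
  have h2 : Tendsto (fun b => S (φ b) |max (ψ b) 0 - max (ψ a) 0| e) (𝓝 a) (𝓝 e) := by
    refine (hS.tendsto_zero (φ a) e).comp (f := fun b => (φ b, |max (ψ b) 0 - max (ψ a) 0|))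
      ((hφ.tendsto a).prodMk (tendsto_nhdsWithin_iff.2 ⟨?_, Eventually.of_forall fun b =>
        mem_Ici.2 (abs_nonneg _)⟩))
    have : Tendsto (fun b => |max (ψ b) 0 - max (ψ a) 0|) (𝓝 a)
        (𝓝 |max (ψ a) 0 - max (ψ a) 0|) := Continuous.tendsto (by fun_prop) a
    simpa using this
  have h3 : Tendsto (fun b => S (φ b) (max (ψ b) 0) e - S (φ b) (max (ψ a) 0) e) (𝓝 a) (𝓝 0) := by
    have h4 := (tendsto_iff_norm_sub_tendsto_zero.1 h2).const_mul C
    rw [mul_zero] at h4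
    refine squeeze_zero_norm' ?_ h4
    filter_upwards [hb] with b hb'
    exact norm_semigroup_sub_le (hS.semigroup _).add (le_max_right _ _) (le_max_right _ _)
      (hC _ _ ⟨le_max_right _ _, by linarith⟩) hb' e
  simpa using h3.add h1

theorem IsC0Family.boundedStronglyContinuous (hS : IsC0Family S) (t : ℝ) :
    BoundedStronglyContinuous fun x => S x (max t 0) := by
  obtain ⟨C, hC⟩ := hS.bounded (max t 0)
  exact ⟨⟨C, fun x => hC x _ ⟨le_max_right _ _, le_rfl⟩⟩, fun e => hS.cont _ e (le_max_right _ _)⟩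

/-- The semigroup `f ↦ S(·) t f(·)` in `C_∞(ℝ, X)`. -/
def mulSemigroup (hS : IsC0Family S) (t : ℝ) : C₀(ℝ, X) →L[ℝ] C₀(ℝ, X) :=
  mulOp (fun x => S x (max t 0)) (hS.boundedStronglyContinuous t)

theorem mulSemigroup_apply (hS : IsC0Family S) {t : ℝ} (ht : 0 ≤ t) (f : C₀(ℝ, X)) (x : ℝ) :
    mulSemigroup hS t f x = S x t (f x) := by
  simp [mulSemigroup, ht]

theorem isC0Semigroup_mulSemigroup [CompleteSpace X] (hS : IsC0Family S) :
    IsC0Semigroup (mulSemigroup hS) := by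
  refine IsC0Semigroup.of_tendsto ?_ ?_ ?_ ?_
  · ext f x
    rw [mulSemigroup_apply hS le_rfl, (hS.semigroup x).zero_apply]; rfl
  · intro s t hs ht
    ext f x
    rw [mul_apply_eq_comp, mulSemigroup_apply hS (add_nonneg hs ht), mulSemigroup_apply hS hs,
      mulSemigroup_apply hS ht, (hS.semigroup x).add_apply hs ht]
  · intro r
    obtain ⟨C, hC⟩ := hS.bounded r
    refine ⟨max C 0, le_max_right _ _, fun t ht => norm_mulOp_le _ (le_max_right _ _) fun x => ?_⟩
    rw [max_eq_left ht.1]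
    exact (hC x t ht).trans (le_max_left _ _)
  · intro f
    obtain ⟨C, hC⟩ := hS.bounded 1
    have hC0 : 0 ≤ C := (norm_nonneg _).trans (hC 0 0 ⟨le_rfl, zero_le_one⟩)
    rw [Metric.tendsto_nhds]
    intro ε hε
    obtain ⟨R, hR⟩ := exists_radius f (show 0 < ε / (2 * (C + 1)) by positivity)
    have hcont : Continuous fun p : ℝ × ℝ => ‖S p.2 (max p.1 0) (f p.2) - f p.2‖ := by
      have h1 := hS.continuous_max (φ := fun p : ℝ × ℝ => p.2) (ψ := fun p : ℝ × ℝ => p.1)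
        (v := fun p => f p.2) (by fun_prop) (by fun_prop) (by fun_prop)
      exact (h1.sub ((map_continuous f).comp continuous_snd)).norm
    have h1 : ∀ᶠ t in 𝓝 (0 : ℝ), ∀ x ∈ Icc (-R) R, ‖S x (max t 0) (f x) - f x‖ < ε / 2 := by
      refine isCompact_Icc.eventually_forall_of_forall_eventually fun x hx => ?_
      refine (hcont.tendsto (0, x)).eventually (eventually_lt_nhds ?_)
      simp only [max_self, (hS.semigroup x).zero_apply, sub_self, norm_zero]
      exact half_pos hε
    have h2 : ∀ᶠ t in 𝓝 (0 : ℝ), t ≤ 1 := eventually_le_nhds zero_lt_one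
    filter_upwards [h1.filter_mono nhdsWithin_le_nhds, h2.filter_mono nhdsWithin_le_nhds,
      self_mem_nhdsWithin] with t ht1 ht2 ht0
    have ht0 : 0 ≤ t := ht0
    rw [dist_eq_norm]
    refine (zeroAtInfty_norm_le (half_pos hε).le fun x => ?_).trans_lt (half_lt_self hε)
    rw [ZeroAtInftyContinuousMap.sub_apply]
    rcases le_or_gt R |x| with hx | hx
    · have h3 := hR x hx
      rw [lt_div_iff₀ (by positivity)] at h3
      rw [mulSemigroup_apply hS ht0]
      have h4 := (S x t).le_of_opNorm_le (hC x t ⟨ht0, ht2⟩) (f x)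
      exact (norm_sub_le _ _).trans (by linarith)
    · exact (ht1 x ⟨(abs_lt.1 hx).1.le, (abs_lt.1 hx).2.le⟩).le

end Families

/-! ### Families of generators with a common core -/

section Pairs

variable {B D : Type*} [NormedAddCommGroup B] [NormedSpace ℝ B]
  [NormedAddCommGroup D] [NormedSpace ℝ D]

/-- The part of `ThreeSpaceFamily` that concerns two consecutive spaces. -/
structure PairFamily (ι : D →L[ℝ] B) (A : ℝ → D →L[ℝ] B) (SB : ℝ → ℝ → B →L[ℝ] B)
    (SD : ℝ → ℝ → D →L[ℝ] D) : Prop where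
  injective : Function.Injective ι
  dense : DenseRange ι
  A_cont : BoundedStronglyContinuous A
  generates : ∀ x, GeneratesWithCore (SB x) ι (A x)
  bounded : LocallyUniformlyBounded SB
  eq : ∀ x t d, 0 ≤ t → ι (SD x t d) = SB x t (ι d)
  bounded_sub : LocallyUniformlyBounded SD

variable {ι : D →L[ℝ] B} {A : ℝ → D →L[ℝ] B} {SB : ℝ → ℝ → B →L[ℝ] B} {SD : ℝ → ℝ → D →L[ℝ] D}

theorem PairFamily.mem_generatorGraph (h : PairFamily ι A SB SD) (x : ℝ) (d : D) :
    (ι d, A x d) ∈ generatorGraph (SB x) := by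
  rw [← (h.generates x).2]
  exact subset_closure ⟨d, rfl⟩

theorem PairFamily.mem_generatorGraph' (h : PairFamily ι A SB SD) (x y : ℝ) (d : D) {s : ℝ}
    (hs : 0 ≤ s) : (SB y s (ι d), A x (SD y s d)) ∈ generatorGraph (SB x) := by
  rw [← h.eq y s d hs]
  exact h.mem_generatorGraph x _

theorem PairFamily.duhamel [CompleteSpace B] (h : PairFamily ι A SB SD) (x y : ℝ) (d : D) {t : ℝ}
    (ht : 0 ≤ t) :
    IntervalIntegrable (fun s => SB x (t - s) ((A y - A x) (SD y s d))) volume 0 t ∧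
      ∫ s in (0 : ℝ)..t, SB x (t - s) ((A y - A x) (SD y s d)) =
        SB y t (ι d) - SB x t (ι d) := by
  obtain ⟨C, hC⟩ := h.bounded_sub t
  exact _root_.duhamel (h.generates x).1 (h.generates y).1 (f := ι d)
    (g := fun s => A y (SD y s d)) (k := fun s => A x (SD y s d)) (C := ‖A y - A x‖ * (C * ‖d‖)) ht
    (fun s hs => h.mem_generatorGraph' y y d hs.1) (fun s hs => h.mem_generatorGraph' x y d hs.1)
    fun s hs => (A y - A x).le_of_opNorm_le_of_le le_rfl
      ((SD y s).le_of_opNorm_le (hC y s ⟨hs.1, hs.2.le⟩) d)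

theorem PairFamily.exists_bound_A (h : PairFamily ι A SB SD) : ∃ C, 0 ≤ C ∧ ∀ x, ‖A x‖ ≤ C := by
  obtain ⟨C, hC⟩ := h.A_cont.1
  exact ⟨C, (norm_nonneg _).trans (hC 0), hC⟩

theorem PairFamily.isC0Family [CompleteSpace B] (h : PairFamily ι A SB SD) : IsC0Family SB := by
  refine ⟨fun x => (h.generates x).1, h.bounded, fun t e ht => ?_⟩
  obtain ⟨CA, hCA0, hCA⟩ := h.exists_bound_A
  obtain ⟨CB, hCB⟩ := h.bounded t
  obtain ⟨CD, hCD⟩ := h.bounded_sub t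
  have hCB0 : 0 ≤ CB := (norm_nonneg _).trans (hCB 0 0 ⟨le_rfl, ht⟩)
  rw [continuous_iff_continuousAt]
  intro y
  have hD : ∀ d, Tendsto (fun x => SB x t (ι d)) (𝓝 y) (𝓝 (SB y t (ι d))) := by
    intro d
    have h1 := intervalIntegral.tendsto_integral_filter_of_dominated_convergence
      (μ := volume) (a := 0) (b := t) (l := 𝓝 y)
      (F := fun x s => SB x (t - s) ((A y - A x) (SD y s d))) (f := fun _ => (0 : B))
      (fun _ => CB * ((CA + CA) * (CD * ‖d‖)))
      (Eventually.of_forall fun x => ?_)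
      (Eventually.of_forall fun x => Eventually.of_forall fun s hs => ?_) intervalIntegrable_const
      (Eventually.of_forall fun s hs => ?_)
    · simp only [(h.duhamel _ y d ht).2, intervalIntegral.integral_zero] at h1
      have h2 := (tendsto_const_nhds (x := SB y t (ι d))).sub h1
      simpa using h2
    · rw [uIoc_of_le ht]
      exact ((intervalIntegrable_iff_integrableOn_Ioc_of_le ht).1
        (h.duhamel x y d ht).1).aestronglyMeasurable
    · rw [uIoc_of_le ht] at hs
      exact (SB x _).le_of_opNorm_le_of_le (hCB x _ ⟨by linarith [hs.2], by linarith [hs.1]⟩)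
        ((A y - A x).le_of_opNorm_le_of_le ((norm_sub_le _ _).trans (add_le_add (hCA y) (hCA x)))
          ((SD y s).le_of_opNorm_le (hCD y s ⟨hs.1.le, hs.2⟩) d))
    · rw [uIoc_of_le ht] at hs
      refine squeeze_zero_norm (a := fun x => CB * ‖(A y - A x) (SD y s d)‖) (fun x =>
        (SB x _).le_of_opNorm_le (hCB x _ ⟨by linarith [hs.2], by linarith [hs.1]⟩) _) ?_
      have h3 : Tendsto (fun x => A y (SD y s d) - A x (SD y s d)) (𝓝 y)
          (𝓝 (A y (SD y s d) - A y (SD y s d))) :=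
        tendsto_const_nhds.sub ((h.A_cont.2 _).tendsto y)
      rw [sub_self] at h3
      simpa using h3.norm.const_mul CB
  have hbd : ∀ x, ‖SB x t‖ ≤ CB := fun x => hCB x t ⟨ht, le_rfl⟩
  rw [ContinuousAt, Metric.tendsto_nhds]
  intro ε hε
  obtain ⟨d, hd⟩ := h.dense.exists_dist_lt e (show 0 < ε / (4 * (CB + 1)) by positivity)
  rw [dist_eq_norm, lt_div_iff₀ (by positivity)] at hd
  filter_upwards [Metric.tendsto_nhds.1 (hD d) (ε / 2) (half_pos hε)] with x hx
  rw [dist_eq_norm] at hx ⊢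
  have e1 : SB x t e - SB y t e =
      SB x t (e - ι d) + (SB x t (ι d) - SB y t (ι d)) - SB y t (e - ι d) := by
    simp only [map_sub]; abel
  have e2 := (SB x t).le_of_opNorm_le (hbd x) (e - ι d)
  have e3 := (SB y t).le_of_opNorm_le (hbd y) (e - ι d)
  rw [e1]
  have e4 := norm_sub_le (SB x t (e - ι d) + (SB x t (ι d) - SB y t (ι d))) (SB y t (e - ι d))
  have e5 := norm_add_le (SB x t (e - ι d)) (SB x t (ι d) - SB y t (ι d))
  have e6 := norm_nonneg (e - ι d)
  nlinarith

theorem PairFamily.isC0Family_sub (h : PairFamily ι A SB SD)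
    (hSD : StronglyContinuousFamily SD) : IsC0Family SD := by
  refine ⟨fun x => ⟨?_, fun s t hs ht => ?_, hSD.cont_time x⟩, h.bounded_sub, hSD.cont_space⟩
  · ext d
    apply h.injective
    rw [h.eq x 0 d le_rfl, (h.generates x).1.zero_apply]; rfl
  · ext d
    apply h.injective
    rw [mul_apply_eq_comp, h.eq x _ d (add_nonneg hs ht), h.eq x _ _ hs, h.eq x _ _ ht,
      (h.generates x).1.add_apply hs ht]

theorem evalAt_mulSemigroup {S : ℝ → ℝ → B →L[ℝ] B} (hS : IsC0Family S) (x t : ℝ) (f : C₀(ℝ, B))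
    (ht : 0 ≤ t) : evalAt B x (mulSemigroup hS t f) = S x t (evalAt B x f) :=
  mulSemigroup_apply hS ht f x

theorem PairFamily.mapC0L_mulSemigroup (h : PairFamily ι A SB SD) (hSB : IsC0Family SB)
    (hSD : IsC0Family SD) (t : ℝ) (f : C₀(ℝ, D)) (ht : 0 ≤ t) :
    mapC0L ι (mulSemigroup hSD t f) = mulSemigroup hSB t (mapC0L ι f) := by
  ext x
  rw [mapC0L_apply, mulSemigroup_apply hSD ht, mulSemigroup_apply hSB ht, h.eq x t _ ht]; rfl

theorem PairFamily.generatesWithCore [CompleteSpace B] [CompleteSpace D]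
    (h : PairFamily ι A SB SD) (hSB : IsC0Family SB) (hSD : IsC0Family SD) :
    GeneratesWithCore (mulSemigroup hSB) (mapC0L ι) (mulOp A h.A_cont) :=
  generatesWithCore_of_invariant (isC0Semigroup_mulSemigroup hSB) (isC0Semigroup_mulSemigroup hSD)
    (denseRange_mapC0L h.dense) (h.mapC0L_mulSemigroup hSB hSD) fun f =>
      mem_generatorGraph_of_forall (isC0Semigroup_mulSemigroup hSB) hSB.semigroup (π := evalAt B)
        (fun _ hf => ZeroAtInftyContinuousMap.ext hf)
        (fun x t f ht => evalAt_mulSemigroup hSB x t f ht)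
        fun x => h.mem_generatorGraph x (f x)

/-- The semigroup generated by `L'_ν + A(·)`, where `S x` is generated by `A x`. -/
def levySemigroup {X : Type*} [NormedAddCommGroup X] [NormedSpace ℝ X] [CompleteSpace X]
    {S : ℝ → ℝ → X →L[ℝ] X} (ν : Measure ℝ) [IsFiniteMeasure ν] (hS : IsC0Family S) (t : ℝ) :
    C₀(ℝ, X) →L[ℝ] C₀(ℝ, X) :=
  perturbExp (isC0Semigroup_mulSemigroup hS) (convOp X ν) (ν.real univ) t

variable (ν : Measure ℝ) [IsFiniteMeasure ν]

theorem isC0Semigroup_levySemigroup [CompleteSpace B] (hSB : IsC0Family SB) :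
    IsC0Semigroup (levySemigroup ν hSB) :=
  isC0Semigroup_perturbExp _ _ _

theorem PairFamily.mapC0_levySemigroup [CompleteSpace B] [CompleteSpace D]
    (h : PairFamily ι A SB SD) (hSB : IsC0Family SB) (hSD : IsC0Family SD) (t : ℝ) (f : C₀(ℝ, D)) :
    mapC0 ι (levySemigroup ν hSD t f) = levySemigroup ν hSB t (mapC0 ι f) :=
  perturbExp_intertwine (isC0Semigroup_mulSemigroup hSD) (isC0Semigroup_mulSemigroup hSB)
    (j := mapC0L ι) (h.mapC0L_mulSemigroup hSB hSD) (convOp_mapC0L ν ι) _ _ _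

theorem levyAdd_eq (ι : D →L[ℝ] B) (A : ℝ → D →L[ℝ] B) [CompleteSpace B] (f : C₀(ℝ, D)) (x : ℝ) :
    levyAdd ν ι A f x = A x (f x) +
      (convOp B ν (mapC0 ι f) x - ν.real univ • mapC0 ι f x) := by
  have h := integral_sub (integrable_shift ν (mapC0 ι f) x) (integrable_const (mapC0 ι f x))
  rw [integral_const] at h
  rw [add_comm]
  exact congrArg (· + A x (f x)) h

theorem PairFamily.exists_generator [CompleteSpace B] [CompleteSpace D]
    (h : PairFamily ι A SB SD) (hSB : IsC0Family SB) (hSD : IsC0Family SD) :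
    ∃ G : C₀(ℝ, D) → C₀(ℝ, B), (∀ f x, G f x = levyAdd ν ι A f x) ∧
      GeneratesWithCore (levySemigroup ν hSB) (mapC0 ι) G := by
  refine ⟨_, fun f x => ?_, (h.generatesWithCore hSB hSD).of_sub_tendsto
    (isC0Semigroup_levySemigroup ν hSB)
    (convOp B ν - ν.real univ • ContinuousLinearMap.id ℝ C₀(ℝ, B)) fun f =>
      perturbExp_sub_tendsto _ _ _ f⟩
  rw [levyAdd_eq]
  rfl

end Pairs

/-! ### Spaces of differentiable functions -/

section Differentiable

variable {B D : Type*} [NormedAddCommGroup B] [NormedSpace ℝ B]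
  [NormedAddCommGroup D] [NormedSpace ℝ D]

theorem C1Space.isClosed (ι : D →L[ℝ] B) : IsClosed (C1Space ι : Set (C₀(ℝ, D) × C₀(ℝ, B))) := by
  refine isClosed_of_closure_subset fun p hp => ?_
  have hne := mem_closure_iff_nhdsWithin_neBot.1 hp
  set l := 𝓝[(C1Space ι : Set (C₀(ℝ, D) × C₀(ℝ, B)))] p
  have hfst : Tendsto (fun q : C₀(ℝ, D) × C₀(ℝ, B) => q.1) l (𝓝 p.1) :=
    (continuous_fst.tendsto p).mono_left nhdsWithin_le_nhds
  have hsnd : Tendsto (fun q : C₀(ℝ, D) × C₀(ℝ, B) => q.2) l (𝓝 p.2) :=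
    (continuous_snd.tendsto p).mono_left nhdsWithin_le_nhds
  refine hasDerivAt_of_tendstoUniformly (l := l) (f := fun q x => ι (q.1 x))
    (f' := fun q x => q.2 x)
    (ZeroAtInftyContinuousMap.tendsto_iff_tendstoUniformly.1 hsnd)
    (eventually_mem_nhdsWithin.mono fun q hq => hq) fun x => ?_
  exact ((ι.comp (evalAt D x)).continuous.tendsto p.1).comp hfst

instance C1Space.completeSpace [CompleteSpace B] [CompleteSpace D] (ι : D →L[ℝ] B) :
    CompleteSpace (C1Space ι) :=
  (C1Space.isClosed ι).completeSpace_coe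

/-- The function itself, as an element of `C_∞(ℝ, D)`. -/
def C1Space.toC0 (ι : D →L[ℝ] B) : C1Space ι →L[ℝ] C₀(ℝ, D) :=
  (ContinuousLinearMap.fst ℝ _ _).comp (C1Space ι).subtypeL

@[simp]
theorem C1Space.toC0_apply (ι : D →L[ℝ] B) (p : C1Space ι) : C1Space.toC0 ι p = p.1.1 := rfl

theorem C1Space.ext_fst {ι : D →L[ℝ] B} {p q : C1Space ι} (h : ∀ x, p.1.1 x = q.1.1 x) :
    p = q := by
  have h1 : p.1.1 = q.1.1 := ZeroAtInftyContinuousMap.ext h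
  refine Subtype.ext (Prod.ext h1 (ZeroAtInftyContinuousMap.ext fun x => ?_))
  have h2 := p.2 x
  rw [h1] at h2
  exact h2.unique (q.2 x)

/-- `f ↦ ∫ f(· - z) μ(dz)` in `C¹_∞(ℝ, B) ∩ C_∞(ℝ, D)`. -/
def C1Space.convOp [CompleteSpace B] [CompleteSpace D] (ι : D →L[ℝ] B) (μ : Measure ℝ)
    [IsFiniteMeasure μ] : C1Space ι →L[ℝ] C1Space ι :=
  ((((_root_.convOp D μ).prodMap (_root_.convOp B μ)).comp (C1Space ι).subtypeL).codRestrict _)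
    fun p x => by
      have h1 := hasDerivAt_integral_of_dominated_loc_of_deriv_le (μ := μ) (x₀ := x) (s := univ)
        (F := fun x z => ι (p.1.1 (x - z))) (F' := fun x z => p.1.2 (x - z))
        (bound := fun _ => ‖p.1.2‖) univ_mem
        (Eventually.of_forall fun y =>
          (integrable_shift μ (mapC0 ι p.1.1) y).aestronglyMeasurable)
        (integrable_shift μ (mapC0 ι p.1.1) x)
        (integrable_shift μ p.1.2 x).aestronglyMeasurable
        (Eventually.of_forall fun z y _ => norm_apply_le_norm _ _) (by simp)
        (Eventually.of_forall fun z y _ => (p.2 (y - z)).comp_sub_const y z)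
      refine h1.2.congr_of_eventuallyEq (Eventually.of_forall fun y => ?_)
      exact (ι.integral_comp_comm (integrable_shift μ p.1.1 y)).symm

theorem C1Space.toC0_convOp [CompleteSpace B] [CompleteSpace D] (ι : D →L[ℝ] B) (μ : Measure ℝ)
    [IsFiniteMeasure μ] (p : C1Space ι) :
    C1Space.toC0 ι (C1Space.convOp ι μ p) = _root_.convOp D μ (C1Space.toC0 ι p) := rfl

theorem norm_sub_le_of_bounded_deriv {A : ℝ → D →L[ℝ] B} (hA : Differentiable ℝ A) {C : ℝ}
    (hC : ∀ x, ‖deriv A x‖ ≤ C) (x y : ℝ) : ‖A y - A x‖ ≤ C * |y - x| :=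
  convex_univ.norm_image_sub_le_of_norm_deriv_le (fun z _ => hA z) (fun z _ => hC z)
    (mem_univ x) (mem_univ y)

variable {ι : D →L[ℝ] B} {A : ℝ → D →L[ℝ] B} {SB : ℝ → ℝ → B →L[ℝ] B} {SD : ℝ → ℝ → D →L[ℝ] D}

theorem PairFamily.hasDerivAt [CompleteSpace B] (h : PairFamily ι A SB SD)
    (hdiff : Differentiable ℝ A) (hA' : BoundedStronglyContinuous (deriv A)) {f : ℝ → D} {g : B}
    {x t : ℝ} (ht : 0 ≤ t) (hf : HasDerivAt (fun y => ι (f y)) g x) :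
    HasDerivAt (fun y => SB y t (ι (f y)))
      (SB x t g + ∫ s in (0 : ℝ)..t, SB x s (deriv A x (SD x (t - s) (f x)))) x := by
  have hSB := h.isC0Family
  obtain ⟨C', hC'⟩ := hA'.1
  obtain ⟨CB, hCB⟩ := h.bounded t
  obtain ⟨CD, hCD⟩ := h.bounded_sub t
  have hlip := norm_sub_le_of_bounded_deriv hdiff hC'
  rw [hasDerivAt_iff_tendsto_slope] at hf ⊢
  set d := f x with hd
  have hbd : ∀ r ∈ Icc 0 t, ∀ᶠ y in 𝓝[≠] x, ‖SB y r‖ ≤ CB := fun r hr =>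
    Eventually.of_forall fun y => hCB y r hr
  have h1 : Tendsto (fun y => SB y t (slope (fun y => ι (f y)) x y)) (𝓝[≠] x) (𝓝 (SB x t g)) :=
    tendsto_apply_of_bound (hbd t ⟨ht, le_rfl⟩)
      (((hSB.cont t g ht).tendsto x).mono_left nhdsWithin_le_nhds) hf
  have h2 : Tendsto (fun y => ∫ s in (0 : ℝ)..t, (y - x)⁻¹ • -(SB y (t - s) ((A x - A y)
      (SD x s d)))) (𝓝[≠] x) (𝓝 (∫ s in (0 : ℝ)..t, SB x (t - s) (deriv A x (SD x s d)))) := by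
    refine intervalIntegral.tendsto_integral_filter_of_dominated_convergence
      (fun _ => CB * (C' * (CD * ‖d‖))) (Eventually.of_forall fun y => ?_) ?_
      intervalIntegrable_const (Eventually.of_forall fun s hs => ?_)
    · rw [uIoc_of_le ht]
      exact (((intervalIntegrable_iff_integrableOn_Ioc_of_le ht).1
        (h.duhamel y x d ht).1).aestronglyMeasurable.neg).const_smul _
    · filter_upwards [self_mem_nhdsWithin] with y hy
      refine Eventually.of_forall fun s hs => ?_
      rw [uIoc_of_le ht] at hs
      have hy0 : 0 < |y - x| := abs_pos.2 (sub_ne_zero.2 hy)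
      have e1 := (SB y (t - s)).le_of_opNorm_le_of_le
        (hCB y _ ⟨by linarith [hs.2], by linarith [hs.1]⟩)
        ((A x - A y).le_of_opNorm_le_of_le (hlip y x)
          ((SD x s).le_of_opNorm_le (hCD x s ⟨hs.1.le, hs.2⟩) d))
      rw [norm_smul, norm_neg, norm_inv, Real.norm_eq_abs, inv_mul_le_iff₀ hy0]
      rw [abs_sub_comm] at e1
      linarith
    · rw [uIoc_of_le ht] at hs
      have hts : 0 ≤ t - s := by linarith [hs.2]
      have e1 : Tendsto (fun y => slope A x y (SD x s d)) (𝓝[≠] x)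
          (𝓝 (deriv A x (SD x s d))) :=
        ((ContinuousLinearMap.apply ℝ B (SD x s d)).continuous.tendsto _).comp
          (hasDerivAt_iff_tendsto_slope.1 (hdiff x).hasDerivAt)
      have e2 := tendsto_apply_of_bound (hbd (t - s) ⟨hts, by linarith [hs.1]⟩)
        (((hSB.cont (t - s) (deriv A x (SD x s d)) hts).tendsto x).mono_left nhdsWithin_le_nhds) e1
      refine e2.congr fun y => ?_
      rw [slope_def_module, ← map_neg, ← map_smul, ← neg_apply, neg_sub]
      rfl
  have h3 := h1.add h2
  have h4 : ∫ s in (0 : ℝ)..t, SB x (t - s) (deriv A x (SD x s d)) =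
      ∫ s in (0 : ℝ)..t, SB x s (deriv A x (SD x (t - s) d)) := by
    have := intervalIntegral.integral_comp_sub_left (a := 0) (b := t)
      (fun s => SB x s (deriv A x (SD x (t - s) d))) t
    simpa using this
  rw [h4] at h3
  refine h3.congr fun y => ?_
  rw [intervalIntegral.integral_smul, intervalIntegral.integral_neg, (h.duhamel y x d ht).2,
    slope_def_module, slope_def_module, map_smul, ← smul_add, map_sub]
  congr 1
  abel

/-- The semigroup in `C_∞(ℝ, D) × C_∞(ℝ, B)` that governs the pairs `(f, f')`. -/
def tangentSemigroup [CompleteSpace B] [CompleteSpace D] (hSB : IsC0Family SB)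
    (hSD : IsC0Family SD) (hA' : BoundedStronglyContinuous (deriv A)) (t : ℝ) :
    C₀(ℝ, D) × C₀(ℝ, B) →L[ℝ] C₀(ℝ, D) × C₀(ℝ, B) :=
  perturb ((isC0Semigroup_mulSemigroup hSD).prodMap (isC0Semigroup_mulSemigroup hSB))
    ((ContinuousLinearMap.inr ℝ _ _).comp
      ((mulOp (deriv A) hA').comp (ContinuousLinearMap.fst ℝ _ _))) t

theorem isC0Semigroup_tangentSemigroup [CompleteSpace B] [CompleteSpace D] (hSB : IsC0Family SB)
    (hSD : IsC0Family SD) (hA' : BoundedStronglyContinuous (deriv A)) :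
    IsC0Semigroup (tangentSemigroup hSB hSD hA') :=
  isC0Semigroup_perturb
    ((isC0Semigroup_mulSemigroup hSD).prodMap (isC0Semigroup_mulSemigroup hSB)) _

theorem tangentSemigroup_fst [CompleteSpace B] [CompleteSpace D] (hSB : IsC0Family SB)
    (hSD : IsC0Family SD) (hA' : BoundedStronglyContinuous (deriv A)) {t : ℝ} (ht : 0 ≤ t)
    (p : C₀(ℝ, D) × C₀(ℝ, B)) :
    (tangentSemigroup hSB hSD hA' t p).1 = mulSemigroup hSD t p.1 := by
  have h1 := perturb_intertwine
    ((isC0Semigroup_mulSemigroup hSD).prodMap (isC0Semigroup_mulSemigroup hSB))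
    (K := (ContinuousLinearMap.inr ℝ _ _).comp
      ((mulOp (deriv A) hA').comp (ContinuousLinearMap.fst ℝ _ _)))
    (isC0Semigroup_mulSemigroup hSD) (K' := 0) (j := ContinuousLinearMap.fst ℝ _ _)
    (fun _ _ _ => rfl) (fun _ => rfl) t p
  refine h1.trans ?_
  rw [perturb_eq _ _ _ ht]
  simp

theorem tangentSemigroup_snd [CompleteSpace B] [CompleteSpace D] (hSB : IsC0Family SB)
    (hSD : IsC0Family SD) (hA' : BoundedStronglyContinuous (deriv A)) {t : ℝ} (ht : 0 ≤ t)
    (p : C₀(ℝ, D) × C₀(ℝ, B)) (x : ℝ) :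
    (tangentSemigroup hSB hSD hA' t p).2 x = SB x t (p.2 x) +
      ∫ s in (0 : ℝ)..t, SB x s (deriv A x (SD x (t - s) (p.1 x))) := by
  let π : C₀(ℝ, D) × C₀(ℝ, B) →L[ℝ] B := (evalAt B x).comp (ContinuousLinearMap.snd ℝ _ _)
  have hprod := (isC0Semigroup_mulSemigroup hSD).prodMap (isC0Semigroup_mulSemigroup hSB)
  have h1 := congrArg π (perturb_eq hprod ((ContinuousLinearMap.inr ℝ _ _).comp
      ((mulOp (deriv A) hA').comp (ContinuousLinearMap.fst ℝ _ _))) p ht)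
  rw [map_add, ← ContinuousLinearMap.intervalIntegral_comp_comm _
    ((perturb_integrand_continuous hprod _ p t).intervalIntegrable _ _)] at h1
  refine h1.trans ?_
  congr 1
  · exact mulSemigroup_apply hSB ht p.2 x
  · refine intervalIntegral.integral_congr fun s hs => ?_
    rw [uIcc_of_le ht] at hs
    have h2 := tangentSemigroup_fst hSB hSD hA' (sub_nonneg.2 hs.2) p
    rw [← mulSemigroup_apply hSD (sub_nonneg.2 hs.2), ← h2]
    simp only [max_eq_left hs.1]
    exact mulSemigroup_apply hSB hs.1 _ x

variable [CompleteSpace B] [CompleteSpace D]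

theorem PairFamily.tangentSemigroup_mem (h : PairFamily ι A SB SD) (hSB : IsC0Family SB)
    (hSD : IsC0Family SD) (hdiff : Differentiable ℝ A)
    (hA' : BoundedStronglyContinuous (deriv A)) (t : ℝ) (ht : 0 ≤ t)
    (p : C₀(ℝ, D) × C₀(ℝ, B)) (hp : p ∈ C1Space ι) :
    tangentSemigroup hSB hSD hA' t p ∈ C1Space ι := by
  intro x
  rw [tangentSemigroup_snd hSB hSD hA' ht, tangentSemigroup_fst hSB hSD hA' ht]
  refine (h.hasDerivAt hdiff hA' ht (hp x)).congr_of_eventuallyEq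
    (Eventually.of_forall fun y => ?_)
  simp only [mulSemigroup_apply hSD ht]
  exact h.eq y t _ ht

/-- The semigroup `f ↦ S(·) t f(·)` in `C¹_∞(ℝ, B) ∩ C_∞(ℝ, D)`. -/
def PairFamily.c1Semigroup (h : PairFamily ι A SB SD) (hSB : IsC0Family SB)
    (hSD : IsC0Family SD) (hdiff : Differentiable ℝ A)
    (hA' : BoundedStronglyContinuous (deriv A)) (t : ℝ) : C1Space ι →L[ℝ] C1Space ι :=
  restrictSemigroup (tangentSemigroup hSB hSD hA') (C1Space ι)
    (h.tangentSemigroup_mem hSB hSD hdiff hA') t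

theorem PairFamily.isC0Semigroup_c1Semigroup (h : PairFamily ι A SB SD) (hSB : IsC0Family SB)
    (hSD : IsC0Family SD) (hdiff : Differentiable ℝ A)
    (hA' : BoundedStronglyContinuous (deriv A)) :
    IsC0Semigroup (h.c1Semigroup hSB hSD hdiff hA') :=
  (isC0Semigroup_tangentSemigroup hSB hSD hA').restrict (h.tangentSemigroup_mem hSB hSD hdiff hA')

theorem PairFamily.toC0_c1Semigroup (h : PairFamily ι A SB SD) (hSB : IsC0Family SB)
    (hSD : IsC0Family SD) (hdiff : Differentiable ℝ A)
    (hA' : BoundedStronglyContinuous (deriv A)) (t : ℝ) (p : C1Space ι) (ht : 0 ≤ t) :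
    C1Space.toC0 ι (h.c1Semigroup hSB hSD hdiff hA' t p) =
      mulSemigroup hSD t (C1Space.toC0 ι p) := by
  rw [C1Space.toC0_apply, PairFamily.c1Semigroup, restrictSemigroup_apply _ ht,
    tangentSemigroup_fst hSB hSD hA' ht]
  rfl

/-- The semigroup generated by `L'_ν + A(·)` in `C¹_∞(ℝ, B) ∩ C_∞(ℝ, D)`. -/
def PairFamily.c1Levy (h : PairFamily ι A SB SD) (ν : Measure ℝ) [IsFiniteMeasure ν]
    (hSB : IsC0Family SB) (hSD : IsC0Family SD) (hdiff : Differentiable ℝ A)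
    (hA' : BoundedStronglyContinuous (deriv A)) (t : ℝ) : C1Space ι →L[ℝ] C1Space ι :=
  perturbExp (h.isC0Semigroup_c1Semigroup hSB hSD hdiff hA') (C1Space.convOp ι ν)
    (ν.real univ) t

theorem PairFamily.c1Levy_fst (h : PairFamily ι A SB SD) (ν : Measure ℝ) [IsFiniteMeasure ν]
    (hSB : IsC0Family SB) (hSD : IsC0Family SD) (hdiff : Differentiable ℝ A)
    (hA' : BoundedStronglyContinuous (deriv A)) (t : ℝ) (p : C1Space ι) :
    (h.c1Levy ν hSB hSD hdiff hA' t p).1.1 = levySemigroup ν hSD t p.1.1 :=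
  perturbExp_intertwine (h.isC0Semigroup_c1Semigroup hSB hSD hdiff hA')
    (isC0Semigroup_mulSemigroup hSD) (j := C1Space.toC0 ι)
    (h.toC0_c1Semigroup hSB hSD hdiff hA') (C1Space.toC0_convOp ι ν) _ _ _

end Differentiable

/-! ### Steklov averages -/

section Steklov

theorem eventually_mem_Ioo_zero_one : ∀ᶠ δ : ℝ in 𝓝[>] 0, 0 < δ ∧ δ < 1 :=
  Ioo_mem_nhdsGT zero_lt_one

theorem eventually_oscillation_le {X : Type*} [NormedAddCommGroup X] (F : C₀(ℝ, X)) {η : ℝ} (hη : 0 < η) :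
    ∀ᶠ δ in 𝓝[>] (0 : ℝ), ∀ x, ∀ y ∈ Icc x (x + δ), ‖F y - F x‖ ≤ η := by
  obtain ⟨δ₀, hδ₀, h⟩ := Metric.uniformContinuous_iff.1
    (ZeroAtInftyContinuousMap.uniformContinuous F) η hη
  filter_upwards [Ioo_mem_nhdsGT hδ₀] with δ hδ x y hy
  rw [← dist_eq_norm]
  refine (h ?_).le
  rw [Real.dist_eq, abs_of_nonneg (by linarith [hy.1])]
  linarith [hy.2, hδ.2]

variable {X Y : Type*} [NormedAddCommGroup X] [NormedSpace ℝ X]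
  [NormedAddCommGroup Y] [NormedSpace ℝ Y]

/-- The uniform distribution on `[-δ, 0]`. -/
def steklovMeasure (δ : ℝ) : Measure ℝ :=
  ENNReal.ofReal δ⁻¹ • volume.restrict (Icc (-δ) 0)

instance (δ : ℝ) : IsFiniteMeasure (steklovMeasure δ) :=
  Measure.smul_finite _ ENNReal.ofReal_ne_top

theorem isProbabilityMeasure_steklovMeasure {δ : ℝ} (hδ : 0 < δ) :
    IsProbabilityMeasure (steklovMeasure δ) := by
  constructor
  simp only [steklovMeasure, Measure.smul_apply, Measure.restrict_apply_univ, Real.volume_Icc,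
    smul_eq_mul, sub_neg_eq_add, zero_add]
  rw [← ENNReal.ofReal_mul (by positivity), inv_mul_cancel₀ hδ.ne', ENNReal.ofReal_one]

theorem convOp_steklovMeasure {δ : ℝ} (hδ : 0 < δ) (e : C₀(ℝ, X)) (x : ℝ) :
    convOp X (steklovMeasure δ) e x = δ⁻¹ • ∫ y in x..(x + δ), e y := by
  rw [convOp_apply, steklovMeasure, integral_smul_measure,
    ENNReal.toReal_ofReal (inv_nonneg.2 hδ.le), integral_Icc_eq_integral_Ioc,
    ← intervalIntegral.integral_of_le (by linarith), intervalIntegral.integral_comp_sub_left]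
  simp

theorem norm_convOp_steklovMeasure_sub_le [CompleteSpace X] [CompleteSpace Y] {δ ε : ℝ}
    (hδ : 0 < δ) (e : C₀(ℝ, X)) (L : X →L[ℝ] Y) {x : ℝ} {c : Y}
    (h : ∀ y ∈ Icc x (x + δ), ‖L (e y) - c‖ ≤ ε) :
    ‖L (convOp X (steklovMeasure δ) e x) - c‖ ≤ ε := by
  have := isProbabilityMeasure_steklovMeasure hδ
  have h1 : L (convOp X (steklovMeasure δ) e x) - c =
      ∫ z, (L (e (x - z)) - c) ∂steklovMeasure δ := by
    rw [integral_sub (L.integrable_comp (integrable_shift _ e x)) (integrable_const c),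
      L.integral_comp_comm (integrable_shift _ e x)]
    simp
  rw [h1]
  refine (norm_integral_le_of_norm_le_const (C := ε) ?_).trans (by simp)
  refine Measure.ae_smul_measure ?_ _
  filter_upwards [ae_restrict_mem measurableSet_Icc] with z hz
  exact h _ ⟨by linarith [hz.2], by linarith [hz.1]⟩

theorem hasDerivAt_convOp_steklovMeasure [CompleteSpace X] {δ : ℝ} (hδ : 0 < δ) (e : C₀(ℝ, X))
    (x : ℝ) : HasDerivAt (fun y => convOp X (steklovMeasure δ) e y)
      (δ⁻¹ • (e (x + δ) - e x)) x := by
  have hc : Continuous e := map_continuous e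
  have h2 : ∀ a, HasDerivAt (fun r => ∫ s in (0 : ℝ)..r, e s) (e a) a :=
    fun a => intervalIntegral.integral_hasDerivAt_right (hc.intervalIntegrable _ _)
      hc.aestronglyMeasurable.stronglyMeasurableAtFilter hc.continuousAt
  have h3 := ((HasDerivAt.comp_add_const x δ (h2 (x + δ))).sub (h2 x)).const_smul δ⁻¹
  refine h3.congr_of_eventuallyEq (Eventually.of_forall fun y => ?_)
  simp only
  rw [convOp_steklovMeasure hδ]
  congr 1
  exact (intervalIntegral.integral_interval_sub_left (hc.intervalIntegrable _ _)
    (hc.intervalIntegrable _ _)).symm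

/-- The Steklov average of a continuous function, as an element of `C¹_∞(ℝ, Y) ∩ C_∞(ℝ, X)`. -/
def steklovC1 [CompleteSpace X] [CompleteSpace Y] (κ : X →L[ℝ] Y) {δ : ℝ} (hδ : 0 < δ)
    (e : C₀(ℝ, X)) : C1Space κ :=
  ⟨(convOp X (steklovMeasure δ) e,
    δ⁻¹ • mapC0L κ (convOp X (Measure.dirac (-δ)) e - e)), fun x => by
      have h := κ.hasFDerivAt.comp_hasDerivAt x (hasDerivAt_convOp_steklovMeasure hδ e x)
      rw [map_smul] at h
      refine h.congr_deriv ?_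
      show δ⁻¹ • κ (e (x + δ) - e x) = δ⁻¹ • κ ((∫ z, e (x - z) ∂Measure.dirac (-δ)) - e x)
      rw [integral_dirac, sub_neg_eq_add]⟩

theorem steklovC1_snd [CompleteSpace X] [CompleteSpace Y] (κ : X →L[ℝ] Y) {δ : ℝ} (hδ : 0 < δ)
    (e : C₀(ℝ, X)) (x : ℝ) : (steklovC1 κ hδ e).1.2 x = δ⁻¹ • (κ (e (x + δ)) - κ (e x)) := by
  show δ⁻¹ • κ ((∫ z, e (x - z) ∂Measure.dirac (-δ)) - e x) = _
  rw [integral_dirac, sub_neg_eq_add, map_sub]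

theorem norm_slope_sub_le {F F' : ℝ → X} (hF : ∀ y, HasDerivAt F (F' y) y) {x δ η : ℝ} {c : X}
    (hδ : 0 < δ) (h : ∀ y ∈ Icc x (x + δ), ‖F' y - c‖ ≤ η) :
    ‖δ⁻¹ • (F (x + δ) - F x) - c‖ ≤ η := by
  have h1 : ∀ y, HasDerivAt (fun y => F y - y • c) (F' y - c) y := fun y => by
    refine ((hF y).sub ((hasDerivAt_id y).smul_const c)).congr_deriv ?_
    rw [one_smul]
  have h2 := (convex_Icc x (x + δ)).norm_image_sub_le_of_norm_hasDerivWithin_le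
    (fun y _ => (h1 y).hasDerivWithinAt) h (left_mem_Icc.2 (by linarith))
    (right_mem_Icc.2 (by linarith))
  have h3 : δ⁻¹ • (F (x + δ) - F x) - c =
      δ⁻¹ • (F (x + δ) - (x + δ) • c - (F x - x • c)) := by
    have : c = δ⁻¹ • δ • c := by rw [smul_smul, inv_mul_cancel₀ hδ.ne', one_smul]
    nth_rewrite 1 [this]
    module
  rw [h3, norm_smul, norm_inv, Real.norm_of_nonneg hδ.le, inv_mul_le_iff₀ hδ, mul_comm]
  simpa [abs_of_pos hδ] using h2

end Steklov

/-! ### The core of the generator in `C¹_∞(ℝ, B) ∩ C_∞(ℝ, D)` -/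

section ThreeSpaceCore

variable {B D E : Type*} [NormedAddCommGroup B] [NormedSpace ℝ B]
  [NormedAddCommGroup D] [NormedSpace ℝ D] [NormedAddCommGroup E] [NormedSpace ℝ E]
  {ι : D →L[ℝ] B} {κ : E →L[ℝ] D} {A : ℝ → D →L[ℝ] B} {A₁ : ℝ → E →L[ℝ] D}
  {SB : ℝ → ℝ → B →L[ℝ] B} {SD : ℝ → ℝ → D →L[ℝ] D} {SE : ℝ → ℝ → E →L[ℝ] E}

theorem ThreeSpaceFamily.pair (h : ThreeSpaceFamily ι κ A A₁ SB SD SE) : PairFamily ι A SB SD where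
  injective := h.ι_injective
  dense := Dense.mono (range_comp_subset_range κ ι) h.dense_in_B
  A_cont := h.A_cont
  generates := h.generates_B
  bounded := h.bounded_B
  eq := h.SD_eq
  bounded_sub := h.bounded_D

theorem ThreeSpaceFamily.pair₁ (h : ThreeSpaceFamily ι κ A A₁ SB SD SE) :
    PairFamily κ A₁ SD SE where
  injective := h.κ_injective
  dense := h.dense_in_D
  A_cont := h.A₁_cont
  generates := h.generates_D
  bounded := h.bounded_D
  eq := h.SE_eq
  bounded_sub := h.bounded_E

theorem C1Space.norm_le {p : C1Space ι} {C : ℝ} (hC : 0 ≤ C) (h1 : ∀ x, ‖p.1.1 x‖ ≤ C)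
    (h2 : ∀ x, ‖p.1.2 x‖ ≤ C) : ‖p‖ ≤ C :=
  max_le (zeroAtInfty_norm_le hC h1) (zeroAtInfty_norm_le hC h2)

theorem C1Space.norm_incl_steklovC1_sub_le [CompleteSpace D] [CompleteSpace E]
    (ι : D →L[ℝ] B) (κ : E →L[ℝ] D) (hι : ∀ d, ‖ι d‖ ≤ ‖d‖) {δ ε η : ℝ} (hδ : 0 < δ) (hδ1 : δ ≤ 1)
    (hε : 0 ≤ ε) (hη : 0 ≤ η) (p : C1Space ι) (e : C₀(ℝ, E))
    (he : ∀ y, ‖κ (e y) - p.1.1 y‖ ≤ ε * δ)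
    (h1 : ∀ x, ∀ y ∈ Icc x (x + δ), ‖p.1.1 y - p.1.1 x‖ ≤ η)
    (h2 : ∀ x, ∀ y ∈ Icc x (x + δ), ‖p.1.2 y - p.1.2 x‖ ≤ η) :
    ‖C1Space.incl ι κ (steklovC1 κ hδ e) - p‖ ≤ 2 * ε + η := by
  refine C1Space.norm_le (by positivity) (fun x => ?_) fun x => ?_
  · show ‖κ (_root_.convOp E (steklovMeasure δ) e x) - p.1.1 x‖ ≤ _
    refine norm_convOp_steklovMeasure_sub_le hδ e κ fun y hy => ?_
    calc ‖κ (e y) - p.1.1 x‖ ≤ ‖κ (e y) - p.1.1 y‖ + ‖p.1.1 y - p.1.1 x‖ :=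
          norm_sub_le_norm_sub_add_norm_sub _ _ _
      _ ≤ 2 * ε + η := by nlinarith [he y, h1 x y hy]
  · show ‖ι ((steklovC1 κ hδ e).1.2 x) - p.1.2 x‖ ≤ _
    rw [steklovC1_snd, map_smul, map_sub]
    have h3 := norm_slope_sub_le p.2 hδ (h2 x)
    have h4 : ∀ y, ‖ι (κ (e y)) - ι (p.1.1 y)‖ ≤ ε * δ := fun y => by
      rw [← map_sub]; exact (hι _).trans (he y)
    have h5 : δ⁻¹ • (ι (κ (e (x + δ))) - ι (κ (e x))) - p.1.2 x =
        δ⁻¹ • ((ι (κ (e (x + δ))) - ι (p.1.1 (x + δ))) - (ι (κ (e x)) - ι (p.1.1 x))) +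
        (δ⁻¹ • (ι (p.1.1 (x + δ)) - ι (p.1.1 x)) - p.1.2 x) := by module
    rw [h5]
    refine (norm_add_le _ _).trans (add_le_add ?_ h3)
    rw [norm_smul, norm_inv, Real.norm_of_nonneg hδ.le, inv_mul_le_iff₀ hδ]
    exact (norm_sub_le _ _).trans (by linarith [h4 x, h4 (x + δ)])

theorem C1Space.denseRange_incl [CompleteSpace D] [CompleteSpace E] (hι : ∀ d, ‖ι d‖ ≤ ‖d‖)
    (hκ : DenseRange κ) : DenseRange (C1Space.incl ι κ) := by
  intro p
  rw [Metric.mem_closure_iff]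
  intro η hη
  have hη4 : 0 < η / 4 := by positivity
  obtain ⟨δ, ⟨hδ, hδ1⟩, h1, h2⟩ := (eventually_mem_Ioo_zero_one.and
    ((eventually_oscillation_le p.1.1 hη4).and (eventually_oscillation_le p.1.2 hη4))).exists
  obtain ⟨e, he⟩ := exists_zeroAtInfty_near hκ p.1.1 (show 0 < η / 4 * δ by positivity)
  refine ⟨_, ⟨steklovC1 κ hδ e, rfl⟩, ?_⟩
  rw [dist_comm, dist_eq_norm]
  have := C1Space.norm_incl_steklovC1_sub_le ι κ hι hδ hδ1.le hη4.le hη4.le p e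
    (fun y => (he y).le) h1 h2
  linarith

/-- The operator `A(·)` from `C¹_∞(ℝ, D) ∩ C_∞(ℝ, E)` to `C¹_∞(ℝ, B) ∩ C_∞(ℝ, D)`. -/
def ThreeSpaceFamily.c1Mul (h : ThreeSpaceFamily ι κ A A₁ SB SD SE)
    (hd : DifferentiableFamily A A₁) (f : C1Space κ) : C1Space ι :=
  ⟨(mulOp A₁ h.A₁_cont f.1.1,
    mulOp (deriv A) hd.deriv_cont (mapC0 κ f.1.1) + mulOp A h.A_cont f.1.2), fun x => by
      refine ((hd.diff x).hasDerivAt.clm_apply (f.2 x)).congr_of_eventuallyEq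
        (Eventually.of_forall fun y => ?_)
      exact h.A₁_eq y _⟩

/-- A continuous choice of the approximating vectors. -/
theorem ThreeSpaceFamily.exists_selection (h : ThreeSpaceFamily ι κ A A₁ SB SD SE) {u w : C₀(ℝ, D)}
    {M ε : ℝ} (hM : 0 ≤ M) (hε : 0 < ε)
    (huw : ∀ y, (u y, w y) ∈ closure ((fun e => (κ e, A₁ y e)) '' Metric.closedBall 0 M)) :
    ∃ e : C₀(ℝ, E), ∀ y, ‖κ (e y) - u y‖ < ε ∧ ‖A₁ y (e y) - w y‖ < ε ∧ ‖e y‖ ≤ M := by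
  obtain ⟨R₁, hR₁⟩ := exists_radius u hε
  obtain ⟨R₂, hR₂⟩ := exists_radius w hε
  have hopen : ∀ e y, ‖κ e - u y‖ < ε → ‖A₁ y e - w y‖ < ε →
      ∀ᶠ y' in 𝓝 y, ‖κ e - u y'‖ < ε ∧ ‖A₁ y' e - w y'‖ < ε := by
    intro e y h1 h2
    have c1 : ContinuousAt (fun y' => ‖κ e - u y'‖) y := by fun_prop
    have c2 : ContinuousAt (fun y' => ‖A₁ y' e - w y'‖) y :=
      ((h.A₁_cont.2 e).sub (map_continuous w)).norm.continuousAt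
    exact (c1.eventually (eventually_lt_nhds h1)).and (c2.eventually (eventually_lt_nhds h2))
  refine exists_zeroAtInfty_forall_mem
    (P := fun y => {e | ‖κ e - u y‖ < ε ∧ ‖A₁ y e - w y‖ < ε ∧ ‖e‖ ≤ M})
    (fun y => ?_) (max R₁ R₂) (fun y hy => ?_) fun y _ => ?_
  · have h1 : Convex ℝ (κ ⁻¹' Metric.ball (u y) ε) :=
      (convex_ball (u y) ε).linear_preimage κ.toLinearMap
    have h2 : Convex ℝ (A₁ y ⁻¹' Metric.ball (w y) ε) :=
      (convex_ball (w y) ε).linear_preimage (A₁ y).toLinearMap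
    have h3 := h1.inter (h2.inter (convex_closedBall (0 : E) M))
    convert h3 using 1
    ext e
    simp [dist_eq_norm]
  · have := hopen 0 y (by simpa using hR₁ y ((le_max_left _ _).trans hy))
      (by simpa using hR₂ y ((le_max_right _ _).trans hy))
    exact this.mono fun y' hy' => ⟨hy'.1, hy'.2, by simpa using hM⟩
  · obtain ⟨_, ⟨e, he, rfl⟩, hd⟩ := Metric.mem_closure_iff.1 (huw y) ε hε
    rw [dist_comm, dist_eq_norm, Prod.norm_def, max_lt_iff] at hd
    exact ⟨e, (hopen e y hd.1 hd.2).mono fun y' hy' =>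
      ⟨hy'.1, hy'.2, mem_closedBall_zero_iff.1 he⟩⟩

theorem ThreeSpaceFamily.mem_closure_c1Mul [CompleteSpace D] [CompleteSpace E]
    (h : ThreeSpaceFamily ι κ A A₁ SB SD SE) (hd : DifferentiableFamily A A₁) {u w : C1Space ι}
    {M : ℝ} (hM : 0 ≤ M)
    (huw : ∀ y, (u.1.1 y, w.1.1 y) ∈
      closure ((fun e => (κ e, A₁ y e)) '' Metric.closedBall 0 M)) :
    (u, w) ∈ closure (range fun f => (C1Space.incl ι κ f, h.c1Mul hd f)) := by
  obtain ⟨C, hC⟩ := hd.deriv_cont.1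
  obtain ⟨C₁, hC₁⟩ := hd.deriv₁_cont.1
  have hC0 : 0 ≤ C := (norm_nonneg _).trans (hC 0)
  have hC₁0 : 0 ≤ C₁ := (norm_nonneg _).trans (hC₁ 0)
  have hlip := norm_sub_le_of_bounded_deriv hd.diff hC
  have hlip₁ := norm_sub_le_of_bounded_deriv hd.diff₁ hC₁
  rw [Metric.mem_closure_iff]
  intro η₀ hη₀
  obtain ⟨η, hη, hηη₀⟩ : ∃ η > 0, (4 + 5 * C) * η < η₀ :=
    ⟨η₀ / (2 * (4 + 5 * C)), by positivity, by
      rw [← mul_div_assoc, mul_comm 2, mul_div_mul_left _ _ (by positivity)]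
      exact half_lt_self hη₀⟩
  have hsmall : ∀ᶠ δ in 𝓝[>] (0 : ℝ), C₁ * δ * M ≤ η := by
    have : ContinuousAt (fun δ : ℝ => C₁ * δ * M) 0 := by fun_prop
    exact (this.eventually (eventually_le_nhds (by simpa using hη))).filter_mono nhdsWithin_le_nhds
  set v : C₀(ℝ, B) := mulOp (deriv A) hd.deriv_cont u.1.1 with hv
  obtain ⟨δ, ⟨hδ, hδ1⟩, hδM, hu, hu', hw, hw', hv'⟩ := (eventually_mem_Ioo_zero_one.and
    (hsmall.and ((eventually_oscillation_le u.1.1 hη).and ((eventually_oscillation_le u.1.2 hη).and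
    ((eventually_oscillation_le w.1.1 hη).and ((eventually_oscillation_le w.1.2 hη).and
    (eventually_oscillation_le v hη))))))).exists
  obtain ⟨e, he⟩ := h.exists_selection hM (show 0 < η * δ by positivity) huw
  have hηδ : η * δ ≤ η := by nlinarith
  have hnorm : ∀ x, ∀ y ∈ Icc x (x + δ), |x - y| ≤ δ := fun x y hy => by
    rw [abs_sub_comm, abs_of_nonneg (by linarith [hy.1])]; linarith [hy.2]
  set g := steklovC1 κ hδ e with hg
  refine ⟨_, ⟨g, rfl⟩, ?_⟩
  rw [dist_comm, dist_eq_norm, Prod.norm_def, max_lt_iff]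
  constructor
  · have := C1Space.norm_incl_steklovC1_sub_le ι κ h.ι_norm_le hδ hδ1.le hη.le hη.le u e
      (fun y => (he y).1.le) hu hu'
    refine this.trans_lt ?_
    nlinarith
  refine (C1Space.norm_le (C := (4 + 5 * C) * η) (by positivity) (fun x => ?_)
    fun x => ?_).trans_lt hηη₀
  · show ‖A₁ x (convOp E (steklovMeasure δ) e x) - w.1.1 x‖ ≤ _
    refine norm_convOp_steklovMeasure_sub_le hδ e (A₁ x) fun y hy => ?_
    have e1 : ‖(A₁ x - A₁ y) (e y)‖ ≤ C₁ * δ * M :=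
      (A₁ x - A₁ y).le_of_opNorm_le_of_le ((hlip₁ y x).trans
        (mul_le_mul_of_nonneg_left (hnorm x y hy) hC₁0)) (he y).2.2
    have e2 : A₁ x (e y) - w.1.1 x =
        (A₁ x - A₁ y) (e y) + (A₁ y (e y) - w.1.1 y) + (w.1.1 y - w.1.1 x) := by
      rw [sub_apply]; abel
    rw [e2]
    refine norm_add₃_le.trans ?_
    nlinarith [(he y).2.1, hw x y hy]
  · have hκg : ‖κ (convOp E (steklovMeasure δ) e x) - u.1.1 x‖ ≤ 2 * η := by
      refine norm_convOp_steklovMeasure_sub_le hδ e κ fun y hy => ?_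
      refine (norm_sub_le_norm_sub_add_norm_sub _ (u.1.1 y) _).trans ?_
      linarith [(he y).1, hu x y hy]
    show ‖deriv A x (κ (convOp E (steklovMeasure δ) e x)) + A x (g.1.2 x) - w.1.2 x‖ ≤ _
    rw [hg, steklovC1_snd, map_smul, map_sub, ← h.A₁_eq x (e x)]
    have hx : x + δ ∈ Icc x (x + δ) := right_mem_Icc.2 (by linarith)
    have s1 := norm_slope_sub_le w.2 hδ (hw' x)
    have s2 : ‖δ⁻¹ • (A (x + δ) (u.1.1 x) - A x (u.1.1 x)) - deriv A x (u.1.1 x)‖ ≤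
        η + C * η := by
      refine norm_slope_sub_le (F := fun y => A y (u.1.1 x)) (F' := fun y => deriv A y (u.1.1 x))
        (fun y => by simpa using (hd.diff y).hasDerivAt.clm_apply (hasDerivAt_const y (u.1.1 x)))
        hδ fun y hy => ?_
      have e1 : deriv A y (u.1.1 x) - deriv A x (u.1.1 x) =
          (v y - v x) - deriv A y (u.1.1 y - u.1.1 x) := by
        simp only [hv, mulOp_apply, map_sub]; abel
      rw [e1]
      exact (norm_sub_le _ _).trans (add_le_add (hv' x y hy)
        ((deriv A y).le_of_opNorm_le_of_le (hC y) (hu x y hy)))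
    have s3 : ‖δ⁻¹ • (A (x + δ) - A x) (κ (e (x + δ)) - u.1.1 x)‖ ≤ C * (2 * η) := by
      rw [norm_smul, norm_inv, Real.norm_of_nonneg hδ.le, inv_mul_le_iff₀ hδ]
      have e1 : ‖κ (e (x + δ)) - u.1.1 x‖ ≤ 2 * η := by
        refine (norm_sub_le_norm_sub_add_norm_sub _ (u.1.1 (x + δ)) _).trans ?_
        linarith [(he (x + δ)).1, hu x _ hx]
      have e2 : ‖A (x + δ) - A x‖ ≤ C * δ := by
        have := hlip x (x + δ)
        rwa [add_sub_cancel_left, abs_of_pos hδ] at this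
      exact ((A (x + δ) - A x).le_of_opNorm_le_of_le e2 e1).trans (le_of_eq (by ring))
    have s4 : ∀ y, ‖ι (A₁ y (e y)) - ι (w.1.1 y)‖ ≤ η * δ := fun y => by
      rw [← map_sub]; exact (h.ι_norm_le _).trans (he y).2.1.le
    have s5 : ‖δ⁻¹ • ((ι (A₁ (x + δ) (e (x + δ))) - ι (w.1.1 (x + δ))) -
        (ι (A₁ x (e x)) - ι (w.1.1 x)))‖ ≤ 2 * η := by
      rw [norm_smul, norm_inv, Real.norm_of_nonneg hδ.le, inv_mul_le_iff₀ hδ]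
      exact (norm_sub_le _ _).trans (by linarith [s4 x, s4 (x + δ)])
    have s6 : ‖deriv A x (κ (convOp E (steklovMeasure δ) e x) - u.1.1 x)‖ ≤ C * (2 * η) :=
      (deriv A x).le_of_opNorm_le_of_le (hC x) hκg
    have key : deriv A x (κ (convOp E (steklovMeasure δ) e x)) +
        δ⁻¹ • (A x (κ (e (x + δ))) - ι (A₁ x (e x))) - w.1.2 x =
        deriv A x (κ (convOp E (steklovMeasure δ) e x) - u.1.1 x) +
        δ⁻¹ • ((ι (A₁ (x + δ) (e (x + δ))) - ι (w.1.1 (x + δ))) -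
          (ι (A₁ x (e x)) - ι (w.1.1 x))) +
        (δ⁻¹ • (ι (w.1.1 (x + δ)) - ι (w.1.1 x)) - w.1.2 x) -
        δ⁻¹ • (A (x + δ) - A x) (κ (e (x + δ)) - u.1.1 x) -
        (δ⁻¹ • (A (x + δ) (u.1.1 x) - A x (u.1.1 x)) - deriv A x (u.1.1 x)) := by
      rw [h.A₁_eq (x + δ)]
      simp only [map_sub, sub_apply]
      module
    rw [key]
    refine (norm_sub_le_of_le (norm_sub_le_of_le (norm_add_le_of_le (norm_add_le_of_le s6 s5) s1)
      s3) s2).trans (le_of_eq (by ring))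

variable [CompleteSpace B] [CompleteSpace D]

theorem ThreeSpaceFamily.incl_mem_generatorGraph (h : ThreeSpaceFamily ι κ A A₁ SB SD SE)
    (hd : DifferentiableFamily A A₁) (hSB : IsC0Family SB) (hSD : IsC0Family SD) (f : C1Space κ) :
    (C1Space.incl ι κ f, h.c1Mul hd f) ∈
      generatorGraph (h.pair.c1Semigroup hSB hSD hd.diff hd.deriv_cont) :=
  mem_generatorGraph_of_forall (h.pair.isC0Semigroup_c1Semigroup hSB hSD hd.diff hd.deriv_cont)
    hSD.semigroup (π := fun x => (evalAt D x).comp (C1Space.toC0 ι))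
    (fun _ hp => C1Space.ext_fst hp)
    (fun x t p ht => by
      rw [ContinuousLinearMap.comp_apply, h.pair.toC0_c1Semigroup hSB hSD hd.diff hd.deriv_cont
        t p ht]
      exact mulSemigroup_apply hSD ht _ x)
    fun x => h.pair₁.mem_generatorGraph x (f.1.1 x)

/-- An average of the orbit of `f` and its image under the generator can be approximated pointwise
by `κ e` and `A₁ y e` with a uniform bound of the norm of `e`. -/
theorem ThreeSpaceFamily.average_mem_closure (h : ThreeSpaceFamily ι κ A A₁ SB SD SE)
    (hd : DifferentiableFamily A A₁) (hSB : IsC0Family SB) (hSD : IsC0Family SD) (f : C1Space κ)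
    {t : ℝ} (ht : 0 < t) :
    let T := h.pair.c1Semigroup hSB hSD hd.diff hd.deriv_cont
    ∃ M, 0 ≤ M ∧ ∀ y,
      ((t⁻¹ • ∫ s in (0 : ℝ)..t, T s (C1Space.incl ι κ f)).1.1 y,
        (t⁻¹ • (T t (C1Space.incl ι κ f) - C1Space.incl ι κ f)).1.1 y) ∈
      closure ((fun e => (κ e, A₁ y e)) '' Metric.closedBall 0 M) := by
  intro T
  obtain ⟨C, hC⟩ := h.bounded_E t
  have hC0 : 0 ≤ C := (norm_nonneg _).trans (hC 0 0 ⟨le_rfl, ht.le⟩)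
  refine ⟨C * ‖f.1.1‖, by positivity, fun y => ?_⟩
  have hT : IsC0Semigroup T := h.pair.isC0Semigroup_c1Semigroup hSB hSD hd.diff hd.deriv_cont
  let π : C1Space ι →L[ℝ] D := (evalAt D y).comp (C1Space.toC0 ι)
  have hπ : ∀ s p, 0 ≤ s → π (T s p) = SD y s (π p) := fun s p hs => by
    simp only [π, ContinuousLinearMap.comp_apply]
    rw [h.pair.toC0_c1Semigroup hSB hSD hd.diff hd.deriv_cont s p hs]
    exact mulSemigroup_apply hSD hs _ y
  set e := f.1.1 y with he
  have hmem : (κ e, A₁ y e) ∈ generatorGraph (SD y) := h.pair₁.mem_generatorGraph y e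
  have h1 : (t⁻¹ • ∫ s in (0 : ℝ)..t, T s (C1Space.incl ι κ f)).1.1 y =
      t⁻¹ • ∫ s in (0 : ℝ)..t, SD y s (κ e) := by
    show π (t⁻¹ • ∫ s in (0 : ℝ)..t, T s (C1Space.incl ι κ f)) = _
    rw [map_smul, ← ContinuousLinearMap.intervalIntegral_comp_comm _
      (hT.intervalIntegrable le_rfl ht.le _)]
    congr 1
    refine intervalIntegral.integral_congr fun s hs => ?_
    rw [uIcc_of_le ht.le] at hs
    exact hπ s _ hs.1
  have h2 : (t⁻¹ • (T t (C1Space.incl ι κ f) - C1Space.incl ι κ f)).1.1 y =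
      t⁻¹ • ∫ s in (0 : ℝ)..t, SD y s (A₁ y e) := by
    show π (t⁻¹ • (T t (C1Space.incl ι κ f) - C1Space.incl ι κ f)) = _
    rw [map_smul, map_sub, hπ t _ ht.le,
      ← (mem_generatorGraph_iff (hSD.semigroup y)).1 hmem t ht.le]
    rfl
  have hi1 := (hSD.semigroup y).intervalIntegrable le_rfl ht.le (κ e)
  have hi2 := (hSD.semigroup y).intervalIntegrable le_rfl ht.le (A₁ y e)
  rw [intervalIntegrable_iff_integrableOn_Ioc_of_le ht.le] at hi1 hi2
  have hconv : Convex ℝ ((fun e => (κ e, A₁ y e)) '' Metric.closedBall 0 (C * ‖f.1.1‖)) :=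
    (convex_closedBall 0 _).linear_image (κ.prod (A₁ y)).toLinearMap
  have h3 := hconv.closure.set_average_mem isClosed_closure (μ := volume) (t := Ioc 0 t)
    (f := fun s => (SD y s (κ e), SD y s (A₁ y e))) (by simp [ht]) (by simp) ?_
    (hi1.prodMk hi2)
  · rw [setAverage_eq, integral_pair hi1 hi2] at h3
    rw [h1, h2, intervalIntegral.integral_of_le ht.le, intervalIntegral.integral_of_le ht.le]
    simpa [ht.le] using h3
  · filter_upwards [ae_restrict_mem measurableSet_Ioc] with s hs
    refine subset_closure ⟨SE y s e, ?_, ?_⟩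
    · rw [mem_closedBall_zero_iff]
      exact (SE y s).le_of_opNorm_le_of_le (hC y s ⟨hs.1.le, hs.2⟩) (norm_apply_le_norm _ _)
    · have h4 : A₁ y (SE y s e) = SD y s (A₁ y e) :=
        generatorGraph_unique (h.pair₁.mem_generatorGraph' y y e hs.1.le)
          (generatorGraph_apply (hSD.semigroup y) hmem hs.1.le)
      simp only [h4, h.SE_eq y s e hs.1.le]

theorem ThreeSpaceFamily.generatesWithCore_c1 [CompleteSpace E]
    (h : ThreeSpaceFamily ι κ A A₁ SB SD SE) (hd : DifferentiableFamily A A₁)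
    (hSB : IsC0Family SB) (hSD : IsC0Family SD) :
    GeneratesWithCore (h.pair.c1Semigroup hSB hSD hd.diff hd.deriv_cont) (C1Space.incl ι κ)
      (h.c1Mul hd) := by
  have hT := h.pair.isC0Semigroup_c1Semigroup hSB hSD hd.diff hd.deriv_cont
  refine ⟨hT, (closure_subset_generatorGraph hT
    (h.incl_mem_generatorGraph hd hSB hSD)).antisymm ?_⟩
  refine generatorGraph_subset_of_average hT isClosed_closure
    (C1Space.denseRange_incl h.ι_norm_le h.dense_in_D) ?_
  rintro _ ⟨f, rfl⟩ t ht
  obtain ⟨M, hM, hmem⟩ := h.average_mem_closure hd hSB hSD f ht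
  exact h.mem_closure_c1Mul hd hM hmem

theorem ThreeSpaceFamily.exists_generator_c1 [CompleteSpace E]
    (h : ThreeSpaceFamily ι κ A A₁ SB SD SE) (hd : DifferentiableFamily A A₁)
    (hSB : IsC0Family SB) (hSD : IsC0Family SD) (ν : Measure ℝ) [IsFiniteMeasure ν] :
    ∃ G₁ : C1Space κ → C1Space ι, (∀ f x, (G₁ f).1.1 x = levyAdd ν κ A₁ f.1.1 x) ∧
      GeneratesWithCore (h.pair.c1Levy ν hSB hSD hd.diff hd.deriv_cont)
        (C1Space.incl ι κ) G₁ := by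
  refine ⟨_, fun f x => ?_, (h.generatesWithCore_c1 hd hSB hSD).of_sub_tendsto
    (isC0Semigroup_perturbExp _ _ _)
    (C1Space.convOp ι ν - ν.real univ • ContinuousLinearMap.id ℝ (C1Space ι)) fun f =>
      perturbExp_sub_tendsto _ _ _ f⟩
  rw [levyAdd_eq]
  rfl

end ThreeSpaceCore

/-! ### The series over the jump times -/

section JumpTimes

variable {m : ℕ}

theorem jumpTimes_zero (t : ℝ) (s : Fin m → ℝ) : jumpTimes t s 0 = 0 := rfl

theorem jumpTimes_succ (t : ℝ) (s : Fin m → ℝ) (k : Fin (m + 1)) :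
    jumpTimes t s k.succ = Fin.snoc (α := fun _ => ℝ) s t k := rfl

theorem jumpTimes_succ_castSucc (t : ℝ) (s : Fin m → ℝ) (i : Fin m) :
    jumpTimes t s i.castSucc.succ = s i := by
  rw [jumpTimes_succ, Fin.snoc_castSucc]

theorem jumpTimes_succ_last (t : ℝ) (s : Fin m → ℝ) : jumpTimes t s (Fin.last m).succ = t := by
  rw [jumpTimes_succ, Fin.snoc_last]

theorem continuous_jumpTimes (t : ℝ) (k : Fin (m + 2)) :
    Continuous fun s : Fin m → ℝ => jumpTimes t s k := by
  refine Fin.cases ?_ (fun k => ?_) k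
  · exact continuous_const
  · refine Fin.lastCases ?_ (fun i => ?_) k
    · simp only [jumpTimes_succ_last]
      exact continuous_const
    · simp only [jumpTimes_succ_castSucc]
      fun_prop

theorem jumpTimes_mem_Icc {t : ℝ} (ht : 0 ≤ t) {s : Fin m → ℝ} (hs : s ∈ jumpSimplex m t)
    (k : Fin (m + 2)) : jumpTimes t s k ∈ Icc 0 t := by
  refine Fin.cases ?_ (fun k => ?_) k
  · exact ⟨le_rfl, ht⟩
  · refine Fin.lastCases ?_ (fun i => ?_) k
    · rw [jumpTimes_succ_last]
      exact ⟨ht, le_rfl⟩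
    · rw [jumpTimes_succ_castSucc]
      exact hs.2 i

theorem monotone_jumpTimes {t : ℝ} (ht : 0 ≤ t) {s : Fin m → ℝ} (hs : s ∈ jumpSimplex m t) :
    Monotone (jumpTimes t s) := by
  rw [Fin.monotone_iff_le_succ]
  intro j
  refine Fin.cases ?_ (fun i => ?_) j
  · exact (jumpTimes_mem_Icc ht hs _).1
  · rw [← Fin.succ_castSucc, jumpTimes_succ_castSucc]
    induction h : i.succ using Fin.lastCases with
    | last => rw [jumpTimes_succ_last]; exact (hs.2 i).2
    | cast k =>
      rw [jumpTimes_succ_castSucc]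
      refine hs.1 ?_
      have h1 := congrArg Fin.val h
      simp only [Fin.val_succ, Fin.val_castSucc] at h1
      exact Fin.le_def.2 (by omega)

theorem jumpTimes_sub_mem_Icc {t : ℝ} (ht : 0 ≤ t) {s : Fin m → ℝ} (hs : s ∈ jumpSimplex m t)
    (j : Fin (m + 1)) : jumpTimes t s j.succ - jumpTimes t s j.castSucc ∈ Icc 0 t := by
  have h1 := monotone_jumpTimes ht hs (Fin.castSucc_le_succ j)
  have h2 := (jumpTimes_mem_Icc ht hs j.succ).2
  have h3 := (jumpTimes_mem_Icc ht hs j.castSucc).1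
  exact ⟨by linarith, by linarith⟩

theorem isClosed_jumpSimplex (m : ℕ) (t : ℝ) : IsClosed (jumpSimplex m t) := by
  have h : jumpSimplex m t = {s | Monotone s} ∩ ⋂ i, (fun s => s i) ⁻¹' Icc 0 t := by
    ext s
    simp [jumpSimplex]
  rw [h]
  exact isClosed_monotone.inter
    (isClosed_iInter fun i => isClosed_Icc.preimage (continuous_apply i))

theorem volume_jumpSimplex_lt_top (m : ℕ) (t : ℝ) : volume (jumpSimplex m t) < ⊤ := by
  have h : jumpSimplex m t ⊆ Icc (fun _ => 0) (fun _ => t) := fun s hs =>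
    ⟨fun i => (hs.2 i).1, fun i => (hs.2 i).2⟩
  exact (measure_mono h).trans_lt isCompact_Icc.measure_lt_top

instance (ν : Measure ℝ) [IsFiniteMeasure ν] (m : ℕ) (t : ℝ) :
    IsFiniteMeasure (jumpMeasure ν m t) := by
  have : IsFiniteMeasure (volume.restrict (jumpSimplex m t)) :=
    ⟨by simpa using volume_jumpSimplex_lt_top m t⟩
  unfold jumpMeasure
  infer_instance

theorem jumpMeasure_eq_restrict (ν : Measure ℝ) [IsFiniteMeasure ν] (m : ℕ) (t : ℝ) :
    jumpMeasure ν m t = ((volume : Measure (Fin m → ℝ)).prod (Measure.pi fun _ => ν)).restrict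
      (jumpSimplex m t ×ˢ univ) := by
  rw [jumpMeasure, ← Measure.prod_restrict, Measure.restrict_univ]

theorem ae_jumpMeasure_mem (ν : Measure ℝ) [IsFiniteMeasure ν] (m : ℕ) (t : ℝ) :
    ∀ᵐ p ∂jumpMeasure ν m t, p.1 ∈ jumpSimplex m t := by
  rw [jumpMeasure_eq_restrict]
  filter_upwards [ae_restrict_mem ((isClosed_jumpSimplex m t).measurableSet.prod
    MeasurableSet.univ)] with p hp using hp.1

/-- The jump times that start at `a`, with the increments of the later ones given by `r`. -/
def consTimes (a : ℝ) (r : Fin m → ℝ) : Fin (m + 1) → ℝ :=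
  Fin.cons (α := fun _ => ℝ) a fun i => r i + a

theorem consTimes_mem_jumpSimplex {a t : ℝ} {r : Fin m → ℝ} :
    consTimes a r ∈ jumpSimplex (m + 1) t ↔ a ∈ Icc 0 t ∧ r ∈ jumpSimplex m (t - a) := by
  have h0 : consTimes a r 0 = a := rfl
  have h1 : ∀ i : Fin m, consTimes a r i.succ = r i + a := fun _ => rfl
  constructor
  · rintro ⟨hm, hI⟩
    refine ⟨hI 0, fun i j hij => ?_, fun i => ?_⟩
    · have := hm (Fin.succ_le_succ_iff.2 hij)
      rw [h1, h1] at this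
      linarith
    · have e1 := hm (Fin.zero_le i.succ)
      have e2 := (hI i.succ).2
      rw [h1] at e1 e2
      rw [h0] at e1
      exact ⟨by linarith, by linarith⟩
  · rintro ⟨ha, hm, hI⟩
    refine ⟨fun i j => ?_, fun i => ?_⟩
    · refine Fin.cases (fun _ => ?_) (fun i => ?_) i
      · refine Fin.cases le_rfl (fun j => ?_) j
        rw [h0, h1]
        linarith [(hI j).1]
      · refine Fin.cases (fun h => absurd h (by simp [Fin.succ_ne_zero]))
          (fun j h => ?_) j
        rw [h1, h1]
        linarith [hm (Fin.succ_le_succ_iff.1 h)]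
    · refine Fin.cases ha (fun j => ?_) i
      rw [h1]
      exact ⟨by linarith [(hI j).1, ha.1], by linarith [(hI j).2]⟩

theorem jumpTimes_consTimes (t a : ℝ) (r : Fin m → ℝ) (k : Fin (m + 2)) :
    jumpTimes t (consTimes a r) k.succ = jumpTimes (t - a) r k + a := by
  refine Fin.cases ?_ (fun k => ?_) k
  · have := jumpTimes_succ_castSucc t (consTimes a r) 0
    rw [Fin.castSucc_zero] at this
    rw [this, jumpTimes_zero, zero_add]
    rfl
  · refine Fin.lastCases ?_ (fun i => ?_) k
    · rw [Fin.succ_last, jumpTimes_succ_last, ← Fin.succ_last, jumpTimes_succ_last]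
      ring
    · rw [jumpTimes_succ_castSucc, Fin.succ_castSucc, jumpTimes_succ_castSucc]
      rfl

theorem expProduct_consTimes {B : Type*} [NormedAddCommGroup B] [NormedSpace ℝ B]
    (S : ℝ → ℝ → B →L[ℝ] B) (t x a b : ℝ) (r z : Fin m → ℝ) :
    expProduct S t x (consTimes a r) (Fin.cons (α := fun _ => ℝ) b z) =
      S x a * expProduct S (t - a) (x - b) r z := by
  rw [expProduct, List.ofFn_succ, List.prod_cons]
  congr 1
  · have h1 := jumpTimes_consTimes t a r 0
    rw [jumpTimes_zero, zero_add] at h1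
    have h2 : jumpTimes t (consTimes a r) (Fin.castSucc 0) = 0 := rfl
    rw [h1, h2]
    simp
  · rw [expProduct]
    congr 2
    funext j
    rw [jumpTimes_consTimes, ← Fin.succ_castSucc, jumpTimes_consTimes, add_sub_add_right_eq_sub,
      Fin.sum_univ_succ]
    congr 1
    simp only [Fin.castSucc_zero, Fin.succ_pos, if_true, Fin.cons_zero, Fin.cons_succ,
      ← Fin.succ_castSucc, Fin.succ_lt_succ_iff]
    ring

/-- The change of variables that splits off the first jump. -/
def consJump (q : (ℝ × ℝ) × ((Fin m → ℝ) × (Fin m → ℝ))) :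
    (Fin (m + 1) → ℝ) × (Fin (m + 1) → ℝ) :=
  (consTimes q.1.1 q.2.1, Fin.cons (α := fun _ => ℝ) q.1.2 q.2.2)

theorem measurePreserving_cons (μ : Measure ℝ) [SigmaFinite μ] :
    MeasurePreserving (fun q : ℝ × (Fin m → ℝ) => Fin.cons (α := fun _ => ℝ) q.1 q.2)
      (μ.prod (Measure.pi fun _ => μ)) (Measure.pi fun _ : Fin (m + 1) => μ) := by
  have h := (measurePreserving_piFinSuccAbove (fun _ : Fin (m + 1) => μ) 0).symm
  convert h using 1
  funext q
  simp [MeasurableEquiv.piFinSuccAbove_symm_apply, Fin.insertNthEquiv]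

theorem measurePreserving_consTimes :
    MeasurePreserving (fun q : ℝ × (Fin m → ℝ) => consTimes q.1 q.2)
      ((volume : Measure ℝ).prod (volume : Measure (Fin m → ℝ)))
      (volume : Measure (Fin (m + 1) → ℝ)) := by
  have h1 : MeasurePreserving (fun q : ℝ × (Fin m → ℝ) => (q.1, fun i => q.2 i + q.1))
      ((volume : Measure ℝ).prod (volume : Measure (Fin m → ℝ)))
      ((volume : Measure ℝ).prod (volume : Measure (Fin m → ℝ))) := by
    refine MeasurePreserving.skew_product (f := id) (g := fun a (r : Fin m → ℝ) i => r i + a)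
      (MeasurePreserving.id _) (by fun_prop) (Eventually.of_forall fun a => ?_)
    exact map_add_right_eq_self (volume : Measure (Fin m → ℝ)) fun _ => a
  exact (measurePreserving_cons volume).comp h1

theorem measurePreserving_prod_comm {α β γ δ : Type*} [MeasurableSpace α] [MeasurableSpace β]
    [MeasurableSpace γ] [MeasurableSpace δ] (μa : Measure α) (μb : Measure β) (μc : Measure γ)
    (μd : Measure δ) [SFinite μa] [SFinite μb] [SFinite μc] [SFinite μd] :
    MeasurePreserving (fun q : (α × β) × (γ × δ) => ((q.1.1, q.2.1), (q.1.2, q.2.2)))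
      ((μa.prod μb).prod (μc.prod μd)) ((μa.prod μc).prod (μb.prod μd)) := by
  have e1 := measurePreserving_prodAssoc μa μb (μc.prod μd)
  have e2 := (measurePreserving_prodAssoc μb μc μd).symm
  have e3 : MeasurePreserving (Prod.map Prod.swap id : (β × γ) × δ → (γ × β) × δ)
      ((μb.prod μc).prod μd) ((μc.prod μb).prod μd) :=
    Measure.measurePreserving_swap.prod (MeasurePreserving.id μd)
  have e4 := measurePreserving_prodAssoc μc μb μd
  have e5 := (MeasurePreserving.id μa).prod (e4.comp (e3.comp e2))
  have e6 := (measurePreserving_prodAssoc μa μc (μb.prod μd)).symm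
  exact e6.comp (e5.comp e1)

theorem measurePreserving_consJump (ν : Measure ℝ) [IsFiniteMeasure ν] :
    MeasurePreserving (consJump (m := m))
      (((volume : Measure ℝ).prod ν).prod
        ((volume : Measure (Fin m → ℝ)).prod (Measure.pi fun _ => ν)))
      ((volume : Measure (Fin (m + 1) → ℝ)).prod (Measure.pi fun _ => ν)) :=
  (measurePreserving_consTimes.prod (measurePreserving_cons ν)).comp
    (measurePreserving_prod_comm _ _ _ _)

end JumpTimes

section Series

variable {B : Type*} [NormedAddCommGroup B] [NormedSpace ℝ B] {S : ℝ → ℝ → B →L[ℝ] B}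

theorem continuous_list_prod_apply {α : Type*} [TopologicalSpace α] {n : ℕ}
    {g : Fin n → α → B →L[ℝ] B} (hg : ∀ j, ∀ v : α → B, Continuous v → Continuous fun a => g j a (v a))
    {v : α → B} (hv : Continuous v) :
    Continuous fun a => (List.ofFn fun j => g j a).prod (v a) := by
  induction n with
  | zero => simpa using hv
  | succ n ih =>
    simp only [List.ofFn_succ, List.prod_cons, mul_apply_eq_comp]
    exact hg 0 _ (ih fun j => hg j.succ)

theorem norm_list_prod_le {n : ℕ} {g : Fin n → B →L[ℝ] B} {C : ℝ} (hC : 0 ≤ C)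
    (hg : ∀ j, ‖g j‖ ≤ C) : ‖(List.ofFn g).prod‖ ≤ C ^ n := by
  induction n with
  | zero =>
    rw [List.ofFn_zero, List.prod_nil, pow_zero]
    exact ContinuousLinearMap.norm_id_le
  | succ n ih =>
    rw [List.ofFn_succ, List.prod_cons, pow_succ']
    exact (norm_mul_le _ _).trans (mul_le_mul (hg 0) (ih fun j => hg j.succ) (norm_nonneg _) hC)

theorem expProduct_eq_max {m : ℕ} {t : ℝ} (ht : 0 ≤ t) (x : ℝ) {s : Fin m → ℝ}
    (hs : s ∈ jumpSimplex m t) (z : Fin m → ℝ) :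
    expProduct S t x s z = expProduct (fun y r => S y (max r 0)) t x s z := by
  rw [expProduct, expProduct]
  congr 2
  funext j
  rw [max_eq_left (jumpTimes_sub_mem_Icc ht hs j).1]

theorem continuous_expProduct_max [CompleteSpace B] (hS : IsC0Family S) (m : ℕ) (t x : ℝ)
    (Y : C₀(ℝ, B)) : Continuous fun p : (Fin m → ℝ) × (Fin m → ℝ) =>
      expProduct (fun y r => S y (max r 0)) t x p.1 p.2 (Y (x - ∑ i, p.2 i)) := by
  refine continuous_list_prod_apply (fun j v hv => hS.continuous_max ?_ ?_ hv) (by fun_prop)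
  · refine continuous_const.sub (continuous_finsetSum _ fun i _ => ?_)
    split_ifs <;> fun_prop
  · exact ((continuous_jumpTimes t _).comp continuous_fst).sub
      ((continuous_jumpTimes t _).comp continuous_fst)

theorem integrable_expProduct [CompleteSpace B] (hS : IsC0Family S) (ν : Measure ℝ)
    [IsFiniteMeasure ν] (m : ℕ) {t : ℝ} (ht : 0 ≤ t) (x : ℝ) (Y : C₀(ℝ, B)) :
    Integrable (fun p : (Fin m → ℝ) × (Fin m → ℝ) =>
      expProduct S t x p.1 p.2 (Y (x - ∑ i, p.2 i))) (jumpMeasure ν m t) := by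
  obtain ⟨C, hC⟩ := hS.bounded t
  have hC0 : 0 ≤ C := (norm_nonneg _).trans (hC 0 0 ⟨le_rfl, ht⟩)
  refine Integrable.of_bound (C := C ^ (m + 1) * ‖Y‖) ?_ ?_
  · refine (continuous_expProduct_max hS m t x Y).aestronglyMeasurable.congr ?_
    filter_upwards [ae_jumpMeasure_mem ν m t] with p hp
    rw [expProduct_eq_max (S := S) ht x hp]
  · filter_upwards [ae_jumpMeasure_mem ν m t] with p hp
    exact ContinuousLinearMap.le_of_opNorm_le_of_le _ (norm_list_prod_le hC0 fun j =>
      hC _ _ (jumpTimes_sub_mem_Icc ht hp j)) (norm_apply_le_norm Y _)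

/-- The terms of the Dyson series are integrals over the jump times and the jumps. -/
theorem dysonTerm_eq_integral [CompleteSpace B] (hS : IsC0Family S) (ν : Measure ℝ)
    [IsFiniteMeasure ν] (Y : C₀(ℝ, B)) (m : ℕ) {t : ℝ} (ht : 0 ≤ t) (x : ℝ) :
    dysonTerm (mulSemigroup hS) (convOp B ν) Y m t x =
      ∫ p, expProduct S t x p.1 p.2 (Y (x - ∑ i, p.2 i)) ∂jumpMeasure ν m t := by
  induction m generalizing t x with
  | zero =>
    have h1 : jumpSimplex 0 t = univ := eq_univ_of_forall fun s =>
      ⟨fun i => i.elim0, fun i => i.elim0⟩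
    have h2 : (jumpMeasure ν 0 t).real univ = 1 := by
      simp [Measure.real, jumpMeasure, h1, ← univ_prod_univ, Measure.prod_prod, volume_pi]
    have : Unique ((Fin 0 → ℝ) × (Fin 0 → ℝ)) := Unique.mk' _
    rw [integral_unique, h2, one_smul, dysonTerm, max_eq_left ht, mulSemigroup_apply hS ht]
    simp [expProduct, jumpTimes, Fin.snoc]
  | succ m ih =>
    let F : ∀ n : ℕ, ℝ → ℝ → (Fin n → ℝ) × (Fin n → ℝ) → B := fun n t x =>
      (jumpSimplex n t ×ˢ univ).indicator fun p =>
        expProduct S t x p.1 p.2 (Y (x - ∑ i, p.2 i))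
    have hmeas : ∀ n t, MeasurableSet (jumpSimplex n t ×ˢ (univ : Set (Fin n → ℝ))) := fun n t =>
      (isClosed_jumpSimplex n t).measurableSet.prod MeasurableSet.univ
    have hF : ∀ n {t} x, ∫ p, expProduct S t x p.1 p.2 (Y (x - ∑ i, p.2 i)) ∂jumpMeasure ν n t =
        ∫ p, F n t x p ∂((volume : Measure (Fin n → ℝ)).prod (Measure.pi fun _ => ν)) :=
      fun n t x => by
        rw [jumpMeasure_eq_restrict, integral_indicator (hmeas n t)]
    have hint : Integrable (F (m + 1) t x)
        ((volume : Measure (Fin (m + 1) → ℝ)).prod (Measure.pi fun _ => ν)) := by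
      rw [integrable_indicator_iff (hmeas _ t), IntegrableOn, ← jumpMeasure_eq_restrict]
      exact integrable_expProduct hS ν (m + 1) ht x Y
    have hmp := measurePreserving_consJump (m := m) ν
    have hcomp : ∀ q : (ℝ × ℝ) × ((Fin m → ℝ) × (Fin m → ℝ)), F (m + 1) t x (consJump q) =
        (Icc 0 t).indicator (fun a => S x a (F m (t - a) (x - q.1.2) q.2)) q.1.1 := by
      rintro ⟨⟨a, b⟩, ⟨r, z⟩⟩
      simp only [F, consJump]
      by_cases h1 : a ∈ Icc 0 t
      · rw [indicator_of_mem h1]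
        by_cases h2 : r ∈ jumpSimplex m (t - a)
        · rw [indicator_of_mem (mem_prod.2 ⟨consTimes_mem_jumpSimplex.2 ⟨h1, h2⟩, mem_univ _⟩),
            indicator_of_mem (mem_prod.2 ⟨h2, mem_univ _⟩), expProduct_consTimes,
            mul_apply_eq_comp]
          simp only [Fin.sum_univ_succ, Fin.cons_zero, Fin.cons_succ, sub_sub]
        · rw [indicator_of_notMem (fun h => h2 (consTimes_mem_jumpSimplex.1 h.1).2),
            indicator_of_notMem (fun h => h2 h.1), map_zero]
      · rw [indicator_of_notMem (fun h => h1 (consTimes_mem_jumpSimplex.1 h.1).1),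
          indicator_of_notMem h1]
    have hint' : Integrable (fun q => F (m + 1) t x (consJump q))
        (((volume : Measure ℝ).prod ν).prod
          ((volume : Measure (Fin m → ℝ)).prod (Measure.pi fun _ => ν))) :=
      hmp.integrable_comp_of_integrable hint
    rw [hF]
    have e1 : ∫ p, F (m + 1) t x p ∂((volume : Measure (Fin (m + 1) → ℝ)).prod
        (Measure.pi fun _ => ν)) = ∫ q, F (m + 1) t x (consJump q)
          ∂(((volume : Measure ℝ).prod ν).prod
            ((volume : Measure (Fin m → ℝ)).prod (Measure.pi fun _ => ν))) := by
      rw [← hmp.map_eq, integral_map hmp.measurable.aemeasurable]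
      rw [hmp.map_eq]
      exact hint.aestronglyMeasurable
    rw [e1, integral_prod _ hint',
      integral_prod _ hint'.integral_prod_left]
    have e2 : ∀ a b, ∫ q, F (m + 1) t x (consJump ((a, b), q))
        ∂((volume : Measure (Fin m → ℝ)).prod (Measure.pi fun _ => ν)) =
        (Icc 0 t).indicator (fun a => S x a
          (dysonTerm (mulSemigroup hS) (convOp B ν) Y m (t - a) (x - b))) a := by
      intro a b
      simp only [hcomp]
      by_cases h1 : a ∈ Icc 0 t
      · simp only [indicator_of_mem h1]
        have hta : 0 ≤ t - a := by linarith [h1.2]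
        rw [ContinuousLinearMap.integral_comp_comm, ih hta, hF]
        rw [integrable_indicator_iff (hmeas _ _), IntegrableOn, ← jumpMeasure_eq_restrict]
        exact integrable_expProduct hS ν m hta _ Y
      · simp [indicator_of_notMem h1]
    simp only [e2]
    have e3 : ∀ a, ∫ b, (Icc 0 t).indicator (fun a => S x a
        (dysonTerm (mulSemigroup hS) (convOp B ν) Y m (t - a) (x - b))) a ∂ν =
        (Icc 0 t).indicator (fun a => evalAt B x (mulSemigroup hS (max a 0)
          (convOp B ν (dysonTerm (mulSemigroup hS) (convOp B ν) Y m (t - a))))) a := by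
      intro a
      by_cases h1 : a ∈ Icc 0 t
      · simp only [indicator_of_mem h1]
        rw [ContinuousLinearMap.integral_comp_comm _ (integrable_shift ν _ x),
          max_eq_left h1.1, evalAt_apply, mulSemigroup_apply hS h1.1, convOp_apply]
      · simp [indicator_of_notMem h1]
    simp only [e3]
    rw [integral_indicator measurableSet_Icc, integral_Icc_eq_integral_Ioc,
      ← intervalIntegral.integral_of_le ht, dysonTerm, max_eq_left ht,
      ContinuousLinearMap.intervalIntegral_comp_comm _
        (dysonTerm_intervalIntegrable (isC0Semigroup_mulSemigroup hS) (convOp B ν) Y m t 0 t)]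
    rfl

theorem levySemigroup_series [CompleteSpace B] (hS : IsC0Family S) (ν : Measure ℝ)
    [IsFiniteMeasure ν] {t : ℝ} (ht : 0 ≤ t) (Y : C₀(ℝ, B)) (x : ℝ) :
    Summable (fun m : ℕ => ∫ p : (Fin (m + 1) → ℝ) × (Fin (m + 1) → ℝ),
      expProduct S t x p.1 p.2 (Y (x - ∑ i, p.2 i)) ∂jumpMeasure ν (m + 1) t) ∧
    levySemigroup ν hS t Y x = Real.exp (-(t * ν.real univ)) • (S x t (Y x) +
      ∑' m : ℕ, ∫ p : (Fin (m + 1) → ℝ) × (Fin (m + 1) → ℝ),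
        expProduct S t x p.1 p.2 (Y (x - ∑ i, p.2 i)) ∂jumpMeasure ν (m + 1) t) := by
  have h1 := (summable_dysonTerm (isC0Semigroup_mulSemigroup hS) (convOp B ν) Y t).mapL (evalAt B x)
  simp only [evalAt_apply] at h1
  simp only [← dysonTerm_eq_integral hS ν Y _ ht x]
  refine ⟨(summable_nat_add_iff 1).2 h1, ?_⟩
  rw [levySemigroup, perturbExp_apply, ZeroAtInftyContinuousMap.smul_apply, perturb_apply,
    ← evalAt_apply, ContinuousLinearMap.map_tsum _
      (summable_dysonTerm (isC0Semigroup_mulSemigroup hS) _ _ _)]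
  simp only [evalAt_apply]
  rw [h1.tsum_eq_zero_add]
  congr 2
  rw [dysonTerm, max_eq_left ht, mulSemigroup_apply hS ht]

end Series

/-! ### Operator exponentials along the paths -/

section Paths

variable {B D : Type*} [NormedAddCommGroup B] [NormedSpace ℝ B]
  [NormedAddCommGroup D] [NormedSpace ℝ D]

theorem opExp_eq [CompleteSpace B] {ι G : D →L[ℝ] B} (hι : DenseRange ι) {T : ℝ → B →L[ℝ] B}
    (hT : GeneratesWithCore T ι G) : opExp ι G = T 1 := by
  have h : ∃ T : ℝ → B →L[ℝ] B, GeneratesWithCore T ι G := ⟨T, hT⟩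
  rw [opExp, dif_pos h]
  refine h.choose_spec.1.eq_of_generatorGraph_eq hT.1 (h.choose_spec.2.symm.trans hT.2) ?_
    zero_le_one
  refine Dense.mono ?_ hι
  rintro _ ⟨d, rfl⟩
  exact ⟨G d, hT.2 ▸ subset_closure ⟨d, rfl⟩⟩

theorem GeneratesWithCore.const_mul {I : Type*} {T : ℝ → B →L[ℝ] B} {ι G : I → B}
    (hT : GeneratesWithCore T ι G) {r : ℝ} (hr : 0 < r) :
    GeneratesWithCore (fun t => T (r * t)) ι fun d => r • G d := by
  refine ⟨⟨by simpa using hT.1.zero, fun s t hs ht => ?_, fun f => ?_⟩, ?_⟩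
  · rw [mul_add, hT.1.add _ _ (by positivity) (by positivity)]
  · exact (hT.1.cont f).comp (Continuous.continuousOn (by fun_prop))
      fun t ht => mem_Ici.2 (mul_nonneg hr.le ht)
  · let σ : B × B ≃ₜ B × B :=
      (Homeomorph.refl B).prodCongr (Homeomorph.smulOfNeZero r hr.ne')
    have h1 : (range fun d => (ι d, r • G d)) = σ '' range fun d => (ι d, G d) := by
      rw [← range_comp]; rfl
    have hlim : ∀ c : ℝ, 0 < c → Tendsto (fun h : ℝ => c * h) (𝓝[>] 0) (𝓝[>] 0) := by
      intro c hc
      refine tendsto_nhdsWithin_iff.2 ⟨?_, eventually_mem_nhdsWithin.mono fun h hh =>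
        mem_Ioi.2 (mul_pos hc hh)⟩
      have : Tendsto (fun h : ℝ => c * h) (𝓝 0) (𝓝 (c * 0)) := Continuous.tendsto (by fun_prop) 0
      rw [mul_zero] at this
      exact this.mono_left nhdsWithin_le_nhds
    have h2 : generatorGraph (fun t => T (r * t)) = σ '' generatorGraph T := by
      ext ⟨f, g⟩
      rw [← σ.preimage_symm]
      show Tendsto (fun h : ℝ => h⁻¹ • (T (r * h) f - f)) (𝓝[>] 0) (𝓝 g) ↔
        Tendsto (fun h : ℝ => h⁻¹ • (T h f - f)) (𝓝[>] 0) (𝓝 (r⁻¹ • g))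
      constructor
      · intro h
        refine ((h.comp (hlim r⁻¹ (inv_pos.2 hr))).const_smul r⁻¹).congr fun q => ?_
        simp only [Function.comp, smul_smul, mul_inv, inv_inv, mul_inv_cancel_left₀ hr.ne',
          inv_mul_cancel_left₀ hr.ne']
      · intro h
        have := (h.comp (hlim r hr)).const_smul r
        rw [smul_smul, mul_inv_cancel₀ hr.ne', one_smul] at this
        refine this.congr fun q => ?_
        simp only [Function.comp, smul_smul, mul_inv, mul_inv_cancel_left₀ hr.ne']
    rw [h1, h2, ← σ.image_closure, hT.2]

theorem generatesWithCore_zero {I : Type*} {ι : I → B} (hι : DenseRange ι) :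
    GeneratesWithCore (fun _ => (1 : B →L[ℝ] B)) ι fun _ => 0 := by
  refine ⟨⟨rfl, fun _ _ _ _ => (one_mul 1).symm, fun _ => continuousOn_const⟩, ?_⟩
  have h1 : (range fun d => (ι d, (0 : B))) = range ι ×ˢ {0} := by
    ext ⟨f, g⟩
    simp [eq_comm]
  rw [h1, closure_prod_eq, hι.closure_range, closure_singleton]
  ext ⟨f, g⟩
  simp only [mem_prod, mem_univ, true_and, mem_singleton_iff]
  show g = 0 ↔ Tendsto (fun h : ℝ => h⁻¹ • ((1 : B →L[ℝ] B) f - f)) (𝓝[>] 0) (𝓝 g)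
  simp only [one_apply_eq_self, sub_self, smul_zero]
  rw [tendsto_const_nhds_iff, eq_comm]

variable {ι : D →L[ℝ] B} {A : ℝ → D →L[ℝ] B} {SB : ℝ → ℝ → B →L[ℝ] B} {SD : ℝ → ℝ → D →L[ℝ] D}

theorem PairFamily.opExp_smul [CompleteSpace B] (h : PairFamily ι A SB SD) (x : ℝ) {r : ℝ}
    (hr : 0 ≤ r) : opExp ι (r • A x) = SB x r := by
  rcases hr.eq_or_lt with rfl | hr
  · rw [(h.generates x).1.zero]
    refine (opExp_eq h.dense (T := fun _ => 1) ?_)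
    convert generatesWithCore_zero h.dense using 1
    ext d
    simp
  · have := opExp_eq (G := r • A x) h.dense ((h.generates x).const_mul hr)
    simpa using this

theorem jumpPath_eq {m : ℕ} {t : ℝ} (ht : 0 ≤ t) (x : ℝ) {s : Fin m → ℝ} (hs : s ∈ jumpSimplex m t)
    (z : Fin m → ℝ) (j : Fin (m + 1)) {τ : ℝ}
    (hτ : τ ∈ Ioo (jumpTimes t s j.castSucc) (jumpTimes t s j.succ)) :
    jumpPath x s z τ = x - ∑ i : Fin m, if i.castSucc < j then z i else 0 := by
  rw [jumpPath]
  congr 1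
  refine Finset.sum_congr rfl fun i _ => ?_
  have hmono := monotone_jumpTimes ht hs
  have hi := jumpTimes_succ_castSucc t s i
  refine if_congr ?_ rfl rfl
  constructor
  · intro h1
    by_contra h2
    have h3 := hmono (Fin.succ_le_succ_iff.2 (not_lt.1 h2))
    linarith [hτ.2]
  · intro h1
    have h3 : i.castSucc.succ ≤ j.castSucc := by
      rw [Fin.le_def]
      rw [Fin.lt_def] at h1
      simpa using h1
    have h4 := hmono h3
    linarith [hτ.1]

theorem jumpPath_end {m : ℕ} {t : ℝ} (x : ℝ) {s : Fin m → ℝ} (hs : s ∈ jumpSimplex m t)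
    (z : Fin m → ℝ) : jumpPath x s z t = x - ∑ i, z i := by
  rw [jumpPath]
  congr 1
  exact Finset.sum_congr rfl fun i _ => if_pos (hs.2 i).2

theorem PairFamily.pathExpProduct_eq [CompleteSpace B] (h : PairFamily ι A SB SD) {m : ℕ} {t : ℝ}
    (ht : 0 ≤ t) (x : ℝ) {s : Fin m → ℝ} (hs : s ∈ jumpSimplex m t) (z : Fin m → ℝ) :
    pathExpProduct ι A t x s z = expProduct SB t x s z := by
  rw [pathExpProduct, expProduct]
  congr 2
  funext j
  have hle := monotone_jumpTimes ht hs (Fin.castSucc_le_succ j)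
  rw [← h.opExp_smul _ (sub_nonneg.2 hle)]
  congr 1
  rw [intervalIntegral.integral_of_le hle, integral_Ioc_eq_integral_Ioo,
    setIntegral_congr_fun measurableSet_Ioo (g := fun _ => A (x - ∑ i : Fin m,
      if i.castSucc < j then z i else 0)) (fun τ hτ => by
      simp only [jumpPath_eq ht x hs z j hτ]), setIntegral_const]
  simp [hle]

theorem PairFamily.ae_pathExpProduct_eq [CompleteSpace B] (h : PairFamily ι A SB SD)
    (ν : Measure ℝ) [IsFiniteMeasure ν] (m : ℕ) {t : ℝ} (ht : 0 ≤ t) (x : ℝ) (Y : C₀(ℝ, B)) :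
    (fun p : (Fin m → ℝ) × (Fin m → ℝ) =>
      pathExpProduct ι A t x p.1 p.2 (Y (jumpPath x p.1 p.2 t))) =ᵐ[jumpMeasure ν m t]
    fun p => expProduct SB t x p.1 p.2 (Y (x - ∑ i, p.2 i)) := by
  filter_upwards [ae_jumpMeasure_mem ν m t] with p hp
  rw [h.pathExpProduct_eq ht x hp, jumpPath_end x hp]

end Paths

/-! ### Killed spaces -/

section Killed

theorem perturbExp_mem {X : Type*} [NormedAddCommGroup X] [NormedSpace ℝ X] [CompleteSpace X]
    {T : ℝ → X →L[ℝ] X} (hT : IsC0Semigroup T) {K : X →L[ℝ] X} {W : Submodule ℝ X}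
    (hc : IsClosed (W : Set X)) (hW : ∀ t, 0 ≤ t → ∀ f ∈ W, T t f ∈ W) (hK : ∀ f ∈ W, K f ∈ W)
    (c t : ℝ) {f : X} (hf : f ∈ W) : perturbExp hT K c t f ∈ W := by
  have := hc.completeSpace_coe
  have h := perturbExp_intertwine (hT.restrict hW) hT
    (K := (K.comp W.subtypeL).codRestrict W fun f => hK _ f.2) (K' := K) (j := W.subtypeL)
    (fun t f ht => restrictSemigroup_apply hW ht f) (fun _ => rfl) c t ⟨f, hf⟩
  rw [Submodule.subtypeL_apply, Submodule.subtypeL_apply] at h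
  rw [← h]
  exact SetLike.coe_mem _

variable {B : Type*} [NormedAddCommGroup B] [NormedSpace ℝ B]

theorem isClosed_killRay (a : ℝ) : IsClosed (killRay B a : Set C₀(ℝ, B)) := by
  have h : (killRay B a : Set C₀(ℝ, B)) = ⋂ (x : ℝ) (_ : x ≤ a), evalAt B x ⁻¹' {0} := by
    ext f
    simp only [mem_iInter, mem_preimage, mem_singleton_iff]
    exact Iff.rfl
  rw [h]
  exact isClosed_iInter fun x => isClosed_iInter fun _ =>
    isClosed_singleton.preimage (evalAt B x).continuous

theorem levySemigroup_mem_killRay [CompleteSpace B] {S : ℝ → ℝ → B →L[ℝ] B} (hS : IsC0Family S)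
    {ν : Measure ℝ} [IsFiniteMeasure ν] (hν : ν (Iic 0) = 0) (a t : ℝ) (_ : 0 ≤ t)
    (f : C₀(ℝ, B)) (hf : f ∈ killRay B a) : levySemigroup ν hS t f ∈ killRay B a := by
  refine perturbExp_mem (isC0Semigroup_mulSemigroup hS) (isClosed_killRay a)
    (fun t ht f hf x hx => ?_) (fun f hf x hx => ?_) _ _ hf
  · rw [mulSemigroup_apply hS ht, hf x hx, map_zero]
  · rw [convOp_apply]
    refine integral_eq_zero_of_ae ?_
    have h1 : ∀ᵐ z ∂ν, z ∉ Iic 0 := measure_eq_zero_iff_ae_notMem.1 hν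
    filter_upwards [h1] with z hz
    exact hf _ (by linarith [not_le.1 fun h : z ≤ 0 => hz h])

variable {a b : ℝ}

/-- An extension of `f ∈ C_{kill(a)}([a, b], B)` to an element of `C_{kill(a)}([a, ∞), B)`. -/
def killExtend (hab : a ≤ b) : killSegment B a b →L[ℝ] C₀(ℝ, B) :=
  LinearMap.mkContinuous
    { toFun := fun f =>
        { toFun := fun x => max 0 (min 1 (b + 1 - x)) • f.1 (projIcc a b hab x)
          continuous_toFun := by
            have : Continuous f.1 := f.1.continuous
            fun_prop
          zero_at_infty' := by
            refine Tendsto.congr' ?_ tendsto_const_nhds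
            have h1 : Tendsto (fun y : ℝ => ‖y‖) (cocompact ℝ) atTop :=
              tendsto_norm_cocompact_atTop
            filter_upwards [h1.eventually (eventually_ge_atTop (|a| + |b| + 1))] with x hx
            rw [Real.norm_eq_abs] at hx
            rcases le_or_gt x a with h | h
            · rw [f.2 _ (by rw [projIcc_of_le_left hab h]), smul_zero]
            · have h2 : b + 1 ≤ x := by
                rcases abs_cases x with ⟨h3, _⟩ | ⟨h3, _⟩
                · linarith [le_abs_self b, abs_nonneg a]
                · linarith [neg_abs_le a, abs_nonneg b]
              rw [max_eq_left ((min_le_right _ _).trans (by linarith)), zero_smul] }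
      map_add' := fun f g => by ext x; simp
      map_smul' := fun c f => by ext x; exact smul_comm _ c _ } 1 fun f => by
        rw [one_mul]
        refine zeroAtInfty_norm_le (norm_nonneg _) fun x => ?_
        show ‖max 0 (min 1 (b + 1 - x)) • f.1 (projIcc a b hab x)‖ ≤ ‖f‖
        rw [norm_smul, Real.norm_of_nonneg (le_max_left _ _)]
        refine (mul_le_of_le_one_left (norm_nonneg _)
          (max_le zero_le_one (min_le_left _ _))).trans ?_
        exact f.1.norm_coe_le_norm _

theorem killExtend_apply (hab : a ≤ b) (f : killSegment B a b) (x : ℝ) :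
    killExtend hab f x = max 0 (min 1 (b + 1 - x)) • f.1 (projIcc a b hab x) := rfl

theorem killExtend_mem (hab : a ≤ b) (f : killSegment B a b) :
    killExtend hab f ∈ killRay B a := by
  intro x hx
  rw [killExtend_apply, f.2 _ (by rw [projIcc_of_le_left hab hx]), smul_zero]

theorem killExtend_coe (hab : a ≤ b) (f : killSegment B a b) (x : Icc a b) :
    killExtend hab f x = f.1 x := by
  rw [killExtend_apply, projIcc_val, min_eq_left (by linarith [x.2.2]), max_eq_right zero_le_one,
    one_smul]

/-- Restriction of functions to `[a, b]`. -/
def restrictIcc (B : Type*) [NormedAddCommGroup B] [NormedSpace ℝ B] (a b : ℝ) :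
    C₀(ℝ, B) →L[ℝ] C(Icc a b, B) :=
  LinearMap.mkContinuous
    { toFun := fun f => ⟨fun x => f x, by fun_prop⟩
      map_add' := fun _ _ => rfl
      map_smul' := fun _ _ => rfl } 1 fun f => by
        rw [one_mul]
        exact (ContinuousMap.norm_le _ (norm_nonneg _)).2 fun x => norm_apply_le_norm f x

theorem exists_killSegment_semigroup {Φ : ℝ → C₀(ℝ, B) →L[ℝ] C₀(ℝ, B)} (hΦ : IsC0Semigroup Φ)
    (hkill : ∀ a t, 0 ≤ t → ∀ f ∈ killRay B a, Φ t f ∈ killRay B a) (hab : a < b) :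
    ∃ Ψ : ℝ → killSegment B a b →L[ℝ] killSegment B a b, IsC0Semigroup Ψ ∧
      ∀ (t : ℝ) (f : killSegment B a b), 0 ≤ t →
        (∃ Y ∈ killRay B a, ∀ x : Icc a b, Y x = f.1 x) ∧
        ∀ Y ∈ killRay B a, (∀ x : Icc a b, Y x = f.1 x) →
          ∀ x : Icc a b, (Ψ t f).1 x = Φ t Y x := by
  let Ψ : ℝ → killSegment B a b →L[ℝ] killSegment B a b := fun t =>
    ((restrictIcc B a b).comp ((Φ (max t 0)).comp (killExtend hab.le))).codRestrict _
      fun f x hx => hkill a _ (le_max_right _ _) _ (killExtend_mem hab.le f) x hx.le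
  have hΨ : ∀ {t} (f : killSegment B a b), 0 ≤ t → ∀ Y ∈ killRay B a,
      (∀ x : Icc a b, Y x = f.1 x) → ∀ x : Icc a b, (Ψ t f).1 x = Φ t Y x := by
    intro t f ht Y hY hYf x
    have h1 : killExtend hab.le f - Y ∈ killRay B b := by
      intro y hy
      rw [ZeroAtInftyContinuousMap.sub_apply]
      rcases le_total y a with h | h
      · rw [killExtend_mem hab.le f y h, hY y h, sub_zero]
      · rw [killExtend_coe hab.le f ⟨y, h, hy⟩, hYf ⟨y, h, hy⟩, sub_self]
    have h2 := hkill b t ht _ h1 x x.2.2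
    rw [map_sub, ZeroAtInftyContinuousMap.sub_apply, sub_eq_zero] at h2
    rw [← h2]
    show Φ (max t 0) (killExtend hab.le f) x = _
    rw [max_eq_left ht]
  refine ⟨Ψ, ⟨?_, fun s t hs ht => ?_, fun f => ?_⟩, fun t f ht =>
    ⟨⟨_, killExtend_mem hab.le f, killExtend_coe hab.le f⟩, hΨ f ht⟩⟩
  · ext f x
    rw [hΨ f le_rfl _ (killExtend_mem hab.le f) (killExtend_coe hab.le f), hΦ.zero_apply,
      killExtend_coe hab.le f]
    rfl
  · ext f x
    have h1 := hΨ f ht _ (killExtend_mem hab.le f) (killExtend_coe hab.le f)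
    rw [mul_apply_eq_comp, hΨ (Ψ t f) hs (Φ t (killExtend hab.le f))
      (hkill a t ht _ (killExtend_mem hab.le f)) fun x => (h1 x).symm,
      hΨ f (add_nonneg hs ht) _ (killExtend_mem hab.le f) (killExtend_coe hab.le f),
      hΦ.add_apply hs ht]
  · refine (Topology.IsInducing.subtypeVal.continuousOn_iff).2 ?_
    refine ((restrictIcc B a b).continuous.comp_continuousOn
      (hΦ.cont (killExtend hab.le f))).congr fun t ht => ?_
    show restrictIcc B a b (Φ (max t 0) (killExtend hab.le f)) = _
    rw [max_eq_left ht]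
    rfl

end Killed

end

theorem mainTheorem8 {B D E : Type*}
    [NormedAddCommGroup B] [NormedSpace ℝ B] [CompleteSpace B]
    [NormedAddCommGroup D] [NormedSpace ℝ D] [CompleteSpace D]
    [NormedAddCommGroup E] [NormedSpace ℝ E] [CompleteSpace E]
    (ι : D →L[ℝ] B) (κ : E →L[ℝ] D)
    (A : ℝ → D →L[ℝ] B) (A₁ : ℝ → E →L[ℝ] D)
    (SB : ℝ → ℝ → B →L[ℝ] B) (SD : ℝ → ℝ → D →L[ℝ] D) (SE : ℝ → ℝ → E →L[ℝ] E)
    (hA : ThreeSpaceFamily ι κ A A₁ SB SD SE)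
    (ν : Measure ℝ) [IsFiniteMeasure ν] (hν : ν (Iic 0) = 0) :
    ∃ Φ : ℝ → C₀(ℝ, B) →L[ℝ] C₀(ℝ, B),
      -- `L'_ν + A(·)` generates `Φ` in `C_∞(ℝ, B)` with the core `C_∞(ℝ, D)`
      (∃ G : C₀(ℝ, D) → C₀(ℝ, B),
        (∀ f x, G f x = levyAdd ν ι A f x) ∧ GeneratesWithCore Φ (mapC0 ι) G) ∧
      -- `C_∞(ℝ, D)` is invariant, and `Φ` is strongly continuous there
      (∃ ΦD : ℝ → C₀(ℝ, D) →L[ℝ] C₀(ℝ, D), IsC0Semigroup ΦD ∧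
        ∀ t f, 0 ≤ t → mapC0 ι (ΦD t f) = Φ t (mapC0 ι f)) ∧
      -- the series over products of exponentials
      (∀ (t : ℝ) (Y : C₀(ℝ, B)) (x : ℝ), 0 ≤ t →
        (∀ m : ℕ, Integrable (fun p : (Fin m → ℝ) × (Fin m → ℝ) =>
          expProduct SB t x p.1 p.2 (Y (x - ∑ i, p.2 i))) (jumpMeasure ν m t)) ∧
        Summable (fun m : ℕ => ∫ p : (Fin (m + 1) → ℝ) × (Fin (m + 1) → ℝ),
          expProduct SB t x p.1 p.2 (Y (x - ∑ i, p.2 i)) ∂jumpMeasure ν (m + 1) t) ∧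
        Φ t Y x = Real.exp (-(t * ν.real univ)) • (SB x t (Y x) +
          ∑' m : ℕ, ∫ p : (Fin (m + 1) → ℝ) × (Fin (m + 1) → ℝ),
            expProduct SB t x p.1 p.2 (Y (x - ∑ i, p.2 i)) ∂jumpMeasure ν (m + 1) t)) ∧
      -- the same series in terms of the paths `Z_x`
      (∀ (t : ℝ) (Y : C₀(ℝ, B)) (x : ℝ), 0 ≤ t →
        (∀ m : ℕ, Integrable (fun p : (Fin m → ℝ) × (Fin m → ℝ) =>
          pathExpProduct ι A t x p.1 p.2 (Y (jumpPath x p.1 p.2 t))) (jumpMeasure ν m t)) ∧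
        Summable (fun m : ℕ => ∫ p : (Fin (m + 1) → ℝ) × (Fin (m + 1) → ℝ),
          pathExpProduct ι A t x p.1 p.2 (Y (jumpPath x p.1 p.2 t)) ∂jumpMeasure ν (m + 1) t) ∧
        Φ t Y x = Real.exp (-(t * ν.real univ)) • (SB x t (Y x) +
          ∑' m : ℕ, ∫ p : (Fin (m + 1) → ℝ) × (Fin (m + 1) → ℝ),
            pathExpProduct ι A t x p.1 p.2 (Y (jumpPath x p.1 p.2 t))
              ∂jumpMeasure ν (m + 1) t)) ∧
      -- the killed spaces
      (∀ a : ℝ, IsClosed (killRay B a : Set C₀(ℝ, B)) ∧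
        ∃ Ψ : ℝ → killRay B a →L[ℝ] killRay B a, IsC0Semigroup Ψ ∧
          ∀ t f, 0 ≤ t → (Ψ t f : C₀(ℝ, B)) = Φ t f) ∧
      (∀ a b : ℝ, a < b →
        ∃ Ψ : ℝ → killSegment B a b →L[ℝ] killSegment B a b, IsC0Semigroup Ψ ∧
          ∀ (t : ℝ) (f : killSegment B a b), 0 ≤ t →
            (∃ Y ∈ killRay B a, ∀ x : Icc a b, Y x = f.1 x) ∧
            ∀ Y ∈ killRay B a, (∀ x : Icc a b, Y x = f.1 x) →
              ∀ x : Icc a b, (Ψ t f).1 x = Φ t Y x) ∧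
      -- the space `C¹_∞(ℝ, B) ∩ C_∞(ℝ, D)` and its subspace `C¹_∞(ℝ, D) ∩ C_∞(ℝ, E)`
      (DifferentiableFamily A A₁ →
        ∃ Φ₁ : ℝ → C1Space ι →L[ℝ] C1Space ι,
          (∀ t f, 0 ≤ t → mapC0 ι (Φ₁ t f).1.1 = Φ t (mapC0 ι f.1.1)) ∧
          (∃ G₁ : C1Space κ → C1Space ι,
            (∀ f x, (G₁ f).1.1 x = levyAdd ν κ A₁ f.1.1 x) ∧
            GeneratesWithCore Φ₁ (C1Space.incl ι κ) G₁) ∧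
          (StronglyContinuousFamily SE →
            ∃ Φ₂ : ℝ → C1Space κ →L[ℝ] C1Space κ,
              ∀ t f, 0 ≤ t → C1Space.incl ι κ (Φ₂ t f) = Φ₁ t (C1Space.incl ι κ f))) := by
  have hSB := hA.pair.isC0Family
  have hSD := hA.pair₁.isC0Family
  have hkill := levySemigroup_mem_killRay hSB hν
  refine ⟨levySemigroup ν hSB, hA.pair.exists_generator ν hSB hSD,
    ⟨levySemigroup ν hSD, isC0Semigroup_levySemigroup ν hSD, fun t f _ =>
      hA.pair.mapC0_levySemigroup ν hSB hSD t f⟩,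
    fun t Y x ht => ⟨fun m => integrable_expProduct hSB ν m ht x Y,
      levySemigroup_series hSB ν ht Y x⟩,
    fun t Y x ht => ?_,
    fun a => ⟨isClosed_killRay a, restrictSemigroup _ _ (hkill a),
      (isC0Semigroup_levySemigroup ν hSB).restrict (hkill a),
      fun t f ht => restrictSemigroup_apply (hkill a) ht f⟩,
    fun a b hab => exists_killSegment_semigroup (isC0Semigroup_levySemigroup ν hSB) hkill hab,
    fun hd => ⟨hA.pair.c1Levy ν hSB hSD hd.diff hd.deriv_cont, fun t f _ => ?_,
      hA.exists_generator_c1 hd hSB hSD ν, fun hSE => ?_⟩⟩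
  · have h := fun m => hA.pair.ae_pathExpProduct_eq ν m ht x Y
    simp only [integral_congr_ae (h _)]
    exact ⟨fun m => (integrable_expProduct hSB ν m ht x Y).congr (h m).symm,
      levySemigroup_series hSB ν ht Y x⟩
  · rw [hA.pair.c1Levy_fst ν hSB hSD hd.diff hd.deriv_cont,
      hA.pair.mapC0_levySemigroup ν hSB hSD]
  · have hE := hA.pair₁.isC0Family_sub hSE
    refine ⟨hA.pair₁.c1Levy ν hSD hE hd.diff₁ hd.deriv₁_cont, fun t f _ =>
      C1Space.ext_fst fun x => ?_⟩
    rw [hA.pair.c1Levy_fst ν hSB hSD hd.diff hd.deriv_cont]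
    show mapC0 κ (hA.pair₁.c1Levy ν hSD hE hd.diff₁ hd.deriv₁_cont t f).1.1 x =
      levySemigroup ν hSD t (mapC0 κ f.1.1) x
    rw [hA.pair₁.c1Levy_fst ν hSD hE hd.diff₁ hd.deriv₁_cont,
      hA.pair₁.mapC0_levySemigroup ν hSD hE]
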